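/- Let $\mu\in\mathbb R$, $0\le\rho\le 1$, let $M$ be a standard Brownian motion, and consider on $\mathbb R$ (no boundary) the SPDE $$dv=-\mu\,\partial_x v\,dt+\tfrac12\,\partial_{xx}v\,dt-\sqrt\rho\,\partial_x v\,dM_t ,$$ whose solution is $v(t,x)=u(t,x-\sqrt\rho M_t)$, where $u$ solves $\partial_t u=\tfrac12(1-\rho)\partial_{xx}u-\mu\,\partial_x u$ with the same initial data. For a timestep $k>0$ and a grid spacing $h>0$ put $Z_n=(M_{(n+1)k}-M_{nk})/\sqrt k$ and consider the scheme on the grid $\{jh\}_{j\in\mathbb Z}$ $$v_j^{n+1}=v_j^n-\frac{\mu k+\sqrt{\rho k}\,Z_n}{2h}\,(v_{j+1}^n-v_{j-1}^n)+\frac{(1-\rho)k+\rho kZ_n^2}{2h^2}\,(v_{j+1}^n-2v_j^n+v_{j-1}^n).$$ (1) Fourier modes. Let $\kappa\in\mathbb R$. The exact Fourier mode with initial data $e^{i\kappa x}$ is $g(t)e^{i\kappa x}$ with $g(t)=\exp(-\frac12(1-\rho)\kappa^2t-i\kappa(\mu t+\sqrt\rho M_t))$; that is, after the shift $x\mapsto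 x+\sqrt\rho M_t$ it satisfies the PDE for $u$. The scheme started from $v_j^0=e^{i\kappa jh}$ gives $v_j^n=g_ne^{i\kappa jh}$ with $g_0=1$ and $g_{n+1}=(a+bZ_n+cZ_n^2)g_n$, where $$a=1-\frac{i\mu k}{h}\sin\kappa h-\frac{2(1-\rho)k}{h^2}\sin^2\frac{\kappa h}2,\qquad b=-\frac{i\sqrt{\rho k}}{h}\sin\kappa h,\qquad c=-\frac{2\rho k}{h^2}\sin^2\frac{\kappa h}2 .$$ There is $\delta>0$, depending only on $\mu,\rho,\kappa$, such that for all $0<k\le\delta$, $0<h\le\delta$ and all $n\ge 0$ one can write $$a+bZ_n+cZ_n^2=\exp\bigl(-\tfrac12(1-\rho)\kappa^2k-i\kappa(\mu k+\sqrt{\rho k}\,Z_n)+e_n\bigr),$$ where $e_n$ is given by the principal branch of the logarithm. Put $$r_n=e_n-\sqrt{\rho k}\,\kappa^2\mu k\,Z_n+\tfrac16\,i\sqrt{\rho k}\,\kappa^3Z_n\bigl(3(1-\rho)k+\rho kZ_n^2-h^2\bigr).$$ (1a) For every $p\ge1$ and every $\Lambda$ there is a constant $c(\kappa,p)$, depending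 also on $\mu,\rho,\Lambda$ only, such that $\mathbb E|r_n|^p\le c(\kappa,p)\,(k^2+kh^2)^p$ for all $n$ and all $0<k,h\le\delta$ with $\rho h^4\le\Lambda k$. (1b) For every $T>0$ there is a constant $C$, depending only on $\mu,\rho,\kappa,T$, such that for all $0<k,h\le\delta$, all $n$ with $nk\le T$ and all $j$ $$\Bigl(\mathbb E\Bigl|\sum_{m<n}e_m\Bigr|^2\Bigr)^{1/2}\le C(k+h^2),\qquad \bigl(\mathbb E\,|g_ne^{i\kappa jh}-g(nk)e^{i\kappa jh}|^2\bigr)^{1/2}\le C(k+h^2).$$ (2) Grid errors. Let $\rho<1$, let $\lambda$ satisfy $(1+2\rho^2)\lambda<1$, and let $0<T_0\le T$. There are $\delta>0$ and $C$, depending only on $\mu,\rho,\lambda,T_0,T$, such that the following holds. Let $\nu$ be any finite Borel measure on $\mathbb R$ and let $v$ be the solution of the SPDE with initial measure $\nu$. Here $u$ is a classical ($C^2$) solution for $t>0$, integrable in $x$, with $\int|u(t,x)|\,dx$ bounded for $t\in(0,S]$ for each $S$, and $u(t,\cdot)\,dx\to\nu$ weakly as $t\downarrow0$. Start the scheme from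 the hat-function projection $$v_j^0=\frac1h\int_{\mathbb R}\Psi_j\,d\nu,\qquad \Psi_j(x)=\frac1h\max(h-|x-jh|,0).$$ Then for all $k>0$, $0<h\le\delta$ with $k\le\lambda h^2$ and all $n$ with $T_0\le nk\le T$ $$\Bigl(\mathbb E\Bigl[h\sum_{j\in\mathbb Z}|v_j^n-v(nk,jh)|^2\Bigr]\Bigr)^{1/2}\le C\,\nu(\mathbb R)\,(k+h^2),\qquad \Bigl(\mathbb E\Bigl[\sup_{j\in\mathbb Z}|v_j^n-v(nk,jh)|^2\Bigr]\Bigr)^{1/2}\le C\,\nu(\mathbb R)\,(k+h^2).$$ -/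

import Mathlib

open MeasureTheory ProbabilityTheory Filter Topology
open scoped NNReal ENNReal BoundedContinuousFunction

universe u

noncomputable section

namespace MilsteinSPDE

/-! ### The equation on the real line -/

/-- `u` satisfies `∂ₜu = ½(1-ρ) ∂ₓₓu - μ ∂ₓu` at every `t > 0`, `x ∈ ℝ`. -/
def SatisfiesPDE {E : Type*} [NormedAddCommGroup E] [NormedSpace ℝ E]
    (μ ρ : ℝ) (u : ℝ → ℝ → E) : Prop :=
  ∀ t : ℝ, 0 < t → ∀ x : ℝ,
    deriv (fun s => u s x) t
      = ((1 / 2) * (1 - ρ)) • iteratedDeriv 2 (u t) x - μ • deriv (u t) x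

/-- `u` is a classical solution for `t > 0` of `∂ₜu = ½(1-ρ) ∂ₓₓu - μ ∂ₓu`, integrable in `x`
with locally bounded total mass, whose initial value is the measure `ν` in the sense of weak
convergence. -/
structure IsPDESolution (μ ρ : ℝ) (ν : Measure ℝ) (u : ℝ → ℝ → ℝ) : Prop where
  contDiffOn : ContDiffOn ℝ 2 (Function.uncurry u) (Set.Ioi 0 ×ˢ Set.univ)
  pde : SatisfiesPDE μ ρ u
  integrable : ∀ t : ℝ, 0 < t → Integrable (u t)
  mass_bounded : ∀ T : ℝ, ∃ B : ℝ, ∀ t : ℝ, 0 < t → t ≤ T → ∫ x, |u t x| ≤ B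
  initial : ∀ φ : ℝ →ᵇ ℝ, Tendsto (fun t => ∫ x, φ x * u t x) (𝓝[>] 0) (𝓝 (∫ x, φ x ∂ν))

/-- The random field `v` is the solution on `ℝ` of
`dv = -μ ∂ₓv dt + ½ ∂ₓₓv dt - √ρ ∂ₓv dM` with initial measure `ν`: almost surely
`v(t, x) = u(t, x - √ρ M_t)`, i.e. `u(t, x) = v(t, x + √ρ M_t)`, where `u` solves
`∂ₜu = ½(1-ρ) ∂ₓₓu - μ ∂ₓu` with initial measure `ν`. -/
def IsSPDESolution {Ω : Type*} [MeasurableSpace Ω] (μ ρ : ℝ) (ν : Measure ℝ)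
    (M : ℝ≥0 → Ω → ℝ) (P : Measure Ω) (v : ℝ → ℝ → Ω → ℝ) : Prop :=
  ∀ᵐ ω ∂P, IsPDESolution μ ρ ν (fun t x => v t (x + √ρ * M t.toNNReal ω) ω)

/-! ### The finite difference scheme on the grid `hℤ` -/

/-- One time step of the Milstein central difference scheme with normalised noise `z`. -/
def milsteinStep {E : Type*} [AddCommGroup E] [Module ℝ E]
    (μ ρ k h z : ℝ) (v : ℤ → E) : ℤ → E := fun j =>
  v j - ((μ * k + √(ρ * k) * z) / (2 * h)) • (v (j + 1) - v (j - 1))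
    + (((1 - ρ) * k + ρ * k * z ^ 2) / (2 * h ^ 2)) • (v (j + 1) - (2 : ℝ) • v j + v (j - 1))

/-- The grid solution `v_j^n` with noise sequence `Z` and initial grid values `v0`. -/
def gridSolution {E : Type*} [AddCommGroup E] [Module ℝ E]
    (μ ρ k h : ℝ) (Z : ℕ → ℝ) (v0 : ℤ → E) : ℕ → ℤ → E
  | 0 => v0
  | n + 1 => milsteinStep μ ρ k h (Z n) (gridSolution μ ρ k h Z v0 n)

/-- The normalised increment `Z_n = (M_{(n+1)k} - M_{nk}) / √k`. -/
def noise {Ω : Type*} (M : ℝ≥0 → Ω → ℝ) (k : ℝ) (n : ℕ) (ω : Ω) : ℝ :=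
  (M (((n : ℝ) + 1) * k).toNNReal ω - M ((n : ℝ) * k).toNNReal ω) / √k

/-- The hat function `Ψ_j(x) = h⁻¹ max(h - |x - jh|, 0)`, of height one and integral `h`. -/
def hat (h : ℝ) (j : ℤ) (x : ℝ) : ℝ := (1 / h) * max (h - |x - j * h|) 0

/-- The hat-function projection `v_j^0 = h⁻¹ ∫ Ψ_j dν` of the initial measure. -/
def hatProjection (h : ℝ) (ν : Measure ℝ) (j : ℤ) : ℝ := (1 / h) * ∫ x, hat h j x ∂ν

/-! ### Fourier modes -/

/-- `a(θ)`. -/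
def coefA (μ ρ k h θ : ℝ) : ℂ :=
  1 - Complex.I * ((μ * k / h * Real.sin θ : ℝ) : ℂ)
    - ((2 * (1 - ρ) * k / h ^ 2 * Real.sin (θ / 2) ^ 2 : ℝ) : ℂ)

/-- `b(θ)`. -/
def coefB (ρ k h θ : ℝ) : ℂ := -(Complex.I * ((√(ρ * k) / h * Real.sin θ : ℝ) : ℂ))

/-- `c(θ)`. -/
def coefC (ρ k h θ : ℝ) : ℂ := -((2 * ρ * k / h ^ 2 * Real.sin (θ / 2) ^ 2 : ℝ) : ℂ)

/-- The numerical amplification factor `a(κh) + b(κh) z + c(κh) z²`. -/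
def ampFactor (μ ρ κ k h z : ℝ) : ℂ :=
  coefA μ ρ k h (κ * h) + coefB ρ k h (κ * h) * z + coefC ρ k h (κ * h) * (z : ℂ) ^ 2

/-- The exponent `-½(1-ρ)κ² t - iκ(μ t + √ρ m)` of the exact mode at time `t` when `M_t = m`. -/
def exactExponent (μ ρ κ t m : ℝ) : ℂ :=
  -(((1 / 2) * (1 - ρ) * κ ^ 2 * t : ℝ) : ℂ) - Complex.I * ((κ * (μ * t + √ρ * m) : ℝ) : ℂ)

/-- The spatial mode `exp(iκx)`. -/
def mode (κ x : ℝ) : ℂ := Complex.exp (Complex.I * ((κ * x : ℝ) : ℂ))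

/-- The exact Fourier mode `g(t) exp(iκx)` with `g(0) = 1`, when `M_t = m`. -/
def exactMode (μ ρ κ t m x : ℝ) : ℂ := Complex.exp (exactExponent μ ρ κ t m) * mode κ x

/-- The error `e` of one time step, where
`a + b z + c z² = exp(-½(1-ρ)κ² k - iκ(μ k + √ρ √k z) + e)` (principal logarithm). -/
def stepError (μ ρ κ k h z : ℝ) : ℂ :=
  Complex.log (ampFactor μ ρ κ k h z * Complex.exp (-exactExponent μ ρ κ k (√k * z)))

/-- The leading part of the error of one time step. -/
def leadingError (μ ρ κ k h z : ℝ) : ℂ :=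
  ((√(ρ * k) * κ ^ 2 * μ * k * z : ℝ) : ℂ)
    - (1 / 6 : ℂ) * Complex.I *
      ((√(ρ * k) * κ ^ 3 * z * (3 * (1 - ρ) * k + ρ * k * z ^ 2 - h ^ 2) : ℝ) : ℂ)

/-- The remainder `r = e - (leading part)`. -/
def remainder (μ ρ κ k h z : ℝ) : ℂ := stepError μ ρ κ k h z - leadingError μ ρ κ k h z

/-! ### Norms -/

/-- The root mean square `(E F²)^{1/2}` of a nonnegative random variable. -/
def rms {Ω : Type*} [MeasurableSpace Ω] (P : Measure Ω) (F : Ω → ℝ≥0∞) : ℝ≥0∞ :=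
  (∫⁻ ω, F ω ^ 2 ∂P) ^ (1 / 2 : ℝ)

/-- The discrete `L₂` norm `(h Σ_j |f_j|²)^{1/2}` on the grid `hℤ`. -/
def gridL2 (h : ℝ) (f : ℤ → ℝ) : ℝ≥0∞ :=
  (∑' j : ℤ, ENNReal.ofReal h * ‖f j‖ₑ ^ 2) ^ (1 / 2 : ℝ)

/-- The discrete `L_∞` norm `sup_j |f_j|`. -/
def gridLinf (f : ℤ → ℝ) : ℝ≥0∞ := ⨆ j : ℤ, ‖f j‖ₑ

end MilsteinSPDE

end

open MilsteinSPDE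

namespace MilsteinSPDE

/-! Fourier modes diagonalise both evolutions. One step of the scheme multiplies e^{iκjh} by
a+bZ+cZ², and one step of the equation multiplies it by e^E, where E = -½(1-ρ)κ²k - iκ(μk+√(ρk)Z).
Expanding e^E to third order gives a+bZ+cZ²-e^E = O+R, where O is an odd polynomial in Z with
coefficients of size √k(k+h²), and R has size k(k+h²). The Z² in front of the second difference
cancels the even term of order k (`oneStepRest_eq`, `norm_oneStepRest_le`). All bounds hold for
every value of Z, at the price of powers of `waveScale` and `noiseScale`. Since O has mean zero, one
step has mean square error O(k(k+h²)²) and mean error O(k(k+h²)), and about T/k independent steps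
add up to a root mean square error O(k+h²).

For products this accumulation is elementary. If the factors are i.i.d., then E|∏f-∏g|² = αⁿ-2Re
βⁿ+γⁿ with α = E|f|², β = E f conj(g), γ = E|g|². Induction (`pow_sub_two_re_pow_add_pow_le`) bounds
this by nGⁿ⁻¹(E|f-g|² + |E f conj(f-g)|²/τ) whenever α+τ ≤ G and γ ≤ G. With τ = k only one-step
moments are needed. For a fixed κ, G = 1+O(k) suffices. If (1+2ρ²)λ < 1, the explicit second moment
of the amplification factor allows G = exp(-cκ²k+Lk) for all |κ|h ≤ π, so the error of a mode decays
like e^{-cT₀κ²} up to a power of κ once nk ≥ T₀.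

The logarithmic error is log(1+x) with x = (a+bZ+cZ²-e^E)e^{-E}. For small x it is expanded. For
large x, a power of the noise scale times k(k+h²) already exceeds a constant, and a crude bound on
the logarithm suffices. That bound needs the amplification factor to stay away from zero for every Z
(`quarter_le_norm_ampFactor`).

For the grid errors, testing the PDE against cut-off exponentials determines the Fourier transform
of any admissible u, and its Gaussian decay permits inversion. The hat projection is a Fourier
integral over |κ| ≤ π/h whose symbol is within O(κ²h²)ν(ℝ) of the transform of ν. The grid error is
thus the inverse transform of a symbol with mean square (k+h²)² times a polynomial times a Gaussian
in κ. Cauchy–Schwarz with a Gaussian weight yields the sup norm; duality and a Schur test for a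
Gaussian Gram matrix yield the discrete L₂ norm. -/

/-! ### Taylor estimates and the pointwise one-step error of a mode -/

lemma abs_self_sub_sin_le (x : ℝ) : |x - Real.sin x| ≤ |x| ^ 3 / 6 := by
  have key : ∀ y : ℝ, 0 < y → |y - Real.sin y| ≤ |y| ^ 3 / 6 := fun y hy => by
    rw [abs_of_nonneg (sub_nonneg.2 (Real.sin_lt hy).le), abs_of_pos hy]
    linarith [Real.sin_gt_sub_cube hy]
  rcases lt_trichotomy x 0 with h | rfl | h
  · have := key (-x) (by linarith)
    rwa [Real.sin_neg, abs_neg, show -x - -Real.sin x = -(x - Real.sin x) by ring, abs_neg] at this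
  · simp
  · exact key x h

lemma abs_sub_sin_div_le (κ : ℝ) {h : ℝ} (hh : 0 < h) :
    |κ - Real.sin (κ * h) / h| ≤ |κ| ^ 3 * h ^ 2 / 6 := by
  have h1 := abs_self_sub_sin_le (κ * h)
  have : κ - Real.sin (κ * h) / h = (κ * h - Real.sin (κ * h)) / h := by field_simp
  rw [this, abs_div, abs_of_pos hh, div_le_iff₀ hh]
  rw [abs_mul, abs_of_pos hh] at h1
  linarith

lemma abs_sq_sub_four_sin_sq_div_le (κ : ℝ) {h : ℝ} (hh : 0 < h) :
    |κ ^ 2 - 4 * Real.sin (κ * h / 2) ^ 2 / h ^ 2| ≤ κ ^ 4 * h ^ 2 / 12 := by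
  have h1 := abs_self_sub_sin_le (κ * h / 2)
  have h2 : |κ * h / 2 + Real.sin (κ * h / 2)| ≤ 2 * |κ * h / 2| := by
    linarith [abs_add_le (κ * h / 2) (Real.sin (κ * h / 2)), Real.abs_sin_le_abs (x := κ * h / 2)]
  have : κ ^ 2 - 4 * Real.sin (κ * h / 2) ^ 2 / h ^ 2
      = 4 * ((κ * h / 2 - Real.sin (κ * h / 2)) * (κ * h / 2 + Real.sin (κ * h / 2))) / h ^ 2 := by
    field_simp; ring
  rw [this, abs_div, abs_of_pos (by positivity : 0 < h ^ 2), div_le_iff₀ (by positivity), abs_mul,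
    abs_mul]
  have h3 := mul_le_mul h1 h2 (abs_nonneg _) (by positivity)
  have h4 : |κ * h / 2| ^ 3 / 6 * (2 * |κ * h / 2|) = (κ * h / 2) ^ 4 / 3 := by
    rw [← (show Even 4 by decide).pow_abs (κ * h / 2)]; ring
  rw [h4] at h3
  rw [abs_of_pos (by norm_num : (0 : ℝ) < 4)]
  nlinarith

/-- Taylor's theorem covers ‖E‖ ≤ 1. In the left half-plane the exponential is bounded by 1, so for
larger E the fourth power dominates trivially. No smallness is assumed because the Gaussian noise
makes E unbounded. -/
lemma norm_exp_sub_cubic_le {E : ℂ} (hE : E.re ≤ 0) :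
    ‖Complex.exp E - (1 + E + E ^ 2 / 2 + E ^ 3 / 6)‖ ≤ 4 * ‖E‖ ^ 4 := by
  have hs : ∑ m ∈ Finset.range 4, E ^ m / (m.factorial : ℂ) = 1 + E + E ^ 2 / 2 + E ^ 3 / 6 := by
    simp [Finset.sum_range_succ, Nat.factorial]
  rcases le_total ‖E‖ 1 with h | h
  · have := Complex.norm_exp_sub_sum_le_norm_mul_exp E 4
    rw [hs] at this
    have h3 : Real.exp ‖E‖ ≤ 4 := by
      have := Real.exp_le_exp.2 h
      linarith [Real.exp_one_lt_d9]
    nlinarith [pow_nonneg (norm_nonneg E) 4]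
  · have h0 : ‖Complex.exp E‖ ≤ 1 := by rw [Complex.norm_exp]; exact Real.exp_le_one_iff.2 hE
    have h1 : ‖1 + E + E ^ 2 / 2 + E ^ 3 / 6‖ ≤ 1 + ‖E‖ + ‖E‖ ^ 2 / 2 + ‖E‖ ^ 3 / 6 := by
      refine (norm_add_le _ _).trans (add_le_add ((norm_add_le _ _).trans
        (add_le_add ((norm_add_le _ _).trans ?_) ?_)) ?_) <;> simp
    have h2 := norm_sub_le (Complex.exp E) (1 + E + E ^ 2 / 2 + E ^ 3 / 6)
    have p1 : (1 : ℝ) ≤ ‖E‖ ^ 4 := one_le_pow₀ h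
    have p2 : ‖E‖ ≤ ‖E‖ ^ 4 := le_self_pow₀ h (by norm_num)
    have p3 : ‖E‖ ^ 2 ≤ ‖E‖ ^ 4 := pow_le_pow_right₀ h (by norm_num)
    have p4 : ‖E‖ ^ 3 ≤ ‖E‖ ^ 4 := pow_le_pow_right₀ h (by norm_num)
    linarith

/-- The part `½(1-ρ)κ²k + iκμk` of the exponent that does not involve the noise. -/
noncomputable def drift (μ ρ κ k : ℝ) : ℂ :=
  ((κ ^ 2 * (1 - ρ) * k / 2 : ℝ) : ℂ) + Complex.I * ((κ * μ * k : ℝ) : ℂ)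

/-- The coefficient of `z` in the odd part of the one-step error. -/
noncomputable def linCoef (μ ρ κ k h : ℝ) : ℂ :=
  Complex.I * (√(ρ * k) : ℝ) * (((κ - Real.sin (κ * h) / h : ℝ) : ℂ) - κ * drift μ ρ κ k)

/-- The coefficient of `z³` in the odd part of the one-step error. -/
noncomputable def cubCoef (ρ κ k : ℝ) : ℂ := -(Complex.I * ((κ * √(ρ * k) : ℝ) : ℂ) ^ 3 / 6)

/-- The remainder of the one-step error beyond its odd part. -/
noncomputable def oneStepRest (μ ρ κ k h z : ℝ) : ℂ :=
  ampFactor μ ρ κ k h z - Complex.exp (exactExponent μ ρ κ k (√k * z))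
    - (linCoef μ ρ κ k h * z + cubCoef ρ κ k * (z : ℂ) ^ 3)

lemma exactExponent_eq {ρ : ℝ} (hρ0 : 0 ≤ ρ) (μ κ k z : ℝ) :
    exactExponent μ ρ κ k (√k * z)
      = -drift μ ρ κ k - Complex.I * ((κ * √(ρ * k) : ℝ) : ℂ) * z := by
  rw [exactExponent, drift, Real.sqrt_mul hρ0]
  push_cast
  ring

lemma exactExponent_re (μ ρ κ t m : ℝ) :
    (exactExponent μ ρ κ t m).re = -((1 / 2) * (1 - ρ) * κ ^ 2 * t) := by
  rw [exactExponent, Complex.sub_re, Complex.neg_re, Complex.ofReal_re, Complex.re_mul_ofReal,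
    Complex.I_re, zero_mul, sub_zero]

/-- Here E = -B - iw with B of order k and w of order √k. After subtracting the cubic Taylor
polynomial of the exponential, the terms iBw and w³, of order k^{3/2} and odd in z, go into
`linCoef` and `cubCoef`. The term w²/2 is matched by the z² part of the second difference. What
stays is spatial truncation times k, and products of order at least k². -/
lemma oneStepRest_eq {ρ : ℝ} (hρ0 : 0 ≤ ρ) (μ κ z : ℝ) {k h : ℝ} (hk : 0 ≤ k) (hh : h ≠ 0) :
    let E := exactExponent μ ρ κ k (√k * z)
    let B := drift μ ρ κ k
    let w : ℂ := ((κ * √(ρ * k) : ℝ) : ℂ) * z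
    oneStepRest μ ρ κ k h z =
      Complex.I * ((μ * k * (κ - Real.sin (κ * h) / h) : ℝ) : ℂ)
      + ((((1 - ρ) * k + ρ * k * z ^ 2) / 2
          * (κ ^ 2 - 4 * Real.sin (κ * h / 2) ^ 2 / h ^ 2) : ℝ) : ℂ)
      + (-(B ^ 2 / 2) + B ^ 3 / 6 + Complex.I * B ^ 2 * w / 2 - B * w ^ 2 / 2)
      + -(Complex.exp E - (1 + E + E ^ 2 / 2 + E ^ 3 / 6)) := by
  intro E B w
  have hs : ((√(ρ * k) : ℝ) : ℂ) ^ 2 = ρ * k := by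
    rw [← Complex.ofReal_pow, Real.sq_sqrt (mul_nonneg hρ0 hk)]; push_cast; ring
  have hh' : (h : ℂ) ≠ 0 := by exact_mod_cast hh
  have hE : E = -B - Complex.I * w := by
    simp only [E, B, w]; rw [exactExponent_eq hρ0]; ring
  have hI := Complex.I_sq
  have hI3 : Complex.I ^ 3 = -Complex.I := by rw [pow_succ, hI]; ring
  have hB : B = ((κ ^ 2 * (1 - ρ) * k / 2 : ℝ) : ℂ) + Complex.I * ((κ * μ * k : ℝ) : ℂ) := rfl
  have hw2 : w ^ 2 = κ ^ 2 * ρ * k * z ^ 2 := by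
    simp only [w]; push_cast; rw [mul_pow, mul_pow, hs]; ring
  have key : 1 + E + E ^ 2 / 2 + E ^ 3 / 6
      = 1 - B - Complex.I * w + B ^ 2 / 2 + Complex.I * B * w - w ^ 2 / 2 - B ^ 3 / 6
        - Complex.I * B ^ 2 * w / 2 + B * w ^ 2 / 2 + Complex.I * w ^ 3 / 6 := by
    rw [hE]
    linear_combination (w ^ 2 / 2 - B * w ^ 2 / 2) * hI - w ^ 3 / 6 * hI3
  have hlin : linCoef μ ρ κ k h * z
      = Complex.I * (√(ρ * k) : ℝ) * ((κ - Real.sin (κ * h) / h : ℝ) : ℂ) * z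
        - Complex.I * B * w := by
    simp only [linCoef, B, w]; push_cast; ring
  have hcub : cubCoef ρ κ k * (z : ℂ) ^ 3 = -(Complex.I * w ^ 3 / 6) := by
    simp only [cubCoef, w]; ring
  have hrw : oneStepRest μ ρ κ k h z = ampFactor μ ρ κ k h z
      - (1 + E + E ^ 2 / 2 + E ^ 3 / 6)
      - (linCoef μ ρ κ k h * z + cubCoef ρ κ k * (z : ℂ) ^ 3)
      + -(Complex.exp E - (1 + E + E ^ 2 / 2 + E ^ 3 / 6)) := by
    simp only [oneStepRest, E]; ring
  rw [hrw, hlin, hcub, key]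
  congr 1
  have hamp : ampFactor μ ρ κ k h z = 1
      - Complex.I * ((μ * k * Real.sin (κ * h) / h : ℝ) : ℂ)
      - Complex.I * ((√(ρ * k) * (Real.sin (κ * h) / h) : ℝ) : ℂ) * z
      - ((((1 - ρ) * k + ρ * k * z ^ 2) / 2
          * (4 * Real.sin (κ * h / 2) ^ 2 / h ^ 2) : ℝ) : ℂ) := by
    simp only [ampFactor, coefA, coefB, coefC]
    push_cast
    field_simp
    ring
  rw [hamp, hw2, hB]
  simp only [w]
  push_cast
  ring

/-- A common bound for the powers of the wave number in the one-step error. -/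
noncomputable def waveScale (μ κ : ℝ) : ℝ := (1 + |μ|) * (1 + κ ^ 2)

lemma one_le_waveScale (μ κ : ℝ) : 1 ≤ waveScale μ κ := by
  unfold waveScale; nlinarith [abs_nonneg μ, sq_nonneg κ, mul_nonneg (abs_nonneg μ) (sq_nonneg κ)]

lemma waveScale_pos (μ κ : ℝ) : 0 < waveScale μ κ := one_pos.trans_le (one_le_waveScale μ κ)

lemma sq_le_waveScale (μ κ : ℝ) : κ ^ 2 ≤ waveScale μ κ := by
  unfold waveScale; nlinarith [abs_nonneg μ, sq_nonneg κ, mul_nonneg (abs_nonneg μ) (sq_nonneg κ)]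

lemma abs_le_one_add_sq (κ : ℝ) : |κ| ≤ 1 + κ ^ 2 := by
  rw [← sq_abs]; nlinarith [sq_nonneg (|κ| - 1), abs_nonneg κ]

lemma abs_mul_le_waveScale (μ κ : ℝ) : (1 + |μ|) * |κ| ≤ waveScale μ κ :=
  mul_le_mul_of_nonneg_left (abs_le_one_add_sq κ) (by positivity)

lemma abs_le_waveScale (μ κ : ℝ) : |κ| ≤ waveScale μ κ := by
  nlinarith [abs_mul_le_waveScale μ κ, abs_nonneg μ, abs_nonneg κ,
    mul_nonneg (abs_nonneg μ) (abs_nonneg κ)]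

lemma norm_drift_le {ρ : ℝ} (hρ0 : 0 ≤ ρ) (hρ1 : ρ ≤ 1) (μ κ : ℝ) {k : ℝ} (hk : 0 ≤ k) :
    ‖drift μ ρ κ k‖ ≤ 3 / 2 * waveScale μ κ * k := by
  have h1 : ‖((κ ^ 2 * (1 - ρ) * k / 2 : ℝ) : ℂ)‖ ≤ waveScale μ κ * k / 2 := by
    rw [Complex.norm_real, Real.norm_of_nonneg
      (by have := sub_nonneg.2 hρ1; positivity)]
    have : κ ^ 2 * (1 - ρ) ≤ waveScale μ κ :=
      (mul_le_of_le_one_right (sq_nonneg κ) (by linarith)).trans (sq_le_waveScale μ κ)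
    have := mul_le_mul_of_nonneg_right this hk
    linarith
  have h2 : ‖Complex.I * ((κ * μ * k : ℝ) : ℂ)‖ ≤ waveScale μ κ * k := by
    rw [norm_mul, Complex.norm_I, one_mul, Complex.norm_real, Real.norm_eq_abs, abs_mul,
      abs_of_nonneg hk, abs_mul]
    refine mul_le_mul_of_nonneg_right ?_ hk
    have := abs_mul_le_waveScale μ κ
    nlinarith [abs_nonneg κ]
  have := norm_add_le ((κ ^ 2 * (1 - ρ) * k / 2 : ℝ) : ℂ) (Complex.I * ((κ * μ * k : ℝ) : ℂ))
  unfold drift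
  linarith

lemma sqrt_mul_le {ρ k : ℝ} (hρ0 : 0 ≤ ρ) (hρ1 : ρ ≤ 1) : √(ρ * k) ≤ √k := by
  rw [Real.sqrt_mul hρ0]
  exact mul_le_of_le_one_left (Real.sqrt_nonneg _) (Real.sqrt_le_one.2 hρ1)

lemma norm_linCoef_le {ρ : ℝ} (hρ0 : 0 ≤ ρ) (hρ1 : ρ ≤ 1) (μ κ : ℝ) {k h : ℝ}
    (hk : 0 ≤ k) (hh : 0 < h) :
    ‖linCoef μ ρ κ k h‖ ≤ 2 * waveScale μ κ ^ 2 * (√k * (k + h ^ 2)) := by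
  set U := waveScale μ κ
  have hU1 : 1 ≤ U := one_le_waveScale μ κ
  have hκ : |κ| ≤ U := abs_le_waveScale μ κ
  have h1 : ‖((κ - Real.sin (κ * h) / h : ℝ) : ℂ)‖ ≤ U ^ 2 * h ^ 2 := by
    rw [Complex.norm_real, Real.norm_eq_abs]
    refine (abs_sub_sin_div_le κ hh).trans ?_
    have : |κ| ^ 3 ≤ U ^ 2 := by
      have h2 : |κ| ^ 2 ≤ U := by rw [sq_abs]; exact sq_le_waveScale μ κ
      calc |κ| ^ 3 = |κ| * |κ| ^ 2 := by ring
        _ ≤ U * U := mul_le_mul hκ h2 (by positivity) (by positivity)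
        _ = U ^ 2 := by ring
    have := mul_le_mul_of_nonneg_right this (sq_nonneg h)
    nlinarith [mul_nonneg (sq_nonneg U) (sq_nonneg h)]
  have h2 : ‖(κ : ℂ) * drift μ ρ κ k‖ ≤ 3 / 2 * U ^ 2 * k := by
    rw [norm_mul, Complex.norm_real, Real.norm_eq_abs]
    calc |κ| * ‖drift μ ρ κ k‖ ≤ U * (3 / 2 * U * k) :=
          mul_le_mul hκ (norm_drift_le hρ0 hρ1 μ κ hk) (norm_nonneg _) (by positivity)
      _ = _ := by ring
  have h3 := norm_sub_le ((κ - Real.sin (κ * h) / h : ℝ) : ℂ) ((κ : ℂ) * drift μ ρ κ k)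
  rw [linCoef, norm_mul, norm_mul, Complex.norm_I, one_mul, Complex.norm_real,
    Real.norm_of_nonneg (Real.sqrt_nonneg _)]
  calc _ ≤ √k * (2 * U ^ 2 * (k + h ^ 2)) := by
        refine mul_le_mul (sqrt_mul_le hρ0 hρ1) (h3.trans ?_) (norm_nonneg _) (Real.sqrt_nonneg _)
        nlinarith [mul_nonneg (sq_nonneg U) (sq_nonneg h), mul_nonneg (sq_nonneg U) hk]
    _ = _ := by ring

lemma norm_cubCoef_le {ρ : ℝ} (hρ0 : 0 ≤ ρ) (hρ1 : ρ ≤ 1) (μ κ : ℝ) {k : ℝ} (hk : 0 ≤ k) (h : ℝ) :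
    ‖cubCoef ρ κ k‖ ≤ waveScale μ κ ^ 2 * (√k * (k + h ^ 2)) := by
  set U := waveScale μ κ
  have h2 : |κ| ^ 2 ≤ U := by rw [sq_abs]; exact sq_le_waveScale μ κ
  have hU1 : 1 ≤ U := one_le_waveScale μ κ
  have h3 : |κ| ^ 3 ≤ U ^ 2 := by
    calc |κ| ^ 3 = |κ| * |κ| ^ 2 := by ring
      _ ≤ U * U := mul_le_mul (abs_le_waveScale μ κ) h2 (by positivity) (by positivity)
      _ = U ^ 2 := by ring
  have h4 : √(ρ * k) ^ 3 ≤ √k * k := by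
    calc √(ρ * k) ^ 3 ≤ √k ^ 3 := pow_le_pow_left₀ (Real.sqrt_nonneg _) (sqrt_mul_le hρ0 hρ1) 3
      _ = √k * √k ^ 2 := by ring
      _ = _ := by rw [Real.sq_sqrt hk]
  have h5 : √k * k ≤ √k * (k + h ^ 2) :=
    mul_le_mul_of_nonneg_left (by nlinarith [sq_nonneg h]) (Real.sqrt_nonneg _)
  rw [cubCoef, norm_neg, norm_div, norm_mul, Complex.norm_I, one_mul, norm_pow, Complex.norm_real,
    Real.norm_eq_abs, abs_mul, abs_of_nonneg (Real.sqrt_nonneg _), mul_pow]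
  have h6 := mul_le_mul h3 (h4.trans h5) (by positivity) (by positivity)
  have h7 : 0 ≤ |κ| ^ 3 * √(ρ * k) ^ 3 := by positivity
  simp only [Complex.norm_ofNat]
  linarith

/-- The growth factor `1 + z²` in the noise. -/
def noiseScale (z : ℝ) : ℝ := 1 + z ^ 2

lemma one_le_noiseScale (z : ℝ) : 1 ≤ noiseScale z := by unfold noiseScale; nlinarith [sq_nonneg z]

lemma abs_le_noiseScale (z : ℝ) : |z| ≤ noiseScale z := abs_le_one_add_sq z

lemma sq_le_noiseScale (z : ℝ) : z ^ 2 ≤ noiseScale z := by unfold noiseScale; linarith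

lemma norm_noise_term_le {ρ : ℝ} (hρ0 : 0 ≤ ρ) (hρ1 : ρ ≤ 1) (μ κ k z : ℝ) :
    ‖((κ * √(ρ * k) : ℝ) : ℂ) * z‖ ≤ waveScale μ κ * √k * noiseScale z := by
  rw [norm_mul, Complex.norm_real, Complex.norm_real, Real.norm_eq_abs, Real.norm_eq_abs, abs_mul,
    abs_of_nonneg (Real.sqrt_nonneg _)]
  have := one_le_waveScale μ κ
  exact mul_le_mul (mul_le_mul (abs_le_waveScale μ κ) (sqrt_mul_le hρ0 hρ1) (Real.sqrt_nonneg _)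
    (by positivity)) (abs_le_noiseScale z) (abs_nonneg _) (by positivity)

/-- The quartic Taylor remainder dictates the powers U⁴Y⁴. The other terms have lower degree and are
raised to it using U, Y ≥ 1 and k ≤ 1. -/
lemma norm_oneStepRest_le {ρ : ℝ} (hρ0 : 0 ≤ ρ) (hρ1 : ρ ≤ 1) (μ κ z : ℝ) {k h : ℝ}
    (hk : 0 < k) (hk1 : k ≤ 1) (hh : 0 < h) :
    ‖oneStepRest μ ρ κ k h z‖
      ≤ 200 * waveScale μ κ ^ 4 * noiseScale z ^ 4 * (k * (k + h ^ 2)) := by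
  rw [oneStepRest_eq hρ0 μ κ z hk.le hh.ne']
  set E := exactExponent μ ρ κ k (√k * z)
  set B := drift μ ρ κ k
  set w : ℂ := ((κ * √(ρ * k) : ℝ) : ℂ) * z
  set U := waveScale μ κ
  set Y := noiseScale z
  have hU1 : 1 ≤ U := one_le_waveScale μ κ
  have hY1 : 1 ≤ Y := one_le_noiseScale z
  have hB : ‖B‖ ≤ 3 / 2 * U * k := norm_drift_le hρ0 hρ1 μ κ hk.le
  have hw : ‖w‖ ≤ U * √k * Y := norm_noise_term_le hρ0 hρ1 μ κ k z
  have hs1 : √k ≤ 1 := Real.sqrt_le_one.2 hk1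
  have hs0 : 0 ≤ √k := Real.sqrt_nonneg _
  have hss : √k ^ 2 = k := Real.sq_sqrt hk.le
  have hks : k ≤ √k := by nlinarith
  have hBs : ‖B‖ ≤ 3 / 2 * U * √k * Y := hB.trans <| by
    have h1 : 3 / 2 * U * k ≤ 3 / 2 * U * √k := mul_le_mul_of_nonneg_left hks (by positivity)
    have h2 : 0 ≤ 3 / 2 * U * √k := by positivity
    nlinarith
  have hE : ‖E‖ ≤ 5 / 2 * U * √k * Y := by
    have : E = -B - Complex.I * w := by
      simp only [E, B, w]; rw [exactExponent_eq hρ0]; ring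
    rw [this]
    refine (norm_sub_le _ _).trans ?_
    rw [norm_neg, norm_mul, Complex.norm_I, one_mul]
    linarith
  have hERe : E.re ≤ 0 := by
    rw [exactExponent_re]
    have : 0 ≤ (1 / 2) * (1 - ρ) * κ ^ 2 * k := by
      have := sub_nonneg.2 hρ1; positivity
    linarith
  have hμκ : |μ| * |κ| ^ 3 ≤ U ^ 2 := by
    have h2 : |κ| ^ 2 ≤ U := by rw [sq_abs]; exact sq_le_waveScale μ κ
    have h1 : |μ| * |κ| ≤ U := by
      nlinarith [abs_mul_le_waveScale μ κ, abs_nonneg κ]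
    calc |μ| * |κ| ^ 3 = |μ| * |κ| * |κ| ^ 2 := by ring
      _ ≤ U * U := mul_le_mul h1 h2 (by positivity) (by positivity)
      _ = U ^ 2 := by ring
  have hY4 : 1 ≤ Y ^ 4 := one_le_pow₀ hY1
  have hU24 : U ^ 2 ≤ U ^ 4 := pow_le_pow_right₀ hU1 (by norm_num)
  have hU34 : U ^ 3 ≤ U ^ 4 := pow_le_pow_right₀ hU1 (by norm_num)
  have hY14 : Y ≤ Y ^ 4 := le_self_pow₀ hY1 (by norm_num)
  have hY24 : Y ^ 2 ≤ Y ^ 4 := pow_le_pow_right₀ hY1 (by norm_num)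
  -- Common device for enlarging every summand to the monomial U⁴Y⁴ times a step-size factor.
  have mono : ∀ {a b c d : ℝ}, 0 ≤ a → a ≤ U ^ 4 → 0 ≤ b → b ≤ Y ^ 4 → 0 ≤ c → 0 ≤ d → c ≤ d →
      a * b * c ≤ U ^ 4 * Y ^ 4 * d := fun ha ha' hb hb' hc hd hcd =>
    mul_le_mul (mul_le_mul ha' hb' hb (by positivity)) hcd hc (by positivity)
  have t1 : ‖Complex.I * ((μ * k * (κ - Real.sin (κ * h) / h) : ℝ) : ℂ)‖
      ≤ U ^ 4 * Y ^ 4 * (k * h ^ 2) := by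
    rw [norm_mul, Complex.norm_I, one_mul, Complex.norm_real, Real.norm_eq_abs, abs_mul, abs_mul,
      abs_of_pos hk]
    have h1 := mul_le_mul_of_nonneg_left (abs_sub_sin_div_le κ hh)
      (by positivity : 0 ≤ |μ| * k)
    have h2 : |μ| * k * (|κ| ^ 3 * h ^ 2 / 6) ≤ U ^ 2 * 1 * (k * h ^ 2) := by
      have := mul_le_mul_of_nonneg_right hμκ (by positivity : 0 ≤ k * h ^ 2)
      have h0 : 0 ≤ |μ| * |κ| ^ 3 * (k * h ^ 2) := by positivity
      nlinarith
    exact h1.trans (h2.trans (mono (by positivity) hU24 zero_le_one hY4 (by positivity)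
      (by positivity) le_rfl))
  have t2 : ‖((((1 - ρ) * k + ρ * k * z ^ 2) / 2
      * (κ ^ 2 - 4 * Real.sin (κ * h / 2) ^ 2 / h ^ 2) : ℝ) : ℂ)‖
      ≤ U ^ 4 * Y ^ 4 * (k * h ^ 2) := by
    rw [Complex.norm_real, Real.norm_eq_abs, abs_mul]
    have h1 : |((1 - ρ) * k + ρ * k * z ^ 2) / 2| ≤ k * Y := by
      rw [abs_of_nonneg (by have := sub_nonneg.2 hρ1; positivity)]
      have a1 : (1 - ρ) * k ≤ k := mul_le_of_le_one_left hk.le (by linarith)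
      have a2 : ρ * k * z ^ 2 ≤ k * z ^ 2 :=
        mul_le_mul_of_nonneg_right (mul_le_of_le_one_left hk.le hρ1) (sq_nonneg z)
      have : k * Y = k + k * z ^ 2 := by simp only [Y, noiseScale]; ring
      have : 0 ≤ k * z ^ 2 := by positivity
      linarith
    have h2 : κ ^ 4 * h ^ 2 / 12 ≤ U ^ 2 * h ^ 2 := by
      have : κ ^ 4 ≤ U ^ 2 := by
        calc κ ^ 4 = (κ ^ 2) ^ 2 := by ring
          _ ≤ U ^ 2 := pow_le_pow_left₀ (sq_nonneg κ) (sq_le_waveScale μ κ) 2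
      have := mul_le_mul_of_nonneg_right this (sq_nonneg h)
      nlinarith [mul_nonneg (sq_nonneg U) (sq_nonneg h)]
    calc _ ≤ k * Y * (U ^ 2 * h ^ 2) := mul_le_mul h1
          ((abs_sq_sub_four_sin_sq_div_le κ hh).trans h2) (abs_nonneg _) (by positivity)
      _ = U ^ 2 * Y * (k * h ^ 2) := by ring
      _ ≤ _ := mono (by positivity) hU24 (by positivity) hY14 (by positivity) (by positivity) le_rfl
  have t3 : ‖-(B ^ 2 / 2)‖ ≤ 9 / 8 * (U ^ 4 * Y ^ 4 * k ^ 2) := by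
    rw [norm_neg, norm_div, norm_pow, Complex.norm_ofNat]
    have h1 : ‖B‖ ^ 2 ≤ (3 / 2 * U * k) ^ 2 := pow_le_pow_left₀ (norm_nonneg _) hB 2
    have h2 : U ^ 2 * 1 * k ^ 2 ≤ U ^ 4 * Y ^ 4 * k ^ 2 :=
      mono (by positivity) hU24 zero_le_one hY4 (by positivity) (by positivity) le_rfl
    nlinarith
  have t4 : ‖B ^ 3 / 6‖ ≤ 9 / 16 * (U ^ 4 * Y ^ 4 * k ^ 2) := by
    rw [norm_div, norm_pow, Complex.norm_ofNat]
    have h1 : ‖B‖ ^ 3 ≤ (3 / 2 * U * k) ^ 3 := pow_le_pow_left₀ (norm_nonneg _) hB 3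
    have h2 : U ^ 3 * 1 * k ^ 3 ≤ U ^ 4 * Y ^ 4 * k ^ 2 :=
      mono (by positivity) hU34 zero_le_one hY4 (by positivity) (by positivity)
        (pow_le_pow_of_le_one hk.le hk1 (by norm_num))
    nlinarith
  have t5 : ‖Complex.I * B ^ 2 * w / 2‖ ≤ 9 / 8 * (U ^ 4 * Y ^ 4 * k ^ 2) := by
    rw [norm_div, norm_mul, norm_mul, norm_pow, Complex.norm_ofNat, Complex.norm_I, one_mul]
    have h1 : ‖B‖ ^ 2 * ‖w‖ ≤ (3 / 2 * U * k) ^ 2 * (U * √k * Y) :=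
      mul_le_mul (pow_le_pow_left₀ (norm_nonneg _) hB 2) hw (norm_nonneg _) (by positivity)
    have h2 : U ^ 3 * Y * (√k * k ^ 2) ≤ U ^ 4 * Y ^ 4 * k ^ 2 :=
      mono (by positivity) hU34 (by positivity) hY14 (by positivity) (by positivity)
        (mul_le_of_le_one_left (by positivity) hs1)
    nlinarith
  have t6 : ‖B * w ^ 2 / 2‖ ≤ 3 / 4 * (U ^ 4 * Y ^ 4 * k ^ 2) := by
    rw [norm_div, norm_mul, norm_pow, Complex.norm_ofNat]
    have h1 : ‖B‖ * ‖w‖ ^ 2 ≤ (3 / 2 * U * k) * (U * √k * Y) ^ 2 :=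
      mul_le_mul hB (pow_le_pow_left₀ (norm_nonneg _) hw 2) (by positivity) (by positivity)
    have h2 : U ^ 3 * Y ^ 2 * k ^ 2 ≤ U ^ 4 * Y ^ 4 * k ^ 2 :=
      mono (by positivity) hU34 (by positivity) hY24 (by positivity) (by positivity) le_rfl
    have h3 : (3 / 2 * U * k) * (U * √k * Y) ^ 2 = 3 / 2 * (U ^ 3 * Y ^ 2 * k ^ 2) := by
      rw [mul_pow, mul_pow, hss]; ring
    linarith
  have t7 : ‖-(Complex.exp E - (1 + E + E ^ 2 / 2 + E ^ 3 / 6))‖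
      ≤ 157 * (U ^ 4 * Y ^ 4 * k ^ 2) := by
    rw [norm_neg]
    refine (norm_exp_sub_cubic_le hERe).trans ?_
    have h1 : ‖E‖ ^ 4 ≤ (5 / 2 * U * √k * Y) ^ 4 := pow_le_pow_left₀ (norm_nonneg _) hE 4
    have h3 : (5 / 2 * U * √k * Y) ^ 4 = 625 / 16 * (U ^ 4 * Y ^ 4 * k ^ 2) := by
      have : k ^ 2 = √k ^ 4 := by rw [show √k ^ 4 = (√k ^ 2) ^ 2 by ring, hss]
      rw [this]; ring
    have : 0 ≤ U ^ 4 * Y ^ 4 * k ^ 2 := by positivity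
    linarith
  have tri := norm_add₄_le (a := Complex.I * ((μ * k * (κ - Real.sin (κ * h) / h) : ℝ) : ℂ))
    (b := ((((1 - ρ) * k + ρ * k * z ^ 2) / 2
      * (κ ^ 2 - 4 * Real.sin (κ * h / 2) ^ 2 / h ^ 2) : ℝ) : ℂ))
    (c := -(B ^ 2 / 2) + B ^ 3 / 6 + Complex.I * B ^ 2 * w / 2 - B * w ^ 2 / 2)
    (d := -(Complex.exp E - (1 + E + E ^ 2 / 2 + E ^ 3 / 6)))
  have tri2 := norm_sub_le (-(B ^ 2 / 2) + B ^ 3 / 6 + Complex.I * B ^ 2 * w / 2) (B * w ^ 2 / 2)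
  have tri3 := norm_add₃_le (a := -(B ^ 2 / 2)) (b := B ^ 3 / 6) (c := Complex.I * B ^ 2 * w / 2)
  refine tri.trans ?_
  have p1 : 0 ≤ U ^ 4 * Y ^ 4 * (k * h ^ 2) := by positivity
  have p2 : 0 ≤ U ^ 4 * Y ^ 4 * k ^ 2 := by positivity
  have e : 200 * U ^ 4 * Y ^ 4 * (k * (k + h ^ 2))
      = 200 * (U ^ 4 * Y ^ 4 * k ^ 2) + 200 * (U ^ 4 * Y ^ 4 * (k * h ^ 2)) := by ring
  rw [e]
  linarith

lemma norm_odd_le {ρ : ℝ} (hρ0 : 0 ≤ ρ) (hρ1 : ρ ≤ 1) (μ κ z : ℝ) {k h : ℝ}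
    (hk : 0 ≤ k) (hh : 0 < h) :
    ‖linCoef μ ρ κ k h * z + cubCoef ρ κ k * (z : ℂ) ^ 3‖
      ≤ 3 * waveScale μ κ ^ 2 * noiseScale z ^ 2 * (√k * (k + h ^ 2)) := by
  have h1 := norm_linCoef_le hρ0 hρ1 μ κ hk hh
  have h2 := norm_cubCoef_le hρ0 hρ1 μ κ hk h
  have hY1 := one_le_noiseScale z
  have z1 : |z| ≤ noiseScale z ^ 2 :=
    (abs_le_noiseScale z).trans (le_self_pow₀ hY1 (by norm_num))
  have z3 : |z| ^ 3 ≤ noiseScale z ^ 2 := by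
    have : |z| ^ 2 ≤ noiseScale z := by rw [sq_abs]; exact sq_le_noiseScale z
    nlinarith [mul_le_mul (abs_le_noiseScale z) this (by positivity) (by positivity)]
  refine (norm_add_le _ _).trans ?_
  rw [norm_mul, norm_mul, norm_pow, Complex.norm_real, Real.norm_eq_abs]
  have a := mul_le_mul h1 z1 (abs_nonneg _) (by have := waveScale_pos μ κ; positivity)
  have b := mul_le_mul h2 z3 (by positivity) (by have := waveScale_pos μ κ; positivity)
  linarith

/-- Pointwise, the odd part dominates and costs a factor √k compared with the rest; only averaging
over the noise recovers it. -/
lemma norm_amp_sub_exp_le {ρ : ℝ} (hρ0 : 0 ≤ ρ) (hρ1 : ρ ≤ 1) (μ κ z : ℝ) {k h : ℝ}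
    (hk : 0 < k) (hk1 : k ≤ 1) (hh : 0 < h) :
    ‖ampFactor μ ρ κ k h z - Complex.exp (exactExponent μ ρ κ k (√k * z))‖
      ≤ 203 * waveScale μ κ ^ 4 * noiseScale z ^ 4 * (√k * (k + h ^ 2)) := by
  have h1 := norm_oneStepRest_le hρ0 hρ1 μ κ z hk hk1 hh
  have h2 := norm_odd_le hρ0 hρ1 μ κ z hk.le hh
  have e : ampFactor μ ρ κ k h z - Complex.exp (exactExponent μ ρ κ k (√k * z))
      = oneStepRest μ ρ κ k h z + (linCoef μ ρ κ k h * z + cubCoef ρ κ k * (z : ℂ) ^ 3) := by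
    rw [oneStepRest]; ring
  rw [e]
  refine (norm_add_le _ _).trans ?_
  have hU1 := one_le_waveScale μ κ
  have hY1 := one_le_noiseScale z
  have hks : k ≤ √k := Real.le_sqrt_self_iff.2 hk1 |>.trans le_rfl
  have a1 : k * (k + h ^ 2) ≤ √k * (k + h ^ 2) := mul_le_mul_of_nonneg_right hks (by positivity)
  have a2 : waveScale μ κ ^ 2 * noiseScale z ^ 2 ≤ waveScale μ κ ^ 4 * noiseScale z ^ 4 :=
    mul_le_mul (pow_le_pow_right₀ hU1 (by norm_num)) (pow_le_pow_right₀ hY1 (by norm_num))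
      (by positivity) (by positivity)
  have b1 := mul_le_mul_of_nonneg_left a1
    (by positivity : 0 ≤ 200 * waveScale μ κ ^ 4 * noiseScale z ^ 4)
  have b2 := mul_le_mul_of_nonneg_right a2 (by positivity : 0 ≤ √k * (k + h ^ 2))
  linarith

lemma norm_amp_sub_one_le {ρ : ℝ} (hρ0 : 0 ≤ ρ) (hρ1 : ρ ≤ 1) (μ κ z : ℝ) {k h : ℝ}
    (hk : 0 < k) (hk1 : k ≤ 1) (hh : 0 < h) (hh1 : h ≤ 1) :
    ‖ampFactor μ ρ κ k h z - 1‖ ≤ 412 * waveScale μ κ ^ 4 * noiseScale z ^ 4 * √k := by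
  have h1 := norm_amp_sub_exp_le hρ0 hρ1 μ κ z hk hk1 hh
  set E := exactExponent μ ρ κ k (√k * z)
  set U := waveScale μ κ
  set Y := noiseScale z
  have hU1 : 1 ≤ U := one_le_waveScale μ κ
  have hY1 : 1 ≤ Y := one_le_noiseScale z
  have hks : k ≤ √k := Real.le_sqrt_self_iff.2 hk1
  have hE : ‖E‖ ≤ 5 / 2 * (U * Y * √k) := by
    have : E = -drift μ ρ κ k - Complex.I * (((κ * √(ρ * k) : ℝ) : ℂ) * z) := by
      simp only [E]; rw [exactExponent_eq hρ0]; ring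
    rw [this]
    refine (norm_sub_le _ _).trans ?_
    rw [norm_neg, norm_mul, Complex.norm_I, one_mul]
    have a := norm_noise_term_le hρ0 hρ1 μ κ k z
    have b := norm_drift_le hρ0 hρ1 μ κ hk.le
    have c : U * k ≤ U * Y * √k :=
      mul_le_mul (le_mul_of_one_le_right (by positivity) hY1) hks hk.le (by positivity)
    change ‖drift μ ρ κ k‖ ≤ 3 / 2 * U * k at b
    change _ ≤ U * √k * Y at a
    linarith
  have hERe : E.re ≤ 0 := by
    rw [exactExponent_re]
    have : 0 ≤ (1 / 2) * (1 - ρ) * κ ^ 2 * k := by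
      have := sub_nonneg.2 hρ1; positivity
    linarith
  -- As Re E ≤ 0, this holds without smallness: for ‖E‖ ≥ 1 the left side is at most 2.
  have hexp : ‖Complex.exp E - 1‖ ≤ 2 * ‖E‖ := by
    rcases le_total ‖E‖ 1 with h | h
    · exact Complex.norm_exp_sub_one_le h
    · have h0 : ‖Complex.exp E‖ ≤ 1 := by rw [Complex.norm_exp]; exact Real.exp_le_one_iff.2 hERe
      have := norm_sub_le (Complex.exp E) 1
      rw [norm_one] at this
      linarith
  have e : ampFactor μ ρ κ k h z - 1
      = (ampFactor μ ρ κ k h z - Complex.exp E) + (Complex.exp E - 1) := by ring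
  rw [e]
  refine (norm_add_le _ _).trans ?_
  have c1 : U * Y ≤ U ^ 4 * Y ^ 4 :=
    mul_le_mul (le_self_pow₀ hU1 (by norm_num)) (le_self_pow₀ hY1 (by norm_num))
      (by positivity) (by positivity)
  have c2 := mul_le_mul_of_nonneg_right c1 (Real.sqrt_nonneg k)
  have c3 : √k * (k + h ^ 2) ≤ √k * 2 :=
    mul_le_mul_of_nonneg_left (by nlinarith) (Real.sqrt_nonneg _)
  have c4 := mul_le_mul_of_nonneg_left c3 (by positivity : 0 ≤ 203 * U ^ 4 * Y ^ 4)
  have c5 : 0 ≤ U ^ 4 * Y ^ 4 * √k := by positivity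
  linarith

/-! ### Mean square error of products of i.i.d. factors -/

section ProductError

lemma norm_sub_sq_complex (x y : ℂ) :
    ‖x - y‖ ^ 2 = ‖x‖ ^ 2 - 2 * (x * starRingEnd ℂ y).re + ‖y‖ ^ 2 := by
  rw [← Complex.normSq_eq_norm_sq, ← Complex.normSq_eq_norm_sq, ← Complex.normSq_eq_norm_sq,
    Complex.normSq_sub]
  ring

/-- Comparison of powers of the second moments `a = E|X|²`, `b = E X Ȳ`, `c = E|Y|²`. -/
lemma pow_sub_two_re_pow_add_pow_le {a c G τ : ℝ} {b : ℂ} (ha : 0 ≤ a) (hc : 0 ≤ c)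
    (hb : ‖b‖ ^ 2 ≤ a * c) (hτ : 0 < τ) (hG : 0 < G) (haG : a + τ ≤ G) (hcG : c ≤ G) (n : ℕ) :
    a ^ n - 2 * (b ^ n).re + c ^ n
      ≤ n * G ^ n / G * ((a - 2 * b.re + c) + ‖(a : ℂ) - b‖ ^ 2 / τ) := by
  -- For actual moments this is E|Fₙ-Gₙ|² ≥ 0, with Fₙ, Gₙ the products; here it follows from `hb`,
  -- the Cauchy–Schwarz inequality, alone.
  have nonneg : ∀ n : ℕ, 0 ≤ a ^ n - 2 * (b ^ n).re + c ^ n := fun n => by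
    have h1 : (b ^ n).re ≤ ‖b ^ n‖ := Complex.re_le_norm _
    have h2 : ‖b ^ n‖ ^ 2 ≤ a ^ n * c ^ n := by
      rw [norm_pow, ← mul_pow, ← pow_mul, mul_comm n, pow_mul]
      exact pow_le_pow_left₀ (by positivity) hb n
    have h3 : 2 * ‖b ^ n‖ ≤ a ^ n + c ^ n := by
      refine abs_le_of_sq_le_sq' ?_ (by positivity) |>.2
      nlinarith [sq_nonneg (a ^ n - c ^ n)]
    linarith
  set S := (a - 2 * b.re + c) + ‖(a : ℂ) - b‖ ^ 2 / τ
  have hS : 0 ≤ S := by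
    have := nonneg 1
    simp only [pow_one] at this
    positivity
  induction n with
  | zero => norm_num
  | succ n ih =>
    set D := a ^ n - 2 * (b ^ n).re + c ^ n with hD
    have hDn : 0 ≤ D := nonneg n
    have hcn : 0 ≤ c ^ n := by positivity
    set d := b ^ n - ((c ^ n : ℝ) : ℂ) with hd
    -- Algebraic form of Cauchy–Schwarz for E[(Fₙ-Gₙ) conj Gₙ], whose value is d.
    have hdD : ‖d‖ ^ 2 ≤ D * c ^ n := by
      rw [hd, norm_sub_sq_complex]
      have h2 : ‖b ^ n‖ ^ 2 ≤ a ^ n * c ^ n := by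
        rw [norm_pow, ← mul_pow, ← pow_mul, mul_comm n, pow_mul]
        exact pow_le_pow_left₀ (by positivity) hb n
      rw [Complex.conj_ofReal, Complex.re_mul_ofReal, Complex.norm_real, Real.norm_of_nonneg hcn]
      rw [hD]; nlinarith
    -- Second moment of Fₙ₊₁-Gₙ₊₁ = f(Fₙ-Gₙ) + (f-g)Gₙ. The new factor is independent of the old
    -- ones, so the cross term factors into (a-b)d.
    have key : a ^ (n + 1) - 2 * (b ^ (n + 1)).re + c ^ (n + 1)
        = a * D + 2 * (((a : ℂ) - b) * d).re + (a - 2 * b.re + c) * c ^ n := by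
      have e1 : (((a : ℂ) - b) * d).re
          = a * (b ^ n).re - a * c ^ n - (b ^ (n + 1)).re + b.re * c ^ n := by
        have : ((a : ℂ) - b) * d = a * b ^ n - (a : ℂ) * ((c ^ n : ℝ) : ℂ) - b ^ (n + 1)
            + b * ((c ^ n : ℝ) : ℂ) := by rw [hd]; ring
        rw [this]
        simp only [Complex.add_re, Complex.sub_re, Complex.re_ofReal_mul, Complex.re_mul_ofReal,
          Complex.ofReal_re]
      rw [e1, hD]; ring
    -- Young's inequality with weight τ: the part τD is charged to the growth factor through a+τ ≤
    -- G, and the rest joins the source term.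
    have cross : 2 * (((a : ℂ) - b) * d).re ≤ τ * D + ‖(a : ℂ) - b‖ ^ 2 / τ * c ^ n := by
      have h1 : (((a : ℂ) - b) * d).re ≤ ‖(a : ℂ) - b‖ * ‖d‖ :=
        (Complex.re_le_norm _).trans (norm_mul _ _).le
      have hx : (‖(a : ℂ) - b‖ * ‖d‖) ^ 2 ≤ (τ * D) * (‖(a : ℂ) - b‖ ^ 2 / τ * c ^ n) := by
        have : (τ * D) * (‖(a : ℂ) - b‖ ^ 2 / τ * c ^ n) = ‖(a : ℂ) - b‖ ^ 2 * (D * c ^ n) := by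
          field_simp
        rw [this, mul_pow]
        exact mul_le_mul_of_nonneg_left hdD (by positivity)
      have h3 : 2 * (‖(a : ℂ) - b‖ * ‖d‖) ≤ τ * D + ‖(a : ℂ) - b‖ ^ 2 / τ * c ^ n := by
        refine abs_le_of_sq_le_sq' ?_ (by positivity) |>.2
        nlinarith [sq_nonneg (τ * D - ‖(a : ℂ) - b‖ ^ 2 / τ * c ^ n)]
      linarith
    have h1 : (a + τ) * D ≤ G * (n * G ^ n / G * S) :=
      mul_le_mul haG ih hDn hG.le
    have h2 : S * c ^ n ≤ S * G ^ n :=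
      mul_le_mul_of_nonneg_left (pow_le_pow_left₀ hc hcG n) hS
    have e : ((n + 1 : ℕ) : ℝ) * G ^ (n + 1) / G * S = G * (n * G ^ n / G * S) + S * G ^ n := by
      push_cast; field_simp; ring
    rw [key, e]
    have : S * c ^ n = (a - 2 * b.re + c) * c ^ n + ‖(a : ℂ) - b‖ ^ 2 / τ * c ^ n := by
      simp only [S]; ring
    linarith

variable {Ω E : Type*} [MeasurableSpace Ω] [MeasurableSpace E] {P : Measure Ω} {π : Measure E}

lemma integrable_mul_conj {f g : E → ℂ} (hf : MemLp f 2 π) (hg : MemLp g 2 π) :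
    Integrable (fun x => f x * starRingEnd ℂ (g x)) π := by
  have hg' : MemLp (fun x => starRingEnd ℂ (g x)) 2 π := by
    refine hg.congr_norm (Complex.continuous_conj.comp_aestronglyMeasurable hg.1)
      (ae_of_all _ fun x => ?_)
    simp
  exact hf.integrable_mul hg'

lemma integrable_norm_sq_of_memLp {f : E → ℂ} (hf : MemLp f 2 π) :
    Integrable (fun x => ‖f x‖ ^ 2) π :=
  (memLp_two_iff_integrable_sq_norm hf.1).1 hf

lemma norm_integral_mul_conj_sq_le {f g : E → ℂ} (hf : MemLp f 2 π) (hg : MemLp g 2 π) :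
    ‖∫ x, f x * starRingEnd ℂ (g x) ∂π‖ ^ 2 ≤ (∫ x, ‖f x‖ ^ 2 ∂π) * ∫ x, ‖g x‖ ^ 2 ∂π := by
  have h := integral_mul_norm_le_Lp_mul_Lq (μ := π) (f := f) (g := g) Real.HolderConjugate.two_two
    (by simpa using hf) (by simpa using hg)
  have h1 : ‖∫ x, f x * starRingEnd ℂ (g x) ∂π‖ ≤ ∫ x, ‖f x‖ * ‖g x‖ ∂π := by
    refine (norm_integral_le_integral_norm _).trans_eq (integral_congr_ae (ae_of_all _ fun x => ?_))
    simp
  simp only [Real.rpow_ofNat] at h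
  rw [← Real.sqrt_eq_rpow, ← Real.sqrt_eq_rpow] at h
  calc _ ≤ (√(∫ x, ‖f x‖ ^ 2 ∂π) * √(∫ x, ‖g x‖ ^ 2 ∂π)) ^ 2 :=
        pow_le_pow_left₀ (norm_nonneg _) (h1.trans h) 2
    _ = _ := by
        rw [mul_pow, Real.sq_sqrt (integral_nonneg fun x => by positivity),
          Real.sq_sqrt (integral_nonneg fun x => by positivity)]

lemma integral_norm_sub_sq {f g : E → ℂ} (hf : MemLp f 2 π) (hg : MemLp g 2 π) :
    ∫ x, ‖f x - g x‖ ^ 2 ∂π = (∫ x, ‖f x‖ ^ 2 ∂π) - 2 * (∫ x, f x * starRingEnd ℂ (g x) ∂π).re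
      + ∫ x, ‖g x‖ ^ 2 ∂π := by
  have h1 := integrable_mul_conj hf hg
  have hre : (∫ x, f x * starRingEnd ℂ (g x) ∂π).re = ∫ x, (f x * starRingEnd ℂ (g x)).re ∂π :=
    (integral_re h1).symm
  simp_rw [norm_sub_sq_complex]
  have i1 := integrable_norm_sq_of_memLp hf
  have i2 : Integrable (fun x => 2 * (f x * starRingEnd ℂ (g x)).re) π := h1.re.const_mul 2
  have i3 : Integrable (fun x => ‖f x‖ ^ 2 - 2 * (f x * starRingEnd ℂ (g x)).re) π := i1.sub i2
  rw [integral_add i3 (integrable_norm_sq_of_memLp hg), integral_sub i1 i2,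
    integral_const_mul, hre]

variable [IsProbabilityMeasure π]

/-- The mean square distance of two products of functions of independent, identically
distributed random variables. -/
lemma lintegral_prod_sub_prod_sq {Z : ℕ → Ω → E} (hZ : iIndepFun Z P)
    (hlaw : ∀ i, HasLaw (Z i) π P) {f g : E → ℂ} (hf : MemLp f 2 π) (hg : MemLp g 2 π) (n : ℕ) :
    ∫⁻ ω, ‖∏ i ∈ Finset.range n, f (Z i ω) - ∏ i ∈ Finset.range n, g (Z i ω)‖ₑ ^ 2 ∂P
      = ENNReal.ofReal ((∫ x, ‖f x‖ ^ 2 ∂π) ^ n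
          - 2 * ((∫ x, f x * starRingEnd ℂ (g x) ∂π) ^ n).re + (∫ x, ‖g x‖ ^ 2 ∂π) ^ n) := by
  have hind : iIndepFun (fun (i : Fin n) => Z i) P := hZ.precomp Fin.val_injective
  -- Under the joint law, a product measure, all three moments of the products become n-th powers.
  have hL : HasLaw (fun ω (i : Fin n) => Z i ω) (Measure.pi fun _ => π) P :=
    iIndepFun.hasLaw_pi (fun i => hlaw i) hind
  have hprod : ∀ {u : E → ℂ}, AEStronglyMeasurable u π →
      AEStronglyMeasurable (fun x : Fin n → E => ∏ i, u (x i)) (Measure.pi fun _ => π) :=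
    fun hu => Finset.aestronglyMeasurable_fun_prod _ fun i _ =>
      hu.comp_measurePreserving (measurePreserving_eval (fun _ : Fin n => π) i)
  have mF : MemLp (fun x : Fin n → E => ∏ i, f (x i)) 2 (Measure.pi fun _ => π) := by
    rw [memLp_two_iff_integrable_sq_norm (hprod hf.1)]
    simp only [norm_prod, ← Finset.prod_pow]
    exact Integrable.fintype_prod fun _ => integrable_norm_sq_of_memLp hf
  have mG : MemLp (fun x : Fin n → E => ∏ i, g (x i)) 2 (Measure.pi fun _ => π) := by
    rw [memLp_two_iff_integrable_sq_norm (hprod hg.1)]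
    simp only [norm_prod, ← Finset.prod_pow]
    exact Integrable.fintype_prod fun _ => integrable_norm_sq_of_memLp hg
  have e1 : ∫ x : Fin n → E, ‖∏ i, f (x i)‖ ^ 2 ∂(Measure.pi fun _ => π)
      = (∫ x, ‖f x‖ ^ 2 ∂π) ^ n := by
    simp only [norm_prod, ← Finset.prod_pow]
    rw [integral_fintype_prod_eq_prod (fun (_ : Fin n) x => ‖f x‖ ^ 2)]
    simp
  have e2 : ∫ x : Fin n → E, ‖∏ i, g (x i)‖ ^ 2 ∂(Measure.pi fun _ => π)
      = (∫ x, ‖g x‖ ^ 2 ∂π) ^ n := by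
    simp only [norm_prod, ← Finset.prod_pow]
    rw [integral_fintype_prod_eq_prod (fun (_ : Fin n) x => ‖g x‖ ^ 2)]
    simp
  have e3 : ∫ x : Fin n → E, (∏ i, f (x i)) * starRingEnd ℂ (∏ i, g (x i)) ∂(Measure.pi fun _ => π)
      = (∫ x, f x * starRingEnd ℂ (g x) ∂π) ^ n := by
    simp only [map_prod, ← Finset.prod_mul_distrib]
    rw [integral_fintype_prod_eq_prod (fun (_ : Fin n) x => f x * starRingEnd ℂ (g x))]
    simp
  have hsub := integral_norm_sub_sq mF mG
  rw [e1, e2, e3] at hsub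
  have iFG : Integrable (fun x : Fin n → E => ‖∏ i, f (x i) - ∏ i, g (x i)‖ ^ 2)
      (Measure.pi fun _ => π) := integrable_norm_sq_of_memLp (mF.sub mG)
  rw [← hsub, ofReal_integral_eq_lintegral_ofReal iFG (ae_of_all _ fun x => by positivity)]
  have := hL.lintegral_comp (f := fun x : Fin n → E =>
    ENNReal.ofReal (‖∏ i, f (x i) - ∏ i, g (x i)‖ ^ 2))
    (((mF.1.sub mG.1).norm.aemeasurable.pow_const 2).ennreal_ofReal)
  rw [← this]
  refine lintegral_congr fun ω => ?_
  rw [Finset.prod_range, Finset.prod_range, ← ofReal_norm, ENNReal.ofReal_pow (norm_nonneg _)]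

/-- Mean square error of a product of i.i.d. factors `f(Zᵢ)` approximating `g(Zᵢ)`. -/
lemma lintegral_prod_sub_prod_sq_le {Z : ℕ → Ω → E} (hZ : iIndepFun Z P)
    (hlaw : ∀ i, HasLaw (Z i) π P) {f g : E → ℂ} (hf : MemLp f 2 π) (hg : MemLp g 2 π)
    {G τ s b : ℝ} (hτ : 0 < τ) (hG : 0 < G)
    (hfG : (∫ x, ‖f x‖ ^ 2 ∂π) + τ ≤ G) (hgG : ∫ x, ‖g x‖ ^ 2 ∂π ≤ G)
    (hs : ∫ x, ‖f x - g x‖ ^ 2 ∂π ≤ s)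
    (hb : ‖∫ x, f x * starRingEnd ℂ (f x - g x) ∂π‖ ≤ b) (n : ℕ) :
    ∫⁻ ω, ‖∏ i ∈ Finset.range n, f (Z i ω) - ∏ i ∈ Finset.range n, g (Z i ω)‖ₑ ^ 2 ∂P
      ≤ ENNReal.ofReal (n * G ^ n / G * (s + b ^ 2 / τ)) := by
  rw [lintegral_prod_sub_prod_sq hZ hlaw hf hg]
  refine ENNReal.ofReal_le_ofReal ?_
  refine (pow_sub_two_re_pow_add_pow_le (integral_nonneg fun x => by positivity)
    (integral_nonneg fun x => by positivity) (norm_integral_mul_conj_sq_le hf hg) hτ hG hfG hgG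
    n).trans ?_
  refine mul_le_mul_of_nonneg_left ?_ (by positivity)
  rw [← integral_norm_sub_sq hf hg]
  -- The quantity a-b equals E f conj(f-g), where a weak error bound can enter.
  have e : ((∫ x, ‖f x‖ ^ 2 ∂π : ℝ) : ℂ) - ∫ x, f x * starRingEnd ℂ (g x) ∂π
      = ∫ x, f x * starRingEnd ℂ (f x - g x) ∂π := by
    rw [← integral_complex_ofReal, ← integral_sub _ (integrable_mul_conj hf hg)]
    · refine integral_congr_ae (ae_of_all _ fun x => ?_)
      simp only [map_sub, mul_sub, Complex.mul_conj', Complex.ofReal_pow]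
    · exact (integrable_norm_sq_of_memLp hf).ofReal
  rw [e]
  gcongr

end ProductError

/-! ### Moments of the standard normal distribution -/

section Gaussian

lemma integrable_pow_gaussianReal (m : ℝ) (v : ℝ≥0) (n : ℕ) :
    Integrable (fun z : ℝ => z ^ n) (gaussianReal m v) := by
  rcases Nat.eq_zero_or_pos n with rfl | hn
  · simp
  · have h := (memLp_id_gaussianReal (μ := m) (v := v) (n : ℝ≥0)).integrable_norm_pow (p := n) hn.ne'
    refine (integrable_norm_iff (by fun_prop)).1 (h.congr (ae_of_all _ fun z => ?_))
    simp

lemma integral_pow_gaussianReal (n : ℕ) :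
    ∫ z, z ^ n ∂(gaussianReal 0 1) = iteratedDeriv n (fun t : ℝ => Real.exp (t ^ 2 / 2)) 0 := by
  have h := iteratedDeriv_mgf_zero (X := fun x : ℝ => x) (μ := gaussianReal 0 1) (by simp) n
  rw [mgf_fun_id_gaussianReal] at h
  simp only [zero_mul, zero_add, NNReal.coe_one, one_mul] at h
  rw [h]
  simp

/-- The moments are the derivatives at 0 of e^{t²/2}. This is the recursion p ↦ p' + tp for their
polynomial factors. -/
lemma deriv_mul_exp_sq_div_two (p : ℝ → ℝ) (p' : ℝ → ℝ) (hp : ∀ t, HasDerivAt p (p' t) t) :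
    deriv (fun t : ℝ => p t * Real.exp (t ^ 2 / 2))
      = fun t => (p' t + t * p t) * Real.exp (t ^ 2 / 2) := by
  funext t
  have h2 : HasDerivAt (fun t : ℝ => t ^ 2 / 2) t t := by
    simpa using (hasDerivAt_pow 2 t).div_const 2
  have h := (hp t).mul h2.exp
  refine (h.congr_deriv ?_).deriv
  ring

lemma gaussian_moments :
    (∫ z, z ∂(gaussianReal 0 1) = 0) ∧ (∫ z, z ^ 2 ∂(gaussianReal 0 1) = 1) ∧
    (∫ z, z ^ 3 ∂(gaussianReal 0 1) = 0) ∧ (∫ z, z ^ 4 ∂(gaussianReal 0 1) = 3) := by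
  have d0 : deriv (fun t : ℝ => Real.exp (t ^ 2 / 2)) = fun t => t * Real.exp (t ^ 2 / 2) := by
    have := deriv_mul_exp_sq_div_two (fun _ => 1) (fun _ => 0) (fun t => hasDerivAt_const t 1)
    simpa using this
  have d1 := deriv_mul_exp_sq_div_two (fun t => t) (fun _ => 1) (fun t => hasDerivAt_id t)
  have d2 := deriv_mul_exp_sq_div_two (fun t => 1 + t * t) (fun t => 2 * t) (fun t => by
    simpa [two_mul] using ((hasDerivAt_id t).mul (hasDerivAt_id t)).const_add 1)
  have d3 := deriv_mul_exp_sq_div_two (fun t => 2 * t + t * (1 + t * t)) (fun t => 3 + 3 * t ^ 2)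
    (fun t => by
      have h := ((hasDerivAt_id t).const_mul 2).add
        ((hasDerivAt_id t).mul (((hasDerivAt_id t).mul (hasDerivAt_id t)).const_add 1))
      refine h.congr_deriv ?_
      simp only [id_eq, Pi.mul_apply, mul_one, one_mul]
      ring)
  refine ⟨by simp, ?_, ?_, ?_⟩
  · rw [integral_pow_gaussianReal, iteratedDeriv_succ, iteratedDeriv_one, d0, d1]; simp
  · rw [integral_pow_gaussianReal, iteratedDeriv_succ, iteratedDeriv_succ, iteratedDeriv_one,
      d0, d1, d2]
    simp
  · rw [integral_pow_gaussianReal, iteratedDeriv_succ, iteratedDeriv_succ, iteratedDeriv_succ,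
      iteratedDeriv_one, d0, d1, d2, d3]
    simp

lemma integrable_quartic_gaussianReal (c₀ c₁ c₂ c₃ c₄ : ℝ) :
    Integrable (fun z : ℝ => c₀ + c₁ * z + c₂ * z ^ 2 + c₃ * z ^ 3 + c₄ * z ^ 4)
      (gaussianReal 0 1) := by
  have i := integrable_pow_gaussianReal 0 1
  have i1 : Integrable (fun z : ℝ => z) (gaussianReal 0 1) := by simpa using i 1
  exact ((((integrable_const _).add (i1.const_mul _)).add ((i 2).const_mul _)).add
    ((i 3).const_mul _)).add ((i 4).const_mul _)

lemma integral_quartic_gaussianReal (c₀ c₁ c₂ c₃ c₄ : ℝ) :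
    ∫ z : ℝ, (c₀ + c₁ * z + c₂ * z ^ 2 + c₃ * z ^ 3 + c₄ * z ^ 4) ∂(gaussianReal 0 1)
      = c₀ + c₂ + 3 * c₄ := by
  have i := integrable_pow_gaussianReal 0 1
  have i1 : Integrable (fun z : ℝ => z) (gaussianReal 0 1) := by simpa using i 1
  have j1 : Integrable (fun z : ℝ => c₀ + c₁ * z) (gaussianReal 0 1) :=
    (integrable_const _).add (i1.const_mul _)
  have j2 : Integrable (fun z : ℝ => c₀ + c₁ * z + c₂ * z ^ 2) (gaussianReal 0 1) :=
    j1.add ((i 2).const_mul _)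
  have j3 : Integrable (fun z : ℝ => c₀ + c₁ * z + c₂ * z ^ 2 + c₃ * z ^ 3) (gaussianReal 0 1) :=
    j2.add ((i 3).const_mul _)
  obtain ⟨m1, m2, m3, m4⟩ := gaussian_moments
  rw [integral_add j3 ((i 4).const_mul _), integral_add j2 ((i 3).const_mul _),
    integral_add j1 ((i 2).const_mul _), integral_add (integrable_const _) (i1.const_mul _),
    integral_const_mul, integral_const_mul, integral_const_mul, integral_const_mul, m1, m2, m3, m4]
  simp
  ring

lemma continuous_noiseScale : Continuous noiseScale := by unfold noiseScale; fun_prop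

lemma integrable_noiseScale_pow (n : ℕ) :
    Integrable (fun z => noiseScale z ^ n) (gaussianReal 0 1) := by
  simp only [noiseScale, add_comm (1 : ℝ), add_pow, one_pow, mul_one, ← pow_mul]
  exact integrable_finsetSum _ fun i _ => (integrable_pow_gaussianReal 0 1 _).mul_const _

/-- The moments `E(1 + Z²)ⁿ` of a standard normal variable. -/
noncomputable def noiseMoment (n : ℕ) : ℝ := ∫ z, noiseScale z ^ n ∂(gaussianReal 0 1)

lemma noiseMoment_nonneg (n : ℕ) : 0 ≤ noiseMoment n :=
  integral_nonneg fun z => pow_nonneg (zero_le_one.trans (one_le_noiseScale z)) n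

lemma noiseMoment_mono {m n : ℕ} (h : m ≤ n) : noiseMoment m ≤ noiseMoment n :=
  integral_mono (integrable_noiseScale_pow m) (integrable_noiseScale_pow n)
    fun z => pow_le_pow_right₀ (one_le_noiseScale z) h

end Gaussian

/-! ### Normalised Brownian increments -/

section Brownian

variable {Ω : Type*} [MeasurableSpace Ω] {P : Measure Ω} {M : ℝ≥0 → Ω → ℝ}

lemma iIndepFun_noise (hM : IsBrownianReal M P) {k : ℝ} (hk : 0 < k) :
    iIndepFun (fun i => noise M k i) P := by
  have ht : Monotone fun i : ℕ => ((i : ℝ) * k).toNNReal := fun i j hij =>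
    Real.toNNReal_le_toNNReal (mul_le_mul_of_nonneg_right (by exact_mod_cast hij) hk.le)
  have := (hM.hasIndepIncrements.nat ht).comp (fun _ x => x / √k) (fun _ => by fun_prop)
  convert this using 2 with i
  funext ω
  simp [noise]

lemma hasLaw_noise (hM : IsBrownianReal M P) {k : ℝ} (hk : 0 < k) (i : ℕ) :
    HasLaw (noise M k i) (gaussianReal 0 1) P := by
  have h := gaussianReal_div_const (hM.hasLaw_sub (((i : ℝ) + 1) * k).toNNReal
    ((i : ℝ) * k).toNNReal) (√k)
  convert h using 1
  · funext ω; simp [noise]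
  congr 1
  · simp
  · refine NNReal.eq ?_
    have h1 : 0 ≤ ((i : ℝ) + 1) * k := by positivity
    have h2 : 0 ≤ (i : ℝ) * k := by positivity
    simp only [NNReal.coe_one, NNReal.coe_div, coe_nndist, NNReal.val_eq_coe,
      Real.coe_toNNReal _ h1, Real.coe_toNNReal _ h2, NNReal.coe_mk, Real.sq_sqrt hk.le,
      Real.dist_eq]
    rw [show ((i : ℝ) + 1) * k - i * k = k by ring, abs_of_pos hk, div_self hk.ne']

/-- The increments telescope. M₀ is kept because it vanishes only almost surely, while this identity
holds on every path. -/
lemma sqrt_mul_sum_noise {Ω' : Type*} (M : ℝ≥0 → Ω' → ℝ) {k : ℝ} (hk : 0 < k) (n : ℕ) (ω : Ω') :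
    √k * ∑ i ∈ Finset.range n, noise M k i ω = M ((n : ℝ) * k).toNNReal ω - M 0 ω := by
  rw [Finset.mul_sum]
  have : ∀ i ∈ Finset.range n, √k * noise M k i ω
      = (fun j : ℕ => M ((j : ℝ) * k).toNNReal ω) (i + 1)
        - (fun j : ℕ => M ((j : ℝ) * k).toNNReal ω) i := fun i _ => by
    have : √k ≠ 0 := (Real.sqrt_pos.2 hk).ne'
    simp only [noise]
    push_cast
    field_simp
  rw [Finset.sum_congr rfl this, Finset.sum_range_sub (fun j : ℕ => M ((j : ℝ) * k).toNNReal ω)]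
  simp

end Brownian

/-! ### One-step moments: growth, stability and consistency -/

section OneStepMoments

lemma continuous_ampFactor (μ ρ κ k h : ℝ) : Continuous (ampFactor μ ρ κ k h) := by
  unfold ampFactor; fun_prop

lemma continuous_exp_exactExponent (μ ρ κ k : ℝ) :
    Continuous fun z : ℝ => Complex.exp (exactExponent μ ρ κ k (√k * z)) := by
  unfold exactExponent; fun_prop

lemma norm_ampFactor_sq (μ ρ κ k h z : ℝ) :
    ‖ampFactor μ ρ κ k h z‖ ^ 2
      = (1 - ((1 - ρ) + ρ * z ^ 2) * (2 * k / h ^ 2 * Real.sin (κ * h / 2) ^ 2)) ^ 2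
        + (μ * k / h * Real.sin (κ * h) + √(ρ * k) / h * Real.sin (κ * h) * z) ^ 2 := by
  have : ampFactor μ ρ κ k h z
      = ((1 - ((1 - ρ) + ρ * z ^ 2) * (2 * k / h ^ 2 * Real.sin (κ * h / 2) ^ 2) : ℝ) : ℂ)
        + ((-(μ * k / h * Real.sin (κ * h) + √(ρ * k) / h * Real.sin (κ * h) * z) : ℝ) : ℂ)
          * Complex.I := by
    simp only [ampFactor, coefA, coefB, coefC]
    push_cast
    ring
  rw [this, ← Complex.normSq_eq_norm_sq, Complex.normSq_add_mul_I]
  ring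

/-- The mean square amplification factor of the scheme. -/
lemma integrable_and_integral_norm_ampFactor_sq {ρ k : ℝ} (hρ0 : 0 ≤ ρ) (hk : 0 ≤ k) (μ κ h : ℝ) :
    Integrable (fun z => ‖ampFactor μ ρ κ k h z‖ ^ 2) (gaussianReal 0 1) ∧
    ∫ z, ‖ampFactor μ ρ κ k h z‖ ^ 2 ∂(gaussianReal 0 1)
      = (1 - 2 * k / h ^ 2 * Real.sin (κ * h / 2) ^ 2) ^ 2
        + 2 * ρ ^ 2 * (2 * k / h ^ 2 * Real.sin (κ * h / 2) ^ 2) ^ 2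
        + (μ * k / h * Real.sin (κ * h)) ^ 2 + ρ * k * (Real.sin (κ * h) / h) ^ 2 := by
  set q := 2 * k / h ^ 2 * Real.sin (κ * h / 2) ^ 2 with hq
  set s := Real.sin (κ * h) with hs
  -- A quartic in z. Since E z⁴ = 3 while (E z²)² = 1, the squared real part averages to (1-q)² +
  -- 2ρ²q²; this is the source of 1+2ρ² in the stability condition.
  have e : (fun z => ‖ampFactor μ ρ κ k h z‖ ^ 2) = fun z : ℝ =>
      ((1 - (1 - ρ) * q) ^ 2 + (μ * k / h * s) ^ 2)
        + (2 * (μ * k / h * s) * (√(ρ * k) / h * s)) * z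
        + (-2 * (1 - (1 - ρ) * q) * ρ * q + ρ * k * (s / h) ^ 2) * z ^ 2
        + 0 * z ^ 3 + (ρ * q) ^ 2 * z ^ 4 := by
    funext z
    rw [norm_ampFactor_sq, ← hq, ← hs]
    have h2 : (√(ρ * k) / h * s * z) ^ 2 = ρ * k * (s / h) ^ 2 * z ^ 2 := by
      rw [show (√(ρ * k) / h * s * z) ^ 2 = √(ρ * k) ^ 2 * (s / h) ^ 2 * z ^ 2 by ring,
        Real.sq_sqrt (mul_nonneg hρ0 hk)]
    linear_combination h2
  rw [e]
  refine ⟨integrable_quartic_gaussianReal _ _ _ _ _, ?_⟩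
  rw [integral_quartic_gaussianReal]
  ring

lemma memLp_ampFactor {ρ k : ℝ} (hρ0 : 0 ≤ ρ) (hk : 0 ≤ k) (μ κ h : ℝ) :
    MemLp (ampFactor μ ρ κ k h) 2 (gaussianReal 0 1) :=
  (memLp_two_iff_integrable_sq_norm (continuous_ampFactor μ ρ κ k h).aestronglyMeasurable).2
    (integrable_and_integral_norm_ampFactor_sq hρ0 hk μ κ h).1

lemma norm_exp_exactExponent (μ ρ κ t m : ℝ) :
    ‖Complex.exp (exactExponent μ ρ κ t m)‖ = Real.exp (-((1 / 2) * (1 - ρ) * κ ^ 2 * t)) := by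
  rw [Complex.norm_exp, exactExponent_re]

lemma norm_exp_exactExponent_le_one {ρ t : ℝ} (hρ1 : ρ ≤ 1) (ht : 0 ≤ t) (μ κ m : ℝ) :
    ‖Complex.exp (exactExponent μ ρ κ t m)‖ ≤ 1 := by
  rw [norm_exp_exactExponent, Real.exp_le_one_iff]
  have := sub_nonneg.2 hρ1
  have : 0 ≤ (1 / 2) * (1 - ρ) * κ ^ 2 * t := by positivity
  linarith

lemma memLp_exp_exactExponent {ρ k : ℝ} (hρ1 : ρ ≤ 1) (hk : 0 ≤ k) (μ κ : ℝ) :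
    MemLp (fun z : ℝ => Complex.exp (exactExponent μ ρ κ k (√k * z))) 2 (gaussianReal 0 1) :=
  MemLp.of_bound (continuous_exp_exactExponent μ ρ κ k).aestronglyMeasurable 1
    (ae_of_all _ fun _ => norm_exp_exactExponent_le_one hρ1 hk μ κ _)

lemma integral_norm_exp_exactExponent_sq (μ ρ κ k : ℝ) :
    ∫ z : ℝ, ‖Complex.exp (exactExponent μ ρ κ k (√k * z))‖ ^ 2 ∂(gaussianReal 0 1)
      = Real.exp (-((1 - ρ) * κ ^ 2 * k)) := by
  simp only [norm_exp_exactExponent, integral_const, probReal_univ, one_smul, ← Real.exp_nat_mul]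
  congr 1
  push_cast
  ring

/-- For a fixed wave number the mean square amplification is at most `1 + O(k)`. -/
lemma integral_norm_ampFactor_sq_le {ρ k h : ℝ} (hρ0 : 0 ≤ ρ) (hρ1 : ρ ≤ 1) (hk : 0 ≤ k)
    (hk1 : k ≤ 1) (hh : 0 < h) (μ κ : ℝ) :
    ∫ z, ‖ampFactor μ ρ κ k h z‖ ^ 2 ∂(gaussianReal 0 1)
      ≤ 1 + (κ ^ 4 + (μ * κ) ^ 2 + κ ^ 2) * k := by
  rw [(integrable_and_integral_norm_ampFactor_sq hρ0 hk μ κ h).2]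
  set q := 2 * k / h ^ 2 * Real.sin (κ * h / 2) ^ 2 with hq
  have hs : (Real.sin (κ * h) / h) ^ 2 ≤ κ ^ 2 := by
    rw [div_pow, div_le_iff₀ (by positivity), ← mul_pow]
    exact sq_le_sq.2 Real.abs_sin_le_abs
  have hq0 : 0 ≤ q := by positivity
  have hqk : q ≤ κ ^ 2 * k / 2 := by
    have h1 : Real.sin (κ * h / 2) ^ 2 ≤ (κ * h / 2) ^ 2 := sq_le_sq.2 Real.abs_sin_le_abs
    calc q ≤ 2 * k / h ^ 2 * (κ * h / 2) ^ 2 := mul_le_mul_of_nonneg_left h1 (by positivity)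
      _ = κ ^ 2 * k / 2 := by field_simp
  have hρ2 : ρ ^ 2 ≤ 1 := pow_le_one₀ hρ0 hρ1
  have hqq : q ^ 2 ≤ κ ^ 4 * k / 4 := by
    have h1 : q ^ 2 ≤ (κ ^ 2 * k / 2) ^ 2 := pow_le_pow_left₀ hq0 hqk 2
    have h2 : κ ^ 4 * (k * k) ≤ κ ^ 4 * k :=
      mul_le_mul_of_nonneg_left (mul_le_of_le_one_right hk hk1) (by positivity)
    nlinarith
  have t1 : (1 - q) ^ 2 + 2 * ρ ^ 2 * q ^ 2 ≤ 1 + κ ^ 4 * k := by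
    have : ρ ^ 2 * q ^ 2 ≤ q ^ 2 := mul_le_of_le_one_left (sq_nonneg q) hρ2
    have : 0 ≤ κ ^ 4 * k := by positivity
    nlinarith
  have t2 : (μ * k / h * Real.sin (κ * h)) ^ 2 ≤ (μ * κ) ^ 2 * k := by
    have e : (μ * k / h * Real.sin (κ * h)) ^ 2
        = μ ^ 2 * (k * k) * (Real.sin (κ * h) / h) ^ 2 := by ring
    rw [e]
    calc μ ^ 2 * (k * k) * (Real.sin (κ * h) / h) ^ 2 ≤ μ ^ 2 * k * κ ^ 2 :=
          mul_le_mul (mul_le_mul_of_nonneg_left (mul_le_of_le_one_right hk hk1) (sq_nonneg μ)) hs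
            (sq_nonneg _) (by positivity)
      _ = _ := by ring
  have t3 : ρ * k * (Real.sin (κ * h) / h) ^ 2 ≤ κ ^ 2 * k := by
    calc ρ * k * (Real.sin (κ * h) / h) ^ 2 ≤ 1 * k * κ ^ 2 :=
          mul_le_mul (mul_le_mul_of_nonneg_right hρ1 hk) hs (sq_nonneg _) (by positivity)
      _ = _ := by ring
  linarith

/-- Mean square stability: damping of every resolved wave number. -/
lemma integral_norm_ampFactor_sq_le_exp {ρ k h lam η : ℝ} (hρ0 : 0 ≤ ρ) (hk : 0 < k)
    (hh : 0 < h) (hkh : k ≤ lam * h ^ 2) (hη1 : η ≤ 1 - ρ)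
    (hη2 : η ≤ 1 - (1 + 2 * ρ ^ 2) * lam) (μ : ℝ) (hμ : 2 * (μ ^ 2 * k) ≤ η) {κ : ℝ}
    (hκ : |κ| * h ≤ Real.pi) :
    ∫ z, ‖ampFactor μ ρ κ k h z‖ ^ 2 ∂(gaussianReal 0 1)
      ≤ Real.exp (-(2 * η / Real.pi ^ 2 * κ ^ 2 * k)) := by
  rw [(integrable_and_integral_norm_ampFactor_sq hρ0 hk.le μ κ h).2]
  set y := Real.sin (κ * h / 2) ^ 2 with hy
  have hη0 : 0 ≤ η := le_trans (by positivity) hμ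
  have hy0 : 0 ≤ y := sq_nonneg _
  have hy1 : y ≤ 1 := by rw [hy]; exact Real.sin_sq_le_one _
  have hs : Real.sin (κ * h) ^ 2 = 4 * y * (1 - y) := by
    rw [show κ * h = 2 * (κ * h / 2) by ring, Real.sin_two_mul, mul_pow, mul_pow, Real.cos_sq', hy]
    ring_nf
  set q := 2 * k / h ^ 2 * y with hq
  have hq0 : 0 ≤ q := by positivity
  have hql : q ≤ 2 * lam * y := by
    rw [hq]
    refine mul_le_mul_of_nonneg_right ?_ hy0
    rw [div_le_iff₀ (by positivity)]
    linarith
  have e2 : (μ * k / h * Real.sin (κ * h)) ^ 2 = μ ^ 2 * k * (2 * q * (1 - y)) := by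
    rw [mul_pow, hs, hq]; field_simp; ring
  have e3 : ρ * k * (Real.sin (κ * h) / h) ^ 2 = ρ * (2 * q * (1 - y)) := by
    rw [div_pow, hs, hq]; field_simp; ring
  rw [e2, e3]
  -- The second moment is 1-2q times the right-hand side. Bounding q by 2λy turns that side into a
  -- function affine in y ∈ [0,1]: its value 1-ρ-μ²k at y = 0 is controlled by ρ < 1 and small k,
  -- and its value 1-(1+2ρ²)λ at y = 1 by the step-size condition.
  have key : η / 2 ≤ 1 - ρ * (1 - y) - q * (1 + 2 * ρ ^ 2) / 2 - μ ^ 2 * k * (1 - y) := by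
    have a1 : q * (1 + 2 * ρ ^ 2) ≤ 2 * lam * y * (1 + 2 * ρ ^ 2) :=
      mul_le_mul_of_nonneg_right hql (by positivity)
    have a2 : μ ^ 2 * k * (1 - y) ≤ μ ^ 2 * k := mul_le_of_le_one_right (by positivity) (by linarith)
    have a3 : η * (1 - y) ≤ (1 - ρ) * (1 - y) := mul_le_mul_of_nonneg_right hη1 (by linarith)
    have a4 : η * y ≤ (1 - (1 + 2 * ρ ^ 2) * lam) * y := mul_le_mul_of_nonneg_right hη2 hy0
    nlinarith
  -- Jordan's inequality for the sine, valid since |κ|h/2 ≤ π/2; it converts damping in q into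
  -- damping in κ²k.
  have hy2 : κ ^ 2 * h ^ 2 / Real.pi ^ 2 ≤ y := by
    have h1 : 2 / Real.pi * (|κ| * h / 2) ≤ Real.sin (|κ| * h / 2) :=
      Real.mul_le_sin (by positivity) (by linarith)
    have h2 : y = Real.sin (|κ| * h / 2) ^ 2 := by
      rw [hy]
      rcases abs_choice κ with h' | h' <;> rw [h']
      rw [show -κ * h / 2 = -(κ * h / 2) by ring, Real.sin_neg, neg_sq]
    rw [h2, ← sq_abs κ]
    calc _ = (2 / Real.pi * (|κ| * h / 2)) ^ 2 := by field_simp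
      _ ≤ _ := pow_le_pow_left₀ (by positivity) h1 2
  have hqlow : 2 * κ ^ 2 * k / Real.pi ^ 2 ≤ q := by
    calc 2 * κ ^ 2 * k / Real.pi ^ 2 = 2 * k / h ^ 2 * (κ ^ 2 * h ^ 2 / Real.pi ^ 2) := by
          field_simp
      _ ≤ q := mul_le_mul_of_nonneg_left hy2 (by positivity)
  have b1 := mul_le_mul_of_nonneg_left key hq0
  have b2 := mul_le_mul_of_nonneg_left hqlow hη0
  have b3 := Real.add_one_le_exp (-(2 * η / Real.pi ^ 2 * κ ^ 2 * k))
  have b4 : 2 * η / Real.pi ^ 2 * κ ^ 2 * k = η * (2 * κ ^ 2 * k / Real.pi ^ 2) := by ring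
  rw [b4] at b3 ⊢
  nlinarith

/-- This removes the dominant part of the one-step error from its mean. -/
lemma integral_odd_eq_zero (c₁ c₃ : ℂ) :
    Integrable (fun z : ℝ => c₁ * z + c₃ * (z : ℂ) ^ 3) (gaussianReal 0 1) ∧
    ∫ z : ℝ, (c₁ * z + c₃ * (z : ℂ) ^ 3) ∂(gaussianReal 0 1) = 0 := by
  obtain ⟨m1, -, m3, -⟩ := gaussian_moments
  have i1 : Integrable (fun z : ℝ => (z : ℂ)) (gaussianReal 0 1) := by
    simpa using (integrable_pow_gaussianReal 0 1 1).ofReal (𝕜 := ℂ)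
  have i3 : Integrable (fun z : ℝ => (z : ℂ) ^ 3) (gaussianReal 0 1) := by
    simpa using (integrable_pow_gaussianReal 0 1 3).ofReal (𝕜 := ℂ)
  refine ⟨(i1.const_mul _).add (i3.const_mul _), ?_⟩
  rw [integral_add (i1.const_mul _) (i3.const_mul _), integral_const_mul, integral_const_mul]
  have e3 : ∫ z : ℝ, (z : ℂ) ^ 3 ∂(gaussianReal 0 1) = 0 := by
    have := integral_complex_ofReal (μ := gaussianReal 0 1) (f := fun z : ℝ => z ^ 3)
    rw [m3] at this
    simpa using this
  have e1 : ∫ z : ℝ, (z : ℂ) ∂(gaussianReal 0 1) = 0 := by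
    rw [integral_complex_ofReal, m1]; simp
  rw [e1, e3]; simp

lemma sq_sqrt_mul {k : ℝ} (hk : 0 ≤ k) (x : ℝ) : (√k * x) ^ 2 = k * x ^ 2 := by
  rw [mul_pow, Real.sq_sqrt hk]

lemma integral_norm_amp_sub_exp_sq_le {ρ : ℝ} (hρ0 : 0 ≤ ρ) (hρ1 : ρ ≤ 1) (μ κ : ℝ) {k h : ℝ}
    (hk : 0 < k) (hk1 : k ≤ 1) (hh : 0 < h) :
    ∫ z : ℝ, ‖ampFactor μ ρ κ k h z - Complex.exp (exactExponent μ ρ κ k (√k * z))‖ ^ 2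
        ∂(gaussianReal 0 1)
      ≤ 203 ^ 2 * waveScale μ κ ^ 8 * noiseMoment 8 * (k * (k + h ^ 2) ^ 2) := by
  have hint := integrable_norm_sq_of_memLp
    ((memLp_ampFactor hρ0 hk.le μ κ h).sub (memLp_exp_exactExponent hρ1 hk.le μ κ))
  have hb := ((integrable_noiseScale_pow 8).const_mul (203 ^ 2 * waveScale μ κ ^ 8)).mul_const
    (k * (k + h ^ 2) ^ 2)
  refine (integral_mono hint hb fun z => ?_).trans_eq ?_
  · have := pow_le_pow_left₀ (norm_nonneg _) (norm_amp_sub_exp_le hρ0 hρ1 μ κ z hk hk1 hh) 2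
    refine this.trans_eq ?_
    rw [mul_pow _ (√k * (k + h ^ 2)), sq_sqrt_mul hk.le]
    ring
  · rw [integral_mul_const, integral_const_mul, noiseMoment]

/-- Direct Cauchy–Schwarz would give only √k(k+h²). Write f = 1+(f-1): the mean of d sees only
`oneStepRest`, because the odd part averages to zero, and in the other term f-1 = O(√k) meets d =
O(√k(k+h²)). -/
lemma norm_integral_amp_mul_conj_le {ρ : ℝ} (hρ0 : 0 ≤ ρ) (hρ1 : ρ ≤ 1) (μ κ : ℝ) {k h : ℝ}
    (hk : 0 < k) (hk1 : k ≤ 1) (hh : 0 < h) (hh1 : h ≤ 1) :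
    ‖∫ z : ℝ, ampFactor μ ρ κ k h z * starRingEnd ℂ
        (ampFactor μ ρ κ k h z - Complex.exp (exactExponent μ ρ κ k (√k * z)))
        ∂(gaussianReal 0 1)‖
      ≤ 83836 * waveScale μ κ ^ 8 * noiseMoment 8 * (k * (k + h ^ 2)) := by
  set f := ampFactor μ ρ κ k h
  set d : ℝ → ℂ := fun z => f z - Complex.exp (exactExponent μ ρ κ k (√k * z)) with hd
  have mf : MemLp f 2 (gaussianReal 0 1) := memLp_ampFactor hρ0 hk.le μ κ h
  have md : MemLp d 2 (gaussianReal 0 1) := mf.sub (memLp_exp_exactExponent hρ1 hk.le μ κ)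
  have mf1 : MemLp (fun z => f z - 1) 2 (gaussianReal 0 1) := mf.sub (memLp_const 1)
  have id : Integrable d (gaussianReal 0 1) := md.integrable one_le_two
  have idc : Integrable (fun z => starRingEnd ℂ (d z)) (gaussianReal 0 1) :=
    (Complex.conjLIE.toContinuousLinearEquiv : ℂ →L[ℝ] ℂ).integrable_comp id
  have iprod := integrable_mul_conj mf1 md
  have e : ∫ z, f z * starRingEnd ℂ (d z) ∂(gaussianReal 0 1)
      = (∫ z, (f z - 1) * starRingEnd ℂ (d z) ∂(gaussianReal 0 1))
        + ∫ z, starRingEnd ℂ (d z) ∂(gaussianReal 0 1) := by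
    rw [← integral_add iprod idc]
    congr 1; funext z; ring
  have h1 : ‖∫ z, starRingEnd ℂ (d z) ∂(gaussianReal 0 1)‖
      ≤ 200 * waveScale μ κ ^ 4 * noiseMoment 4 * (k * (k + h ^ 2)) := by
    rw [integral_conj, RCLike.norm_conj]
    obtain ⟨io, eo⟩ := integral_odd_eq_zero (linCoef μ ρ κ k h) (cubCoef ρ κ k)
    have ed : ∫ z, d z ∂(gaussianReal 0 1)
        = ∫ z, oneStepRest μ ρ κ k h z ∂(gaussianReal 0 1) := by
      have : (fun z => oneStepRest μ ρ κ k h z) = fun z : ℝ =>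
          d z - (linCoef μ ρ κ k h * z + cubCoef ρ κ k * (z : ℂ) ^ 3) := rfl
      rw [this, integral_sub id io, eo, sub_zero]
    rw [ed]
    refine (norm_integral_le_of_norm_le (((integrable_noiseScale_pow 4).const_mul
      (200 * waveScale μ κ ^ 4)).mul_const (k * (k + h ^ 2)))
      (ae_of_all _ fun z => norm_oneStepRest_le hρ0 hρ1 μ κ z hk hk1 hh)).trans_eq ?_
    rw [integral_mul_const, integral_const_mul, noiseMoment]
  have h2 : ‖∫ z, (f z - 1) * starRingEnd ℂ (d z) ∂(gaussianReal 0 1)‖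
      ≤ 83636 * waveScale μ κ ^ 8 * noiseMoment 8 * (k * (k + h ^ 2)) := by
    refine (norm_integral_le_of_norm_le (((integrable_noiseScale_pow 8).const_mul
      (83636 * waveScale μ κ ^ 8)).mul_const (k * (k + h ^ 2)))
      (ae_of_all _ fun z => ?_)).trans_eq ?_
    · rw [norm_mul, RCLike.norm_conj]
      have hU := waveScale_pos μ κ
      have hY := one_pos.trans_le (one_le_noiseScale z)
      refine (mul_le_mul (norm_amp_sub_one_le hρ0 hρ1 μ κ z hk hk1 hh hh1)
        (norm_amp_sub_exp_le hρ0 hρ1 μ κ z hk hk1 hh) (norm_nonneg _) (by positivity)).trans_eq ?_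
      have hs : √k * √k = k := Real.mul_self_sqrt hk.le
      calc _ = 83636 * waveScale μ κ ^ 8 * noiseScale z ^ 8 * ((√k * √k) * (k + h ^ 2)) := by ring
        _ = _ := by rw [hs]
    · rw [integral_mul_const, integral_const_mul, noiseMoment]
  rw [e]
  refine (norm_add_le _ _).trans ?_
  have hU1 := one_le_waveScale μ κ
  have c1 : waveScale μ κ ^ 4 * noiseMoment 4 ≤ waveScale μ κ ^ 8 * noiseMoment 8 :=
    mul_le_mul (pow_le_pow_right₀ hU1 (by norm_num)) (noiseMoment_mono (by norm_num))
      (noiseMoment_nonneg 4) (by positivity)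
  have c2 := mul_le_mul_of_nonneg_right c1 (by positivity : 0 ≤ k * (k + h ^ 2))
  linarith

/-- The constant in the mean square consistency bound. -/
noncomputable def consistencyConst : ℝ := 203 ^ 2 * noiseMoment 8 + (83836 * noiseMoment 8) ^ 2

lemma consistencyConst_nonneg : 0 ≤ consistencyConst := by
  have := noiseMoment_nonneg 8
  unfold consistencyConst; positivity

variable {Ω : Type*} [MeasurableSpace Ω] {P : Measure Ω}

/-- Mean square error of the discrete amplification over `n` steps, in terms of a bound `G` for
the one-step growth factors. -/
lemma lintegral_prod_amp_sub_prod_exp_sq_le {Z : ℕ → Ω → ℝ} (hZ : iIndepFun Z P)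
    (hlaw : ∀ i, HasLaw (Z i) (gaussianReal 0 1) P) {ρ : ℝ} (hρ0 : 0 ≤ ρ) (hρ1 : ρ ≤ 1)
    (μ κ : ℝ) {k h G : ℝ} (hk : 0 < k) (hk1 : k ≤ 1) (hh : 0 < h) (hh1 : h ≤ 1) (hG : 0 < G)
    (hfG : (∫ z, ‖ampFactor μ ρ κ k h z‖ ^ 2 ∂(gaussianReal 0 1)) + k ≤ G)
    (hgG : Real.exp (-((1 - ρ) * κ ^ 2 * k)) ≤ G) (n : ℕ) :
    ∫⁻ ω, ‖∏ i ∈ Finset.range n, ampFactor μ ρ κ k h (Z i ω)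
        - ∏ i ∈ Finset.range n, Complex.exp (exactExponent μ ρ κ k (√k * Z i ω))‖ₑ ^ 2 ∂P
      ≤ ENNReal.ofReal (G ^ n / G * ((n * k) * (consistencyConst * waveScale μ κ ^ 16
          * (k + h ^ 2) ^ 2))) := by
  have key := lintegral_prod_sub_prod_sq_le hZ hlaw (memLp_ampFactor hρ0 hk.le μ κ h)
    (memLp_exp_exactExponent hρ1 hk.le μ κ) hk hG hfG
    ((integral_norm_exp_exactExponent_sq μ ρ κ k).trans_le hgG)
    (integral_norm_amp_sub_exp_sq_le hρ0 hρ1 μ κ hk hk1 hh)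
    (norm_integral_amp_mul_conj_le hρ0 hρ1 μ κ hk hk1 hh hh1) n
  refine key.trans (ENNReal.ofReal_le_ofReal ?_)
  have hU1 := one_le_waveScale μ κ
  have hm := noiseMoment_nonneg 8
  -- The choice τ = k makes the squared weak error divided by τ of the same order k(k+h²)² as the
  -- strong one, so n steps cost nk(k+h²)².
  have hS : 203 ^ 2 * waveScale μ κ ^ 8 * noiseMoment 8 * (k * (k + h ^ 2) ^ 2)
      + (83836 * waveScale μ κ ^ 8 * noiseMoment 8 * (k * (k + h ^ 2))) ^ 2 / k
      ≤ k * (consistencyConst * waveScale μ κ ^ 16 * (k + h ^ 2) ^ 2) := by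
    have e : (83836 * waveScale μ κ ^ 8 * noiseMoment 8 * (k * (k + h ^ 2))) ^ 2 / k
        = (83836 * noiseMoment 8) ^ 2 * waveScale μ κ ^ 16 * (k * (k + h ^ 2) ^ 2) := by
      field_simp
    have h8 : waveScale μ κ ^ 8 ≤ waveScale μ κ ^ 16 := pow_le_pow_right₀ hU1 (by norm_num)
    have := mul_le_mul_of_nonneg_left h8
      (by positivity : 0 ≤ 203 ^ 2 * noiseMoment 8 * (k * (k + h ^ 2) ^ 2))
    rw [e, consistencyConst]
    linarith
  have := mul_le_mul_of_nonneg_left hS (by positivity : 0 ≤ n * G ^ n / G)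
  refine this.trans_eq ?_
  ring

end OneStepMoments

/-! ### Discrete and exact Fourier modes -/

section Modes

lemma mode_add (κ x y : ℝ) : mode κ (x + y) = mode κ x * mode κ y := by
  rw [mode, mode, mode, ← Complex.exp_add]; push_cast; ring_nf

lemma norm_mode (κ x : ℝ) : ‖mode κ x‖ = 1 := by
  rw [mode, mul_comm]; exact Complex.norm_exp_ofReal_mul_I _

lemma mode_eq_cos_add_sin (κ x : ℝ) :
    mode κ x = (Real.cos (κ * x) : ℂ) + (Real.sin (κ * x) : ℂ) * Complex.I := by
  rw [mode, mul_comm, Complex.exp_mul_I, Complex.ofReal_cos, Complex.ofReal_sin]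

/-- One step of the scheme multiplies a discrete mode by the amplification factor. -/
lemma milsteinStep_mode (μ ρ κ k h z : ℝ) (c : ℂ) (j : ℤ) :
    milsteinStep μ ρ k h z (fun i : ℤ => c * mode κ (i * h)) j
      = c * ampFactor μ ρ κ k h z * mode κ (j * h) := by
  have e1 : mode κ (((j + 1 : ℤ) : ℝ) * h) = mode κ (j * h) * mode κ h := by
    rw [← mode_add]; push_cast; ring_nf
  have e2 : mode κ (((j - 1 : ℤ) : ℝ) * h) = mode κ (j * h) * mode κ (-h) := by
    rw [← mode_add]; push_cast; ring_nf
  have hc : Real.cos (κ * h) = 1 - 2 * Real.sin (κ * h / 2) ^ 2 := by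
    rw [← Real.cos_sq_add_sin_sq (κ * h / 2)]
    conv_lhs => rw [show κ * h = 2 * (κ * h / 2) by ring, Real.cos_two_mul']
    ring
  simp only [milsteinStep, e1, e2, Complex.real_smul]
  rw [mode_eq_cos_add_sin κ h, mode_eq_cos_add_sin κ (-h), mul_neg, Real.cos_neg, Real.sin_neg, hc]
  simp only [ampFactor, coefA, coefB, coefC]
  push_cast
  ring

lemma gridSolution_mode (μ ρ κ k h : ℝ) (Z : ℕ → ℝ) (n : ℕ) (j : ℤ) :
    gridSolution μ ρ k h Z (fun i : ℤ => mode κ (i * h)) n j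
      = (∏ i ∈ Finset.range n, ampFactor μ ρ κ k h (Z i)) * mode κ (j * h) := by
  induction n generalizing j with
  | zero => simp [gridSolution]
  | succ n ih =>
    have : gridSolution μ ρ k h Z (fun i : ℤ => mode κ (i * h)) n
        = fun j : ℤ => (∏ i ∈ Finset.range n, ampFactor μ ρ κ k h (Z i)) * mode κ (j * h) :=
      funext ih
    rw [gridSolution, this, milsteinStep_mode, Finset.prod_range_succ]

lemma exactExponent_add (μ ρ κ s t m m' : ℝ) :
    exactExponent μ ρ κ (s + t) (m + m') = exactExponent μ ρ κ s m + exactExponent μ ρ κ t m' := by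
  simp only [exactExponent]; push_cast; ring

lemma prod_exp_exactExponent (μ ρ κ k : ℝ) (Z : ℕ → ℝ) (n : ℕ) :
    ∏ i ∈ Finset.range n, Complex.exp (exactExponent μ ρ κ k (√k * Z i))
      = Complex.exp (exactExponent μ ρ κ (n * k) (√k * ∑ i ∈ Finset.range n, Z i)) := by
  induction n with
  | zero => simp [exactExponent]
  | succ n ih =>
    rw [Finset.prod_range_succ, ih, ← Complex.exp_add, ← exactExponent_add,
      Finset.sum_range_succ]
    push_cast
    ring_nf

lemma prod_exp_exactExponent_noise {Ω : Type*} [MeasurableSpace Ω] {P : Measure Ω}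
    {M : ℝ≥0 → Ω → ℝ} (hM : IsBrownianReal M P) {k : ℝ} (hk : 0 < k) (n : ℕ) :
    ∀ᵐ ω ∂P, ∀ μ ρ κ : ℝ,
      ∏ i ∈ Finset.range n, Complex.exp (exactExponent μ ρ κ k (√k * noise M k i ω))
        = Complex.exp (exactExponent μ ρ κ (n * k) (M ((n : ℝ) * k).toNNReal ω)) := by
  filter_upwards [hM.eval_zero_ae_eq_zero] with ω hω μ ρ κ
  rw [prod_exp_exactExponent, sqrt_mul_sum_noise M hk, hω, sub_zero]

/-- The exact mode solves the equation after the shift `x ↦ x + √ρ M_t`. -/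
lemma satisfiesPDE_exactMode (μ ρ κ : ℝ) (m : ℝ → ℝ) :
    SatisfiesPDE μ ρ (fun t x => exactMode μ ρ κ t (m t) (x + √ρ * m t)) := by
  intro t _ x
  set a : ℂ := -(((1 / 2) * (1 - ρ) * κ ^ 2 : ℝ) : ℂ) - Complex.I * ((κ * μ : ℝ) : ℂ) with ha
  have e : (fun t x : ℝ => exactMode μ ρ κ t (m t) (x + √ρ * m t))
      = fun t x : ℝ => Complex.exp (a * t + Complex.I * κ * x) := by
    funext t x
    rw [exactMode, mode, ← Complex.exp_add, exactExponent, ha]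
    push_cast; ring_nf
  rw [e]
  have hx : ∀ c : ℂ, deriv (fun x : ℝ => c * Complex.exp (a * t + Complex.I * κ * x))
      = fun x : ℝ => c * (Complex.I * κ) * Complex.exp (a * t + Complex.I * κ * x) := by
    intro c; funext x
    have h1 : HasDerivAt (fun x : ℝ => a * t + Complex.I * κ * (x : ℂ)) (Complex.I * κ) x := by
      simpa using ((Complex.ofRealCLM.hasDerivAt (x := x)).const_mul (Complex.I * κ)).const_add
        (a * t)
    rw [(h1.cexp.const_mul c).deriv]; ring
  have ht : deriv (fun s : ℝ => Complex.exp (a * s + Complex.I * κ * x)) t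
      = a * Complex.exp (a * t + Complex.I * κ * x) := by
    have h1 : HasDerivAt (fun s : ℝ => a * (s : ℂ) + Complex.I * κ * x) a t := by
      simpa using ((Complex.ofRealCLM.hasDerivAt (x := t)).const_mul a).add_const
        (Complex.I * κ * x)
    rw [h1.cexp.deriv]; ring
  have h1 := hx 1
  simp only [one_mul] at h1
  rw [ht, iteratedDeriv_succ, iteratedDeriv_one, h1, hx, Complex.real_smul, Complex.real_smul]
  beta_reduce
  generalize Complex.exp (a * t + Complex.I * κ * x) = X
  rw [ha]
  push_cast
  linear_combination ((1 / 2) * (1 - ρ) * κ ^ 2 * X) * (-Complex.I_sq)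

end Modes

/-! ### Accumulated mean square error of a mode -/

section ModeError

variable {Ω : Type*} [MeasurableSpace Ω] {P : Measure Ω}

/-- The constant in the error bound for a mode with fixed wave number. -/
noncomputable def modeErrorConst (μ κ T : ℝ) : ℝ :=
  √(Real.exp ((κ ^ 4 + (μ * κ) ^ 2 + κ ^ 2 + 1) * T) * (T * (consistencyConst
    * waveScale μ κ ^ 16)))

/-- At a fixed wave number no relation between k and h is required: the second moment grows by at
most 1+O(k) per step, hence by a constant over [0,T]. The final +1 in L pays for τ = k. -/
lemma lintegral_mode_error_sq_le {Z : ℕ → Ω → ℝ} (hZ : iIndepFun Z P)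
    (hlaw : ∀ i, HasLaw (Z i) (gaussianReal 0 1) P) {ρ : ℝ} (hρ0 : 0 ≤ ρ) (hρ1 : ρ ≤ 1)
    (μ κ : ℝ) {k h T : ℝ} (hk : 0 < k) (hk1 : k ≤ 1) (hh : 0 < h) (hh1 : h ≤ 1) (hT : 0 ≤ T)
    {n : ℕ} (hn : n * k ≤ T) :
    ∫⁻ ω, ‖∏ i ∈ Finset.range n, ampFactor μ ρ κ k h (Z i ω)
        - ∏ i ∈ Finset.range n, Complex.exp (exactExponent μ ρ κ k (√k * Z i ω))‖ₑ ^ 2 ∂P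
      ≤ ENNReal.ofReal (modeErrorConst μ κ T * (k + h ^ 2)) ^ 2 := by
  set L := κ ^ 4 + (μ * κ) ^ 2 + κ ^ 2 + 1 with hL
  have hL0 : 0 ≤ L := by positivity
  set G := Real.exp (L * k) with hGdef
  have hG1 : 1 ≤ G := Real.one_le_exp (by positivity)
  have hfG : (∫ z, ‖ampFactor μ ρ κ k h z‖ ^ 2 ∂(gaussianReal 0 1)) + k ≤ G := by
    have h1 := integral_norm_ampFactor_sq_le hρ0 hρ1 hk.le hk1 hh μ κ
    have h2 := Real.add_one_le_exp (L * k)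
    rw [hGdef]
    have : L * k = (κ ^ 4 + (μ * κ) ^ 2 + κ ^ 2) * k + k := by rw [hL]; ring
    linarith
  have hgG : Real.exp (-((1 - ρ) * κ ^ 2 * k)) ≤ G := by
    refine le_trans (Real.exp_le_one_iff.2 ?_) hG1
    have := sub_nonneg.2 hρ1
    have : 0 ≤ (1 - ρ) * κ ^ 2 * k := by positivity
    linarith
  refine (lintegral_prod_amp_sub_prod_exp_sq_le hZ hlaw hρ0 hρ1 μ κ hk hk1 hh hh1 (by positivity)
    hfG hgG n).trans ?_
  have hC := consistencyConst_nonneg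
  have hU := waveScale_pos μ κ
  rw [← ENNReal.ofReal_pow (by unfold modeErrorConst; positivity)]
  refine ENNReal.ofReal_le_ofReal ?_
  rw [mul_pow, modeErrorConst, Real.sq_sqrt (by positivity)]
  have h1 : G ^ n / G ≤ Real.exp (L * T) := by
    calc G ^ n / G ≤ G ^ n := div_le_self (by positivity) hG1
      _ = Real.exp (L * (n * k)) := by rw [hGdef, ← Real.exp_nat_mul]; ring_nf
      _ ≤ _ := Real.exp_le_exp.2 (mul_le_mul_of_nonneg_left hn hL0)
  calc G ^ n / G * (n * k * (consistencyConst * waveScale μ κ ^ 16 * (k + h ^ 2) ^ 2))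
      ≤ Real.exp (L * T) * (T * (consistencyConst * waveScale μ κ ^ 16 * (k + h ^ 2) ^ 2)) :=
        mul_le_mul h1 (mul_le_mul_of_nonneg_right hn (by positivity)) (by positivity)
          (by positivity)
    _ = _ := by ring

/-- Under the stability condition, the mean square error of the resolved modes decays in the
wave number. -/
lemma exists_mode_error_decay (μ : ℝ) {ρ : ℝ} (hρ0 : 0 ≤ ρ) (hρ1 : ρ < 1) {lam : ℝ}
    (hlam : (1 + 2 * ρ ^ 2) * lam < 1) {T₀ T : ℝ} (hT₀ : 0 < T₀) (hT : T₀ ≤ T) :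
    ∃ δ c C : ℝ, 0 < δ ∧ δ ≤ 1 ∧ 0 < c ∧ c ≤ 1 - ρ ∧ 0 ≤ C ∧
      ∀ {Ω : Type u} [MeasurableSpace Ω] {P : Measure Ω} {Z : ℕ → Ω → ℝ}, iIndepFun Z P →
        (∀ i, HasLaw (Z i) (gaussianReal 0 1) P) → ∀ k h : ℝ, 0 < k → 0 < h → h ≤ δ →
        k ≤ lam * h ^ 2 → ∀ n : ℕ, T₀ ≤ n * k → n * k ≤ T → ∀ κ : ℝ, |κ| * h ≤ Real.pi →
        ∫⁻ ω, ‖∏ i ∈ Finset.range n, ampFactor μ ρ κ k h (Z i ω)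
            - ∏ i ∈ Finset.range n, Complex.exp (exactExponent μ ρ κ k (√k * Z i ω))‖ₑ ^ 2 ∂P
          ≤ ENNReal.ofReal (C * (k + h ^ 2) ^ 2 * (waveScale μ κ ^ 16
              * Real.exp (-(c * T₀ * κ ^ 2)))) := by
  set η := min (1 - ρ) (1 - (1 + 2 * ρ ^ 2) * lam) with hη
  have hη0 : 0 < η := lt_min (by linarith) (by linarith)
  have hη1 : η ≤ 1 - ρ := min_le_left _ _
  have hη2 : η ≤ 1 - (1 + 2 * ρ ^ 2) * lam := min_le_right _ _
  set c := 2 * η / Real.pi ^ 2 with hc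
  have hc0 : 0 < c := by have := Real.pi_pos; positivity
  have hcη : c ≤ η := by
    rw [hc, div_le_iff₀ (by have := Real.pi_pos; positivity)]
    have : 2 ≤ Real.pi ^ 2 := by nlinarith [Real.pi_gt_three]
    nlinarith
  have hδ : 0 < η / (2 * (1 + μ ^ 2)) := by positivity
  -- Together with k ≤ h, the second entry ensures 2μ²k ≤ η, so the drift cannot spoil the damping.
  set δ := min 1 (η / (2 * (1 + μ ^ 2))) with hδdef
  have hδ0 : 0 < δ := lt_min one_pos hδ
  -- The additive k from τ has to be absorbed into a factor e^{Lk} beside the decaying exponential.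
  -- As cκ²k ≤ cπ² for resolved wave numbers, e^{-cκ²k}L ≥ 1.
  set L := Real.exp (c * Real.pi ^ 2) with hL
  refine ⟨δ, c, Real.exp (L * T) * L * (T * consistencyConst), hδ0, min_le_left _ _, hc0,
    hcη.trans hη1, by have := consistencyConst_nonneg; have := hT₀.le.trans hT; positivity, ?_⟩
  intro Ω _ P Z hZ hlaw k h hk hh hhδ hkh n hn0 hnT κ hκ
  have hh1 : h ≤ 1 := hhδ.trans (min_le_left _ _)
  have hlam1 : lam < 1 := by
    rcases le_or_gt lam 0 with h0 | h0
    · linarith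
    · nlinarith [sq_nonneg ρ]
  have hkh2 : k ≤ h ^ 2 := hkh.trans (mul_le_of_le_one_left (by positivity) hlam1.le)
  have hkh1 : k ≤ h := hkh2.trans (by nlinarith)
  have hk1 : k ≤ 1 := hkh1.trans hh1
  have hμk : 2 * (μ ^ 2 * k) ≤ η := by
    have h1 : k ≤ η / (2 * (1 + μ ^ 2)) := hkh1.trans (hhδ.trans (min_le_right _ _))
    rw [le_div_iff₀ (by positivity)] at h1
    nlinarith
  have hκk : c * κ ^ 2 * k ≤ c * Real.pi ^ 2 := by
    have h1 : κ ^ 2 * k ≤ Real.pi ^ 2 := by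
      calc κ ^ 2 * k ≤ κ ^ 2 * h ^ 2 := mul_le_mul_of_nonneg_left hkh2 (sq_nonneg κ)
        _ = (|κ| * h) ^ 2 := by rw [mul_pow, sq_abs]
        _ ≤ Real.pi ^ 2 := pow_le_pow_left₀ (by positivity) hκ 2
    rw [mul_assoc]
    exact mul_le_mul_of_nonneg_left h1 hc0.le
  set G := Real.exp (-(c * κ ^ 2 * k) + L * k) with hG
  have hfG : (∫ z, ‖ampFactor μ ρ κ k h z‖ ^ 2 ∂(gaussianReal 0 1)) + k ≤ G := by
    have h1 := integral_norm_ampFactor_sq_le_exp hρ0 hk hh hkh hη1 hη2 μ hμk hκ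
    rw [← hc] at h1
    have h2 := Real.add_one_le_exp (L * k)
    have h3 : 1 ≤ Real.exp (-(c * κ ^ 2 * k)) * L := by
      rw [hL, ← Real.exp_add]
      exact Real.one_le_exp (by linarith)
    have h4 : 0 < Real.exp (-(c * κ ^ 2 * k)) := Real.exp_pos _
    rw [hG, Real.exp_add]
    nlinarith
  have hgG : Real.exp (-((1 - ρ) * κ ^ 2 * k)) ≤ G := by
    refine Real.exp_le_exp.2 ?_
    have h1 : c * (κ ^ 2 * k) ≤ (1 - ρ) * (κ ^ 2 * k) :=
      mul_le_mul_of_nonneg_right (hcη.trans hη1) (by positivity)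
    have h2 : 0 ≤ L * k := by positivity
    linarith
  refine (lintegral_prod_amp_sub_prod_exp_sq_le hZ hlaw hρ0 hρ1.le μ κ hk hk1 hh hh1
    (Real.exp_pos _) hfG hgG n).trans (ENNReal.ofReal_le_ofReal ?_)
  have hC := consistencyConst_nonneg
  have hU := waveScale_pos μ κ
  have hT0 : 0 ≤ T := hT₀.le.trans hT
  -- Only n-1 growth factors are present; the missing decay e^{-cκ²k} costs at most one more factor
  -- L.
  have hGn : G ^ n / G ≤ Real.exp (L * T) * L * Real.exp (-(c * T₀ * κ ^ 2)) := by
    rw [hG, ← Real.exp_nat_mul, ← Real.exp_sub, hL, ← Real.exp_add, ← Real.exp_add, ← hL]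
    refine Real.exp_le_exp.2 ?_
    have h1 : L * (n * k) ≤ L * T := mul_le_mul_of_nonneg_left hnT (by positivity)
    have h2 : c * κ ^ 2 * T₀ ≤ c * κ ^ 2 * (n * k) :=
      mul_le_mul_of_nonneg_left hn0 (by positivity)
    have h3 : 0 ≤ L * k := by positivity
    linarith
  calc G ^ n / G * (n * k * (consistencyConst * waveScale μ κ ^ 16 * (k + h ^ 2) ^ 2))
      ≤ Real.exp (L * T) * L * Real.exp (-(c * T₀ * κ ^ 2))
          * (T * (consistencyConst * waveScale μ κ ^ 16 * (k + h ^ 2) ^ 2)) :=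
        mul_le_mul hGn (mul_le_mul_of_nonneg_right hnT (by positivity)) (by positivity)
          (by positivity)
    _ = _ := by ring

end ModeError

/-! ### The logarithmic error of one step -/

section StepError

lemma one_div_le_one_of_waveScale (μ κ : ℝ) : 1 / (8 * waveScale μ κ) ≤ 1 := by
  have := one_le_waveScale μ κ
  rw [div_le_one (by positivity)]
  linarith

lemma waveScale_mul_le {μ κ x : ℝ} (hx : x ≤ 1 / (8 * waveScale μ κ)) :
    waveScale μ κ * x ≤ 1 / 8 := by
  have := waveScale_pos μ κ
  rw [le_div_iff₀ (by positivity)] at hx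
  linarith

/-- For small `k` and `h` the amplification factor is bounded away from zero. -/
lemma quarter_le_norm_ampFactor {μ ρ κ k h : ℝ} (hρ0 : 0 ≤ ρ) (hρ1 : ρ ≤ 1) (hk : 0 < k)
    (hkδ : k ≤ 1 / (8 * waveScale μ κ)) (hh : 0 < h) (hhδ : h ≤ 1 / (8 * waveScale μ κ))
    (z : ℝ) : 1 / 4 ≤ ‖ampFactor μ ρ κ k h z‖ := by
  refine abs_le_of_sq_le_sq' (a := 1 / 4) ?_ (norm_nonneg _) |>.2
  rw [norm_ampFactor_sq]
  set q := 2 * k / h ^ 2 * Real.sin (κ * h / 2) ^ 2 with hq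
  have hUk := waveScale_mul_le hkδ
  have hUh := waveScale_mul_le hhδ
  have hq0 : 0 ≤ q := by positivity
  have hqk : q ≤ κ ^ 2 * k / 2 := by
    have h1 : Real.sin (κ * h / 2) ^ 2 ≤ (κ * h / 2) ^ 2 := sq_le_sq.2 Real.abs_sin_le_abs
    calc q ≤ 2 * k / h ^ 2 * (κ * h / 2) ^ 2 := mul_le_mul_of_nonneg_left h1 (by positivity)
      _ = κ ^ 2 * k / 2 := by field_simp
  have hκk : κ ^ 2 * k ≤ 1 / 8 :=
    (mul_le_mul_of_nonneg_right (sq_le_waveScale μ κ) hk.le).trans hUk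
  set w := κ * √(ρ * k) * z with hw
  have hw2 : w ^ 2 = κ ^ 2 * (ρ * k) * z ^ 2 := by
    rw [hw, mul_pow, mul_pow, Real.sq_sqrt (mul_nonneg hρ0 hk.le)]
  have hpos : 0 ≤ (1 - ρ) + ρ * z ^ 2 := by have := sub_nonneg.2 hρ1; positivity
  -- If the phase w is small, the real part is at least 1/2. Otherwise the imaginary part is large:
  -- |sin(κh)/h| ≥ 5/6|κ|, |w| ≥ 7/10 and |κμk| ≤ 1/8 give 5/6 · 23/40 = 23/48 > 1/4.
  rcases le_or_gt (w ^ 2) (1 / 2) with h1 | h1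
  · have h2 : ((1 - ρ) + ρ * z ^ 2) * q ≤ κ ^ 2 * k / 2 + w ^ 2 / 2 := by
      refine (mul_le_mul_of_nonneg_left hqk hpos).trans ?_
      rw [hw2]
      have : 0 ≤ ρ * (κ ^ 2 * k) := by positivity
      nlinarith
    have h3 : 1 / 2 ≤ 1 - ((1 - ρ) + ρ * z ^ 2) * q := by linarith
    nlinarith [sq_nonneg (μ * k / h * Real.sin (κ * h) + √(ρ * k) / h * Real.sin (κ * h) * z)]
  · have hsin : 5 / 6 * |κ| ≤ |Real.sin (κ * h) / h| := by
      have a1 := abs_sub_sin_div_le κ hh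
      have a2 : |κ| ^ 3 * h ^ 2 ≤ |κ| := by
        have b1 : |κ| * h ≤ 1 :=
          ((mul_le_mul_of_nonneg_right (abs_le_waveScale μ κ) hh.le).trans hUh).trans (by norm_num)
        have b2 : (|κ| * h) ^ 2 ≤ 1 := pow_le_one₀ (by positivity) b1
        calc |κ| ^ 3 * h ^ 2 = |κ| * (|κ| * h) ^ 2 := by ring
          _ ≤ |κ| * 1 := mul_le_mul_of_nonneg_left b2 (abs_nonneg κ)
          _ = |κ| := mul_one _
      have a3 := abs_sub_abs_le_abs_sub κ (Real.sin (κ * h) / h)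
      linarith
    have hm : |κ * μ * k| ≤ 1 / 8 := by
      rw [abs_mul, abs_mul, abs_of_pos hk]
      refine le_trans (mul_le_mul_of_nonneg_right ?_ hk.le) hUk
      have := abs_mul_le_waveScale μ κ
      nlinarith [abs_nonneg κ]
    have hwabs : 7 / 10 ≤ |w| := by
      refine abs_le_of_sq_le_sq' (a := 7 / 10) ?_ (abs_nonneg _) |>.2
      rw [sq_abs]; linarith
    have hmw : 23 / 40 ≤ |κ * μ * k + w| := by
      have := abs_sub_abs_le_abs_sub w (-(κ * μ * k))
      rw [abs_neg, sub_neg_eq_add, add_comm w] at this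
      linarith
    have e : (μ * k / h * Real.sin (κ * h) + √(ρ * k) / h * Real.sin (κ * h) * z) ^ 2
        = (|Real.sin (κ * h) / h| * |μ * k + √(ρ * k) * z|) ^ 2 := by
      rw [← abs_mul, sq_abs]; ring
    have h5 : 23 / 48 ≤ |Real.sin (κ * h) / h| * |μ * k + √(ρ * k) * z| := by
      have a1 := mul_le_mul_of_nonneg_right hsin (abs_nonneg (μ * k + √(ρ * k) * z))
      have a2 : |κ| * |μ * k + √(ρ * k) * z| = |κ * μ * k + w| := by
        rw [← abs_mul, hw]; ring_nf
      nlinarith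
    rw [e]
    nlinarith [sq_nonneg (1 - ((1 - ρ) + ρ * z ^ 2) * q)]

lemma ampFactor_eq_exp {μ ρ κ k h : ℝ} (hρ0 : 0 ≤ ρ) (hρ1 : ρ ≤ 1) (hk : 0 < k)
    (hkδ : k ≤ 1 / (8 * waveScale μ κ)) (hh : 0 < h) (hhδ : h ≤ 1 / (8 * waveScale μ κ))
    (z : ℝ) : ampFactor μ ρ κ k h z
      = Complex.exp (exactExponent μ ρ κ k (√k * z) + stepError μ ρ κ k h z) := by
  have h1 := quarter_le_norm_ampFactor hρ0 hρ1 hk hkδ hh hhδ z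
  have h2 : ampFactor μ ρ κ k h z ≠ 0 := norm_pos_iff.1 (by linarith)
  rw [Complex.exp_add, stepError, Complex.exp_log (mul_ne_zero h2 (Complex.exp_ne_zero _)),
    mul_left_comm, ← Complex.exp_add, add_neg_cancel, Complex.exp_zero, mul_one]

lemma norm_exp_neg_exactExponent_le_two {μ ρ κ k : ℝ} (hρ0 : 0 ≤ ρ) (hk : 0 < k)
    (hkδ : k ≤ 1 / (8 * waveScale μ κ)) (m : ℝ) :
    ‖Complex.exp (-exactExponent μ ρ κ k m)‖ ≤ 2 := by
  rw [Complex.norm_exp, Complex.neg_re, exactExponent_re, neg_neg]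
  have hκk : κ ^ 2 * k ≤ 1 / 8 :=
    (mul_le_mul_of_nonneg_right (sq_le_waveScale μ κ) hk.le).trans (waveScale_mul_le hkδ)
  have h0 : 0 ≤ κ ^ 2 * k := by positivity
  have h1 : (1 / 2) * (1 - ρ) * κ ^ 2 * k ≤ 1 / 2 := by nlinarith
  calc Real.exp ((1 / 2) * (1 - ρ) * κ ^ 2 * k) ≤ Real.exp (1 / 2) := Real.exp_le_exp.2 h1
    _ ≤ 2 := by
      refine abs_le_of_sq_le_sq' (b := 2) ?_ (by norm_num) |>.2
      rw [← Real.exp_nat_mul]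
      norm_num
      linarith [Real.exp_one_lt_d9]

/-- A bound without smallness in k or h, for the noise values at which the logarithm cannot be
expanded. The argument is at most π, and log|y| is controlled because |y| ≥ 1/4. -/
lemma norm_stepError_le {μ ρ κ k h : ℝ} (hρ0 : 0 ≤ ρ) (hρ1 : ρ ≤ 1) (hk : 0 < k)
    (hkδ : k ≤ 1 / (8 * waveScale μ κ)) (hh : 0 < h) (hhδ : h ≤ 1 / (8 * waveScale μ κ))
    (z : ℝ) : ‖stepError μ ρ κ k h z‖ ≤ 830 * waveScale μ κ ^ 4 * noiseScale z ^ 4 := by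
  have hk1 := hkδ.trans (one_div_le_one_of_waveScale μ κ)
  have hh1 := hhδ.trans (one_div_le_one_of_waveScale μ κ)
  have hlow := quarter_le_norm_ampFactor hρ0 hρ1 hk hkδ hh hhδ z
  have hup := norm_amp_sub_one_le hρ0 hρ1 μ κ z hk hk1 hh hh1
  set y := ampFactor μ ρ κ k h z * Complex.exp (-exactExponent μ ρ κ k (√k * z)) with hy
  set W := waveScale μ κ ^ 4 * noiseScale z ^ 4 with hW
  have hW1 : 1 ≤ W := one_le_mul_of_one_le_of_one_le (one_le_pow₀ (one_le_waveScale μ κ))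
    (one_le_pow₀ (one_le_noiseScale z))
  have hexp2 := norm_exp_neg_exactExponent_le_two (μ := μ) hρ0 hk hkδ (√k * z)
  have hexp1 : 1 ≤ ‖Complex.exp (-exactExponent μ ρ κ k (√k * z))‖ := by
    rw [Complex.norm_exp, Complex.neg_re, exactExponent_re, neg_neg]
    have := sub_nonneg.2 hρ1
    exact Real.one_le_exp (by positivity)
  have hamp : ‖ampFactor μ ρ κ k h z‖ ≤ 413 * W := by
    have h1 := norm_add_le (ampFactor μ ρ κ k h z - 1) 1
    rw [sub_add_cancel, norm_one] at h1
    have h2 : 412 * waveScale μ κ ^ 4 * noiseScale z ^ 4 * √k ≤ 412 * W := by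
      rw [mul_assoc 412, ← hW]
      exact mul_le_of_le_one_right (by positivity) (Real.sqrt_le_one.2 hk1)
    linarith
  have hy1 : ‖y‖ ≤ 826 * W := by
    rw [hy, norm_mul]
    calc _ ≤ 413 * W * 2 := mul_le_mul hamp hexp2 (norm_nonneg _) (by positivity)
      _ = _ := by ring
  have hy2 : 1 / 4 ≤ ‖y‖ := by
    rw [hy, norm_mul]; nlinarith [norm_nonneg (ampFactor μ ρ κ k h z)]
  have hy0 : 0 < ‖y‖ := by linarith
  have hlog : |Real.log ‖y‖| ≤ 826 * W := by
    rw [abs_le]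
    constructor
    · have h1 := Real.one_sub_inv_le_log_of_pos hy0
      have h2 : ‖y‖⁻¹ ≤ 4 := by
        rw [inv_le_comm₀ hy0 (by norm_num)]; linarith
      linarith
    · exact (Real.log_le_self hy0.le).trans hy1
  have h1 := Complex.norm_le_abs_re_add_abs_im (Complex.log y)
  rw [Complex.log_re, Complex.log_im] at h1
  have h2 := Complex.abs_arg_le_pi y
  have h3 := Real.pi_le_four
  rw [stepError, ← hy, mul_assoc, ← hW]
  linarith

/-- The error of one time step is its odd part up to `O(k (k + h²))`. -/
lemma norm_stepError_sub_odd_le {μ ρ κ k h : ℝ} (hρ0 : 0 ≤ ρ) (hρ1 : ρ ≤ 1) (hk : 0 < k)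
    (hkδ : k ≤ 1 / (8 * waveScale μ κ)) (hh : 0 < h) (hhδ : h ≤ 1 / (8 * waveScale μ κ))
    (z : ℝ) :
    ‖stepError μ ρ κ k h z - (linCoef μ ρ κ k h * z + cubCoef ρ κ k * (z : ℂ) ^ 3)‖
      ≤ 1200000000 * waveScale μ κ ^ 12 * noiseScale z ^ 12 * (k * (k + h ^ 2)) := by
  have hk1 := hkδ.trans (one_div_le_one_of_waveScale μ κ)
  have hh1 := hhδ.trans (one_div_le_one_of_waveScale μ κ)
  have hae := norm_amp_sub_exp_le hρ0 hρ1 μ κ z hk hk1 hh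
  have ha1 := norm_amp_sub_one_le hρ0 hρ1 μ κ z hk hk1 hh hh1
  have hR := norm_oneStepRest_le hρ0 hρ1 μ κ z hk hk1 hh
  have hodd := norm_odd_le hρ0 hρ1 μ κ z hk.le hh
  have hexp2 := norm_exp_neg_exactExponent_le_two (μ := μ) hρ0 hk hkδ (√k * z)
  have hlog := norm_stepError_le hρ0 hρ1 hk hkδ hh hhδ z
  set E := exactExponent μ ρ κ k (√k * z) with hE
  set O := linCoef μ ρ κ k h * z + cubCoef ρ κ k * (z : ℂ) ^ 3 with hO
  set a := ampFactor μ ρ κ k h z with ha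
  set U := waveScale μ κ
  set Y := noiseScale z
  set ε := k + h ^ 2 with hε
  have hU1 : 1 ≤ U := one_le_waveScale μ κ
  have hY1 : 1 ≤ Y := one_le_noiseScale z
  have hε0 : 0 < ε := by positivity
  have hε2 : ε ≤ 2 := by nlinarith
  have hss : √k * √k = k := Real.mul_self_sqrt hk.le
  have hs1 : √k ≤ 1 := Real.sqrt_le_one.2 hk1
  have hs0 : 0 ≤ √k := Real.sqrt_nonneg _
  set x := (a - Complex.exp E) * Complex.exp (-E) with hx
  have hEE : Complex.exp E * Complex.exp (-E) = 1 := by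
    rw [← Complex.exp_add, add_neg_cancel, Complex.exp_zero]
  have hy : a * Complex.exp (-E) = 1 + x := by rw [hx, sub_mul, hEE]; ring
  have hstep : stepError μ ρ κ k h z = Complex.log (1 + x) := by
    rw [stepError, ← hE, ← ha, hy]
  have hxn : ‖x‖ ≤ 406 * U ^ 4 * Y ^ 4 * (√k * ε) := by
    rw [hx, norm_mul]
    calc _ ≤ 203 * U ^ 4 * Y ^ 4 * (√k * ε) * 2 :=
          mul_le_mul hae hexp2 (norm_nonneg _) (by positivity)
      _ = _ := by ring
  have hx2 : ‖x‖ ^ 2 ≤ 329672 * U ^ 8 * Y ^ 8 * (k * ε) := by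
    refine (pow_le_pow_left₀ (norm_nonneg _) hxn 2).trans ?_
    have e : (406 * U ^ 4 * Y ^ 4 * (√k * ε)) ^ 2
        = 164836 * U ^ 8 * Y ^ 8 * ((√k * √k) * ε) * ε := by ring
    rw [e, hss]
    have := mul_le_mul_of_nonneg_left hε2 (by positivity : 0 ≤ 164836 * U ^ 8 * Y ^ 8 * (k * ε))
    linarith
  have hpow : ∀ {i j : ℕ}, i ≤ 12 → j ≤ 12 → U ^ i * Y ^ j * (k * ε) ≤ U ^ 12 * Y ^ 12 * (k * ε) :=
    fun hi hj => mul_le_mul_of_nonneg_right (mul_le_mul (pow_le_pow_right₀ hU1 hi)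
      (pow_le_pow_right₀ hY1 hj) (by positivity) (by positivity)) (by positivity)
  have p88 := hpow (show 8 ≤ 12 by norm_num) (show 8 ≤ 12 by norm_num)
  have p66 := hpow (show 6 ≤ 12 by norm_num) (show 6 ≤ 12 by norm_num)
  have p44 := hpow (show 4 ≤ 12 by norm_num) (show 4 ≤ 12 by norm_num)
  have p0 : 0 ≤ U ^ 12 * Y ^ 12 * (k * ε) := by positivity
  rw [hstep]
  -- In the second case `hx2` forces 1 ≤ 4 · 329672 U⁸Y⁸kε, so the crude bound of order U⁴Y⁴ may be
  -- multiplied by this quantity; hence the powers 12.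
  rcases le_or_gt ‖x‖ (1 / 2) with hxs | hxl
  · have hl := Complex.norm_log_one_add_sub_self_le (z := x) (by linarith)
    have hinv : (1 - ‖x‖)⁻¹ ≤ 2 := by
      rw [inv_le_comm₀ (by linarith) (by norm_num)]; linarith
    have hl2 : ‖Complex.log (1 + x) - x‖ ≤ ‖x‖ ^ 2 := by
      have := mul_le_mul_of_nonneg_left hinv (sq_nonneg ‖x‖)
      linarith
    -- Replacing x by O costs O(e^{-E}-1) plus the rest: e^{-E}-1 contributes the second √k.
    have hxO : x - O = O * (Complex.exp (-E) * (1 - Complex.exp E))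
        + oneStepRest μ ρ κ k h z * Complex.exp (-E) := by
      rw [oneStepRest, ← hE, ← ha, ← hO, hx]
      linear_combination O * hEE
    have hE1 : ‖1 - Complex.exp E‖ ≤ 818 * U ^ 4 * Y ^ 4 * √k := by
      have e : 1 - Complex.exp E = (a - Complex.exp E) - (a - 1) := by ring
      rw [e]
      refine (norm_sub_le _ _).trans ?_
      have : √k * ε ≤ √k * 2 := mul_le_mul_of_nonneg_left hε2 hs0
      have := mul_le_mul_of_nonneg_left this (by positivity : 0 ≤ 203 * U ^ 4 * Y ^ 4)
      linarith
    have t1 : ‖O * (Complex.exp (-E) * (1 - Complex.exp E))‖ ≤ 4908 * (U ^ 6 * Y ^ 6 * (k * ε)) := by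
      rw [norm_mul, norm_mul]
      calc _ ≤ 3 * U ^ 2 * Y ^ 2 * (√k * ε) * (2 * (818 * U ^ 4 * Y ^ 4 * √k)) :=
            mul_le_mul hodd (mul_le_mul hexp2 hE1 (norm_nonneg _) (by norm_num)) (by positivity)
              (by positivity)
        _ = 4908 * (U ^ 6 * Y ^ 6 * ((√k * √k) * ε)) := by ring
        _ = _ := by rw [hss]
    have t2 : ‖oneStepRest μ ρ κ k h z * Complex.exp (-E)‖ ≤ 400 * (U ^ 4 * Y ^ 4 * (k * ε)) := by
      rw [norm_mul]
      calc _ ≤ 200 * U ^ 4 * Y ^ 4 * (k * ε) * 2 :=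
            mul_le_mul hR hexp2 (norm_nonneg _) (by positivity)
        _ = _ := by ring
    have t3 := norm_add_le (O * (Complex.exp (-E) * (1 - Complex.exp E)))
      (oneStepRest μ ρ κ k h z * Complex.exp (-E))
    rw [← hxO] at t3
    have t4 := norm_add_le (Complex.log (1 + x) - x) (x - O)
    rw [sub_add_sub_cancel] at t4
    linarith
  · have h4 : 1 ≤ 4 * ‖x‖ ^ 2 := by nlinarith
    have h5 : 1 ≤ 1318688 * U ^ 8 * Y ^ 8 * (k * ε) := by linarith
    have hO2 : ‖O‖ ≤ 6 * (U ^ 4 * Y ^ 4) := by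
      have c1 : U ^ 2 * Y ^ 2 ≤ U ^ 4 * Y ^ 4 :=
        mul_le_mul (pow_le_pow_right₀ hU1 (by norm_num)) (pow_le_pow_right₀ hY1 (by norm_num))
          (by positivity) (by positivity)
      have c2 : √k * ε ≤ 2 := by nlinarith
      calc ‖O‖ ≤ 3 * U ^ 2 * Y ^ 2 * (√k * ε) := hodd
        _ ≤ 3 * U ^ 2 * Y ^ 2 * 2 := mul_le_mul_of_nonneg_left c2 (by positivity)
        _ ≤ _ := by linarith
    have h6 := norm_sub_le (Complex.log (1 + x)) O
    rw [← hstep] at h6 ⊢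
    have h7 : ‖stepError μ ρ κ k h z - O‖ ≤ 836 * (U ^ 4 * Y ^ 4) := by linarith
    calc _ ≤ 836 * (U ^ 4 * Y ^ 4) * 1 := by linarith
      _ ≤ 836 * (U ^ 4 * Y ^ 4) * (1318688 * U ^ 8 * Y ^ 8 * (k * ε)) :=
        mul_le_mul_of_nonneg_left h5 (by positivity)
      _ = 1102423168 * (U ^ 12 * Y ^ 12 * (k * ε)) := by ring
      _ ≤ _ := by linarith

end StepError

/-! ### The leading error, its remainder, and sums of one-step errors -/

section Remainder

lemma abs_sin_sub_cubic_le {x : ℝ} (hx : |x| ≤ 1) : |x - Real.sin x - x ^ 3 / 6| ≤ |x| ^ 5 := by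
  have h := Complex.exp_bound (x := x * Complex.I) (by simpa using hx) (n := 5) (by norm_num)
  have him := (Complex.abs_im_le_norm _).trans h
  have e : (Complex.exp (x * Complex.I)
      - ∑ m ∈ Finset.range 5, (x * Complex.I) ^ m / (m.factorial : ℂ)).im
      = -(x - Real.sin x - x ^ 3 / 6) := by
    have h3 : (x * Complex.I) ^ 3 = ((-x ^ 3 : ℝ) : ℂ) * Complex.I := by
      rw [mul_pow, Complex.I_pow_three]; push_cast; ring
    have h2 : (x * Complex.I) ^ 2 = ((-x ^ 2 : ℝ) : ℂ) := by
      rw [mul_pow, Complex.I_sq]; push_cast; ring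
    have h4 : (x * Complex.I) ^ 4 = ((x ^ 4 : ℝ) : ℂ) := by
      rw [mul_pow, Complex.I_pow_four]; push_cast; ring
    have hs : ∑ m ∈ Finset.range 5, (x * Complex.I) ^ m / (m.factorial : ℂ)
        = ((1 - x ^ 2 / 2 + x ^ 4 / 24 : ℝ) : ℂ) + ((x - x ^ 3 / 6 : ℝ) : ℂ) * Complex.I := by
      simp only [Finset.sum_range_succ, Finset.sum_range_zero, h2, h3, h4, Nat.factorial]
      push_cast; ring
    rw [hs, Complex.exp_mul_I, ← Complex.ofReal_cos, ← Complex.ofReal_sin]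
    simp only [Complex.sub_im, Complex.add_im, Complex.ofReal_im, Complex.im_ofReal_mul,
      Complex.I_im]
    ring
  rw [e, abs_neg] at him
  refine him.trans ?_
  rw [norm_mul, Complex.norm_I, mul_one, Complex.norm_real, Real.norm_eq_abs]
  refine mul_le_of_le_one_right (by positivity) ?_
  norm_num [Nat.factorial]

/-- The leading error is the odd part with sin(κh) replaced by its cubic Taylor polynomial, so only
the fifth-order sine remainder separates them. -/
lemma odd_sub_leadingError {ρ : ℝ} (hρ0 : 0 ≤ ρ) (μ κ h z : ℝ) {k : ℝ} (hk : 0 ≤ k) :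
    linCoef μ ρ κ k h * z + cubCoef ρ κ k * (z : ℂ) ^ 3 - leadingError μ ρ κ k h z
      = Complex.I * ((√(ρ * k) * z * (κ - Real.sin (κ * h) / h - κ ^ 3 * h ^ 2 / 6) : ℝ) : ℂ) := by
  have hs : ((√(ρ * k) : ℝ) : ℂ) ^ 3 = (√(ρ * k) : ℝ) * (ρ * k) := by
    have : √(ρ * k) ^ 3 = √(ρ * k) * (ρ * k) := by
      rw [pow_succ', Real.sq_sqrt (mul_nonneg hρ0 hk)]
    exact_mod_cast this
  simp only [linCoef, cubCoef, leadingError, drift]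
  push_cast
  rw [mul_pow, hs]
  linear_combination (-(√(ρ * k) : ℝ) * κ ^ 2 * μ * k * z : ℂ) * Complex.I_sq

lemma norm_remainder_le {μ ρ κ k h Λ : ℝ} (hρ0 : 0 ≤ ρ) (hρ1 : ρ ≤ 1) (hk : 0 < k)
    (hkδ : k ≤ 1 / (8 * waveScale μ κ)) (hh : 0 < h) (hhδ : h ≤ 1 / (8 * waveScale μ κ))
    (hΛ : ρ * h ^ 4 ≤ Λ * k) (z : ℝ) :
    ‖remainder μ ρ κ k h z‖ ≤ (1200000000 * waveScale μ κ ^ 12 + waveScale μ κ ^ 3 * √Λ)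
      * (k ^ 2 + k * h ^ 2) * noiseScale z ^ 12 := by
  have h1 := norm_stepError_sub_odd_le hρ0 hρ1 hk hkδ hh hhδ z
  set O := linCoef μ ρ κ k h * z + cubCoef ρ κ k * (z : ℂ) ^ 3 with hO
  have e : remainder μ ρ κ k h z
      = (stepError μ ρ κ k h z - O) + (O - leadingError μ ρ κ k h z) := by
    rw [remainder]; ring
  have hU1 := one_le_waveScale μ κ
  have hY1 := one_le_noiseScale z
  have hκh : |κ * h| ≤ 1 := by
    rw [abs_mul, abs_of_pos hh]
    exact ((mul_le_mul_of_nonneg_right (abs_le_waveScale μ κ) hh.le).trans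
      (waveScale_mul_le hhδ)).trans (by norm_num)
  have hsin : |κ - Real.sin (κ * h) / h - κ ^ 3 * h ^ 2 / 6| ≤ waveScale μ κ ^ 3 * h ^ 4 := by
    have a1 := abs_sin_sub_cubic_le hκh
    have a2 : κ - Real.sin (κ * h) / h - κ ^ 3 * h ^ 2 / 6
        = (κ * h - Real.sin (κ * h) - (κ * h) ^ 3 / 6) / h := by field_simp
    rw [a2, abs_div, abs_of_pos hh, div_le_iff₀ hh]
    refine a1.trans ?_
    rw [abs_mul, abs_of_pos hh, mul_pow]
    have a3 : |κ| ^ 5 ≤ waveScale μ κ ^ 3 := by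
      have b1 : (|κ| ^ 2) ^ 2 ≤ waveScale μ κ ^ 2 :=
        pow_le_pow_left₀ (by positivity) (by rw [sq_abs]; exact sq_le_waveScale μ κ) 2
      calc |κ| ^ 5 = |κ| * (|κ| ^ 2) ^ 2 := by ring
        _ ≤ waveScale μ κ * waveScale μ κ ^ 2 :=
          mul_le_mul (abs_le_waveScale μ κ) b1 (by positivity) (by positivity)
        _ = _ := by ring
    calc |κ| ^ 5 * h ^ 5 ≤ waveScale μ κ ^ 3 * h ^ 5 :=
          mul_le_mul_of_nonneg_right a3 (by positivity)
      _ = _ := by ring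
  -- The condition ρh⁴ ≤ Λk enters here: the sine remainder leaves √(ρk)h⁴, which must be O(kh²).
  have hΛs : √(ρ * k) * h ^ 2 ≤ √Λ * k := by
    have c1 : √(ρ * k) * h ^ 2 = √(ρ * h ^ 4) * √k := by
      rw [Real.sqrt_mul hρ0, Real.sqrt_mul hρ0, show h ^ 4 = (h ^ 2) ^ 2 by ring,
        Real.sqrt_sq (by positivity)]
      ring
    have c2 : √(Λ * k) * √k = √Λ * k := by
      rw [Real.sqrt_mul' _ hk.le, mul_assoc, Real.mul_self_sqrt hk.le]
    rw [c1, ← c2]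
    exact mul_le_mul_of_nonneg_right (Real.sqrt_le_sqrt hΛ) (Real.sqrt_nonneg _)
  have h2 : ‖O - leadingError μ ρ κ k h z‖
      ≤ waveScale μ κ ^ 3 * √Λ * (k ^ 2 + k * h ^ 2) * noiseScale z ^ 12 := by
    rw [hO, odd_sub_leadingError hρ0 μ κ h z hk.le, norm_mul, Complex.norm_I, one_mul,
      Complex.norm_real, Real.norm_eq_abs, abs_mul, abs_mul, abs_of_nonneg (Real.sqrt_nonneg _)]
    have hz : |z| ≤ noiseScale z ^ 12 :=
      (abs_le_noiseScale z).trans (le_self_pow₀ hY1 (by norm_num))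
    calc _ ≤ √(ρ * k) * noiseScale z ^ 12 * (waveScale μ κ ^ 3 * h ^ 4) :=
          mul_le_mul (mul_le_mul_of_nonneg_left hz (Real.sqrt_nonneg _)) hsin (abs_nonneg _)
            (by positivity)
      _ = waveScale μ κ ^ 3 * noiseScale z ^ 12 * h ^ 2 * (√(ρ * k) * h ^ 2) := by ring
      _ ≤ waveScale μ κ ^ 3 * noiseScale z ^ 12 * h ^ 2 * (√Λ * k) :=
          mul_le_mul_of_nonneg_left hΛs (by positivity)
      _ = waveScale μ κ ^ 3 * √Λ * (0 + k * h ^ 2) * noiseScale z ^ 12 := by ring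
      _ ≤ _ := by gcongr; positivity
  rw [e]
  refine (norm_add_le _ _).trans ?_
  have : 1200000000 * waveScale μ κ ^ 12 * noiseScale z ^ 12 * (k * (k + h ^ 2))
      = 1200000000 * waveScale μ κ ^ 12 * (k ^ 2 + k * h ^ 2) * noiseScale z ^ 12 := by ring
  rw [this] at h1
  linarith

variable {Ω : Type*} [MeasurableSpace Ω] {P : Measure Ω}

lemma lintegral_noiseScale_pow {Z : Ω → ℝ} (hZ : HasLaw Z (gaussianReal 0 1) P) (n : ℕ) :
    ∫⁻ ω, ENNReal.ofReal (noiseScale (Z ω) ^ n) ∂P = ENNReal.ofReal (noiseMoment n) := by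
  have hc := continuous_noiseScale
  rw [hZ.lintegral_comp (f := fun z => ENNReal.ofReal (noiseScale z ^ n))
      (Measurable.aemeasurable (by fun_prop)), noiseMoment,
    ofReal_integral_eq_lintegral_ofReal (integrable_noiseScale_pow n)
      (ae_of_all _ fun z => pow_nonneg (zero_le_one.trans (one_le_noiseScale z)) n)]

/-- Moments of the remainder of the one-step error. -/
lemma lintegral_remainder_rpow_le {μ ρ κ k h Λ p : ℝ} (hρ0 : 0 ≤ ρ) (hρ1 : ρ ≤ 1) (hk : 0 < k)
    (hkδ : k ≤ 1 / (8 * waveScale μ κ)) (hh : 0 < h) (hhδ : h ≤ 1 / (8 * waveScale μ κ))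
    (hΛ : ρ * h ^ 4 ≤ Λ * k) (hp : 0 ≤ p) {Z : Ω → ℝ} (hZ : HasLaw Z (gaussianReal 0 1) P) :
    ∫⁻ ω, ‖remainder μ ρ κ k h (Z ω)‖ₑ ^ p ∂P
      ≤ ENNReal.ofReal (((1200000000 * waveScale μ κ ^ 12 + waveScale μ κ ^ 3 * √Λ) ^ p
          * noiseMoment (12 * ⌈p⌉₊)) * (k ^ 2 + k * h ^ 2) ^ p) := by
  set K := 1200000000 * waveScale μ κ ^ 12 + waveScale μ κ ^ 3 * √Λ with hK
  have hU := waveScale_pos μ κ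
  have hK0 : 0 ≤ K := by positivity
  have hpt : ∀ ω, ‖remainder μ ρ κ k h (Z ω)‖ₑ ^ p
      ≤ ENNReal.ofReal (K ^ p * (k ^ 2 + k * h ^ 2) ^ p)
        * ENNReal.ofReal (noiseScale (Z ω) ^ (12 * ⌈p⌉₊)) := fun ω => by
    have hY1 := one_le_noiseScale (Z ω)
    rw [← ofReal_norm, ENNReal.ofReal_rpow_of_nonneg (norm_nonneg _) hp,
      ← ENNReal.ofReal_mul (by positivity)]
    refine ENNReal.ofReal_le_ofReal ?_
    refine (Real.rpow_le_rpow (norm_nonneg _)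
      (norm_remainder_le hρ0 hρ1 hk hkδ hh hhδ hΛ (Z ω)) hp).trans ?_
    rw [← hK, Real.mul_rpow (by positivity) (by positivity), Real.mul_rpow hK0 (by positivity)]
    refine mul_le_mul_of_nonneg_left ?_ (by positivity)
    -- Since the noise scale is at least 1, a real exponent p may be raised to its ceiling, leaving
    -- an integer Gaussian moment.
    rw [pow_mul, ← Real.rpow_natCast (noiseScale (Z ω) ^ 12)]
    exact Real.rpow_le_rpow_of_exponent_le (one_le_pow₀ hY1) (Nat.le_ceil p)
  refine (lintegral_mono hpt).trans_eq ?_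
  rw [lintegral_const_mul' _ _ ENNReal.ofReal_ne_top, lintegral_noiseScale_pow hZ,
    ← ENNReal.ofReal_mul (by positivity)]
  ring_nf

lemma lintegral_sum_sq {Z : ℕ → Ω → ℝ} (hZ : iIndepFun Z P) {π : Measure ℝ}
    (hlaw : ∀ i, HasLaw (Z i) π P) [IsProbabilityMeasure π] {f : ℝ → ℝ} (hf : Measurable f)
    (hf2 : MemLp f 2 π) (hf0 : ∫ z, f z ∂π = 0) (n : ℕ) :
    ∫⁻ ω, ENNReal.ofReal ((∑ i ∈ Finset.range n, f (Z i ω)) ^ 2) ∂P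
      = ENNReal.ofReal (n * ∫ z, f z ^ 2 ∂π) := by
  have hP : IsProbabilityMeasure P := (hlaw 0).isProbabilityMeasure
  have hm : ∀ i, MemLp (fun ω => f (Z i ω)) 2 P := fun i =>
    MemLp.comp_of_map (by rw [(hlaw i).map_eq]; exact hf2) (hlaw i).aemeasurable
  have hmean : ∀ i, ∫ ω, f (Z i ω) ∂P = 0 := fun i => by
    rw [← hf0, ← (hlaw i).integral_comp hf.aestronglyMeasurable]; rfl
  have hsq : ∀ i, ∫ ω, f (Z i ω) ^ 2 ∂P = ∫ z, f z ^ 2 ∂π := fun i => by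
    rw [← (hlaw i).integral_comp (f := fun z => f z ^ 2)
      (hf.pow_const 2).aestronglyMeasurable]; rfl
  have hind : iIndepFun (fun i ω => f (Z i ω)) P := hZ.comp (fun _ => f) (fun _ => hf)
  have hvar := IndepFun.variance_sum (s := Finset.range n) (fun i _ => hm i)
    (fun i _ j _ hij => hind.indepFun hij)
  have hS : MemLp (fun ω => ∑ i ∈ Finset.range n, f (Z i ω)) 2 P :=
    memLp_finsetSum _ fun i _ => hm i
  have hS0 : ∫ ω, ∑ i ∈ Finset.range n, f (Z i ω) ∂P = 0 := by
    rw [integral_finsetSum _ fun i _ => (hm i).integrable one_le_two]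
    simp [hmean]
  rw [← ofReal_integral_eq_lintegral_ofReal hS.integrable_sq (ae_of_all _ fun _ => sq_nonneg _)]
  congr 1
  have e1 : (∑ i ∈ Finset.range n, fun ω => f (Z i ω)) = fun ω => ∑ i ∈ Finset.range n, f (Z i ω) :=
    funext fun ω => Finset.sum_apply _ _ _
  rw [e1, variance_of_integral_eq_zero hS.aemeasurable hS0] at hvar
  rw [hvar]
  have : ∀ i ∈ Finset.range n, Var[fun ω => f (Z i ω); P] = ∫ z, f z ^ 2 ∂π := fun i _ => by
    rw [variance_of_integral_eq_zero (hm i).aemeasurable (hmean i), hsq]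
  rw [Finset.sum_congr rfl this]
  simp

/-- The constant in the bound for the accumulated one-step errors. -/
noncomputable def errorSumConst (μ κ T : ℝ) : ℝ :=
  √(3 * (4 * waveScale μ κ ^ 4 * T + waveScale μ κ ^ 4 * T * noiseMoment 3
    + (1200000000 * waveScale μ κ ^ 12) ^ 2 * T ^ 2 * noiseMoment 24))

/-- The odd parts sum to c₁ΣZ + c₃ΣZ³, sums of centred independent variables, so variances add and
contribute nk(k+h²)². The rests need no cancellation: they are small enough for the triangle
inequality, contributing (nk)²(k+h²)². -/
lemma lintegral_sum_stepError_sq_le {Z : ℕ → Ω → ℝ} (hZ : iIndepFun Z P)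
    (hlaw : ∀ i, HasLaw (Z i) (gaussianReal 0 1) P) {μ ρ κ k h T : ℝ} (hρ0 : 0 ≤ ρ)
    (hρ1 : ρ ≤ 1) (hk : 0 < k) (hkδ : k ≤ 1 / (8 * waveScale μ κ)) (hh : 0 < h)
    (hhδ : h ≤ 1 / (8 * waveScale μ κ)) (hT : 0 ≤ T) {n : ℕ} (hn : n * k ≤ T) :
    ∫⁻ ω, ‖∑ i ∈ Finset.range n, stepError μ ρ κ k h (Z i ω)‖ₑ ^ 2 ∂P
      ≤ ENNReal.ofReal (errorSumConst μ κ T * (k + h ^ 2)) ^ 2 := by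
  have hU := waveScale_pos μ κ
  set U := waveScale μ κ with hUdef
  set ε := k + h ^ 2 with hε
  have hε0 : 0 < ε := by positivity
  have hm3 := noiseMoment_nonneg 3
  have hm24 := noiseMoment_nonneg 24
  set K := 1200000000 * U ^ 12 with hK
  have hK0 : 0 ≤ K := by positivity
  have hc1 := norm_linCoef_le hρ0 hρ1 μ κ hk.le hh
  have hc3 := norm_cubCoef_le hρ0 hρ1 μ κ hk.le h
  set c1 := linCoef μ ρ κ k h
  set c3 := cubCoef ρ κ k
  have hc1s : ‖c1‖ ^ 2 ≤ 4 * U ^ 4 * (k * ε ^ 2) := by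
    refine (pow_le_pow_left₀ (norm_nonneg _) hc1 2).trans_eq ?_
    rw [mul_pow, sq_sqrt_mul hk.le]; ring
  have hc3s : ‖c3‖ ^ 2 ≤ U ^ 4 * (k * ε ^ 2) := by
    refine (pow_le_pow_left₀ (norm_nonneg _) hc3 2).trans_eq ?_
    rw [mul_pow, sq_sqrt_mul hk.le]; ring
  set S1 : Ω → ℝ := fun ω => ∑ i ∈ Finset.range n, Z i ω with hS1
  set S3 : Ω → ℝ := fun ω => ∑ i ∈ Finset.range n, Z i ω ^ 3 with hS3
  have hpt : ∀ ω, ‖∑ i ∈ Finset.range n, stepError μ ρ κ k h (Z i ω)‖ₑ ^ 2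
      ≤ ENNReal.ofReal (3 * ‖c1‖ ^ 2) * ENNReal.ofReal (S1 ω ^ 2)
        + ENNReal.ofReal (3 * ‖c3‖ ^ 2) * ENNReal.ofReal (S3 ω ^ 2)
        + ENNReal.ofReal (3 * (n * (K * (k * ε)) ^ 2))
          * ∑ i ∈ Finset.range n, ENNReal.ofReal (noiseScale (Z i ω) ^ 24) := fun ω => by
    have hY : ∀ i, 0 ≤ noiseScale (Z i ω) := fun i => zero_le_one.trans (one_le_noiseScale _)
    rw [← ofReal_norm, ← ENNReal.ofReal_pow (norm_nonneg _), ← ENNReal.ofReal_mul (by positivity),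
      ← ENNReal.ofReal_mul (by positivity),
      ← ENNReal.ofReal_sum_of_nonneg (fun i _ => pow_nonneg (hY i) 24),
      ← ENNReal.ofReal_mul (by positivity), ← ENNReal.ofReal_add (by positivity) (by positivity),
      ← ENNReal.ofReal_add (by positivity)
        (mul_nonneg (by positivity) (Finset.sum_nonneg fun i _ => pow_nonneg (hY i) 24))]
    refine ENNReal.ofReal_le_ofReal ?_
    set R : ℕ → ℂ := fun i => stepError μ ρ κ k h (Z i ω)
      - (c1 * (Z i ω) + c3 * ((Z i ω : ℝ) : ℂ) ^ 3) with hR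
    have e : ∑ i ∈ Finset.range n, stepError μ ρ κ k h (Z i ω)
        = c1 * (S1 ω : ℝ) + c3 * (S3 ω : ℝ) + ∑ i ∈ Finset.range n, R i := by
      simp only [hR, hS1, hS3, Finset.sum_sub_distrib, Finset.sum_add_distrib]
      push_cast
      rw [Finset.mul_sum, Finset.mul_sum]
      ring
    have hRn : ‖∑ i ∈ Finset.range n, R i‖ ^ 2
        ≤ (n * (K * (k * ε)) ^ 2) * ∑ i ∈ Finset.range n, noiseScale (Z i ω) ^ 24 := by
      have a1 : ‖∑ i ∈ Finset.range n, R i‖ ^ 2 ≤ (∑ i ∈ Finset.range n, ‖R i‖) ^ 2 :=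
        pow_le_pow_left₀ (norm_nonneg _) (norm_sum_le _ _) 2
      have a2 := sq_sum_le_card_mul_sum_sq (s := Finset.range n) (f := fun i => ‖R i‖)
      rw [Finset.card_range] at a2
      have a3 : ∑ i ∈ Finset.range n, ‖R i‖ ^ 2
          ≤ ∑ i ∈ Finset.range n, (K * (k * ε)) ^ 2 * noiseScale (Z i ω) ^ 24 :=
        Finset.sum_le_sum fun i _ => by
          refine (pow_le_pow_left₀ (norm_nonneg _)
            (norm_stepError_sub_odd_le hρ0 hρ1 hk hkδ hh hhδ (Z i ω)) 2).trans_eq ?_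
          rw [hK]; ring
      rw [← Finset.mul_sum] at a3
      calc _ ≤ (n : ℝ) * ∑ i ∈ Finset.range n, ‖R i‖ ^ 2 := a1.trans a2
        _ ≤ n * ((K * (k * ε)) ^ 2 * ∑ i ∈ Finset.range n, noiseScale (Z i ω) ^ 24) :=
          mul_le_mul_of_nonneg_left a3 (by positivity)
        _ = _ := by ring
    have t := norm_add₃_le (a := c1 * (S1 ω : ℝ)) (b := c3 * (S3 ω : ℝ))
      (c := ∑ i ∈ Finset.range n, R i)
    rw [← e, norm_mul, norm_mul, Complex.norm_real, Complex.norm_real, Real.norm_eq_abs,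
      Real.norm_eq_abs] at t
    have t2 := pow_le_pow_left₀ (norm_nonneg _) t 2
    have q1 : (‖c1‖ * |S1 ω|) ^ 2 = ‖c1‖ ^ 2 * S1 ω ^ 2 := by rw [mul_pow, sq_abs]
    have q3 : (‖c3‖ * |S3 ω|) ^ 2 = ‖c3‖ ^ 2 * S3 ω ^ 2 := by rw [mul_pow, sq_abs]
    have t3 : ∀ x y z : ℝ, (x + y + z) ^ 2 ≤ 3 * x ^ 2 + 3 * y ^ 2 + 3 * z ^ 2 := fun x y z => by
      nlinarith [sq_nonneg (x - y), sq_nonneg (y - z), sq_nonneg (x - z)]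
    have t4 := t3 (‖c1‖ * |S1 ω|) (‖c3‖ * |S3 ω|) ‖∑ i ∈ Finset.range n, R i‖
    rw [q1, q3] at t4
    linarith
  obtain ⟨m1, m2, m3, -⟩ := gaussian_moments
  have iS1 := lintegral_sum_sq hZ hlaw (f := fun z => z) measurable_id
    (memLp_id_gaussianReal' 2 (by simp)) m1 n
  have iS3 := lintegral_sum_sq hZ hlaw (f := fun z => z ^ 3) (by fun_prop)
    ((memLp_two_iff_integrable_sq (by fun_prop)).2 (by
      simpa only [← pow_mul] using integrable_pow_gaussianReal 0 1 (3 * 2))) m3 n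
  rw [m2, mul_one] at iS1
  have m6 : ∫ z : ℝ, (z ^ 3) ^ 2 ∂(gaussianReal 0 1) ≤ noiseMoment 3 := by
    refine integral_mono (by simpa only [← pow_mul] using integrable_pow_gaussianReal 0 1 (3 * 2))
      (integrable_noiseScale_pow 3) fun z => ?_
    calc (z ^ 3) ^ 2 = (z ^ 2) ^ 3 := by ring
      _ ≤ noiseScale z ^ 3 := pow_le_pow_left₀ (sq_nonneg z) (sq_le_noiseScale z) 3
  have hZm : ∀ i, AEMeasurable (Z i) P := fun i => (hlaw i).aemeasurable
  have mY : ∀ i, AEMeasurable (fun ω => ENNReal.ofReal (noiseScale (Z i ω) ^ 24)) P := fun i =>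
    ((continuous_noiseScale.measurable.comp_aemeasurable (hZm i)).pow_const 24).ennreal_ofReal
  have mS1 : AEMeasurable (fun ω => ENNReal.ofReal (S1 ω ^ 2)) P :=
    ((Finset.aemeasurable_fun_sum _ fun i _ => hZm i).pow_const 2).ennreal_ofReal
  have mS3 : AEMeasurable (fun ω => ENNReal.ofReal (S3 ω ^ 2)) P :=
    ((Finset.aemeasurable_fun_sum _ fun i _ => (hZm i).pow_const 3).pow_const 2).ennreal_ofReal
  have mS13 : AEMeasurable (fun ω => ENNReal.ofReal (3 * ‖c1‖ ^ 2) * ENNReal.ofReal (S1 ω ^ 2)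
      + ENNReal.ofReal (3 * ‖c3‖ ^ 2) * ENNReal.ofReal (S3 ω ^ 2)) P :=
    (mS1.const_mul _).add (mS3.const_mul _)
  refine (lintegral_mono hpt).trans ?_
  rw [lintegral_add_left' mS13,
    lintegral_add_left' (mS1.const_mul _), lintegral_const_mul' _ _ ENNReal.ofReal_ne_top,
    lintegral_const_mul' _ _ ENNReal.ofReal_ne_top, lintegral_const_mul' _ _ ENNReal.ofReal_ne_top,
    lintegral_finsetSum' _ fun i _ => mY i, iS1, iS3]
  simp only [lintegral_noiseScale_pow (hlaw _), Finset.sum_const, Finset.card_range]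
  rw [← ENNReal.ofReal_nsmul, ← ENNReal.ofReal_mul (by positivity),
    ← ENNReal.ofReal_mul (by positivity), ← ENNReal.ofReal_mul (by positivity),
    ← ENNReal.ofReal_add (by positivity)
      (mul_nonneg (by positivity) (mul_nonneg (by positivity) (integral_nonneg fun z => by positivity))),
    ← ENNReal.ofReal_add (add_nonneg (by positivity)
      (mul_nonneg (by positivity) (mul_nonneg (by positivity)
        (integral_nonneg fun z => by positivity)))) (by positivity),
    ← ENNReal.ofReal_pow (by unfold errorSumConst; positivity)]
  refine ENNReal.ofReal_le_ofReal ?_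
  rw [errorSumConst, mul_pow (√_) ε, Real.sq_sqrt (by positivity), ← hUdef, ← hK, nsmul_eq_mul]
  have b1 : 3 * ‖c1‖ ^ 2 * n ≤ 3 * (4 * U ^ 4 * T) * ε ^ 2 := by
    have a1 := mul_le_mul_of_nonneg_right hc1s (by positivity : (0 : ℝ) ≤ 3 * n)
    have a2 := mul_le_mul_of_nonneg_left hn (by positivity : 0 ≤ 12 * U ^ 4 * ε ^ 2)
    linarith
  have b3 : 3 * ‖c3‖ ^ 2 * (n * ∫ z : ℝ, (z ^ 3) ^ 2 ∂(gaussianReal 0 1))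
      ≤ 3 * (U ^ 4 * T * noiseMoment 3) * ε ^ 2 := by
    calc _ ≤ 3 * (U ^ 4 * (k * ε ^ 2)) * (n * noiseMoment 3) := by gcongr
      _ = 3 * U ^ 4 * ε ^ 2 * noiseMoment 3 * (n * k) := by ring
      _ ≤ 3 * U ^ 4 * ε ^ 2 * noiseMoment 3 * T := mul_le_mul_of_nonneg_left hn (by positivity)
      _ = _ := by ring
  have b4 : 3 * (n * (K * (k * ε)) ^ 2) * (n * noiseMoment 24)
      ≤ 3 * (K ^ 2 * T ^ 2 * noiseMoment 24) * ε ^ 2 := by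
    have a1 : (n * k) ^ 2 ≤ T ^ 2 := pow_le_pow_left₀ (by positivity) hn 2
    calc _ = 3 * K ^ 2 * noiseMoment 24 * ε ^ 2 * (n * k) ^ 2 := by ring
      _ ≤ 3 * K ^ 2 * noiseMoment 24 * ε ^ 2 * T ^ 2 :=
        mul_le_mul_of_nonneg_left a1 (by positivity)
      _ = _ := by ring
  linarith

end Remainder

/-! ### Assembly of the Fourier mode estimates -/

lemma rms_le_of_lintegral_sq_le {Ω : Type*} [MeasurableSpace Ω] {P : Measure Ω} {F : Ω → ℝ≥0∞}
    {c : ℝ≥0∞} (h : ∫⁻ ω, F ω ^ 2 ∂P ≤ c ^ 2) : rms P F ≤ c := by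
  rw [rms]
  refine (ENNReal.rpow_le_rpow h (by norm_num)).trans_eq ?_
  rw [← ENNReal.rpow_natCast, ← ENNReal.rpow_mul]
  norm_num

/-- The error expansion for Fourier modes. -/
theorem fourierMode_errors (μ ρ : ℝ) (hρ0 : 0 ≤ ρ) (hρ1 : ρ ≤ 1) (κ : ℝ) :
    ∃ δ : ℝ, 0 < δ ∧
      (∀ k h : ℝ, 0 < k → k ≤ δ → 0 < h → h ≤ δ → ∀ z : ℝ,
        ampFactor μ ρ κ k h z
          = Complex.exp (exactExponent μ ρ κ k (√k * z) + stepError μ ρ κ k h z)) ∧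
      (∀ p : ℝ, 1 ≤ p → ∀ Λ : ℝ, ∃ c : ℝ,
        ∀ (Ω : Type u) [MeasurableSpace Ω] (P : Measure Ω) (M : ℝ≥0 → Ω → ℝ),
          IsBrownianReal M P →
          ∀ k h : ℝ, 0 < k → k ≤ δ → 0 < h → h ≤ δ → ρ * h ^ 4 ≤ Λ * k → ∀ n : ℕ,
            ∫⁻ ω, ‖remainder μ ρ κ k h (noise M k n ω)‖ₑ ^ p ∂P
              ≤ ENNReal.ofReal (c * (k ^ 2 + k * h ^ 2) ^ p)) ∧
      (∀ T : ℝ, 0 < T → ∃ C : ℝ,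
        ∀ (Ω : Type u) [MeasurableSpace Ω] (P : Measure Ω) (M : ℝ≥0 → Ω → ℝ),
          IsBrownianReal M P →
          ∀ k h : ℝ, 0 < k → k ≤ δ → 0 < h → h ≤ δ → ∀ n : ℕ, n * k ≤ T →
            rms P (fun ω => ‖∑ i ∈ Finset.range n, stepError μ ρ κ k h (noise M k i ω)‖ₑ)
              ≤ ENNReal.ofReal (C * (k + h ^ 2)) ∧
            ∀ j : ℤ,
              rms P (fun ω =>
                  ‖gridSolution μ ρ k h (fun i => noise M k i ω)
                      (fun i : ℤ => mode κ (i * h)) n j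
                    - exactMode μ ρ κ (n * k) (M (n * k : ℝ).toNNReal ω) (j * h)‖ₑ)
                ≤ ENNReal.ofReal (C * (k + h ^ 2))) := by
  have hU := waveScale_pos μ κ
  refine ⟨1 / (8 * waveScale μ κ), by positivity, ?_, ?_, ?_⟩
  · intro k h hk hkδ hh hhδ z
    exact ampFactor_eq_exp hρ0 hρ1 hk hkδ hh hhδ z
  · intro p hp Λ
    refine ⟨(1200000000 * waveScale μ κ ^ 12 + waveScale μ κ ^ 3 * √Λ) ^ p
      * noiseMoment (12 * ⌈p⌉₊), ?_⟩
    intro Ω _ P M hM k h hk hkδ hh hhδ hΛ n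
    exact lintegral_remainder_rpow_le hρ0 hρ1 hk hkδ hh hhδ hΛ (by linarith) (hasLaw_noise hM hk n)
  · intro T hT
    refine ⟨max (errorSumConst μ κ T) (modeErrorConst μ κ T), ?_⟩
    intro Ω _ P M hM k h hk hkδ hh hhδ n hn
    have hk1 := hkδ.trans (one_div_le_one_of_waveScale μ κ)
    have hh1 := hhδ.trans (one_div_le_one_of_waveScale μ κ)
    have hind := iIndepFun_noise hM hk
    have hlaw := hasLaw_noise hM hk
    have hε : 0 ≤ k + h ^ 2 := by positivity
    refine ⟨?_, fun j => ?_⟩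
    · refine (rms_le_of_lintegral_sq_le (lintegral_sum_stepError_sq_le hind hlaw hρ0 hρ1 hk hkδ hh
        hhδ hT.le hn)).trans (ENNReal.ofReal_le_ofReal ?_)
      exact mul_le_mul_of_nonneg_right (le_max_left _ _) hε
    · refine (rms_le_of_lintegral_sq_le ?_).trans (ENNReal.ofReal_le_ofReal
        (mul_le_mul_of_nonneg_right (le_max_right (errorSumConst μ κ T) _) hε))
      refine le_trans (lintegral_mono_ae ?_)
        (lintegral_mode_error_sq_le hind hlaw hρ0 hρ1 μ κ hk hk1 hh hh1 hT.le hn)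
      filter_upwards [prod_exp_exactExponent_noise hM hk n] with ω hω
      rw [gridSolution_mode, exactMode, ← hω, ← sub_mul, enorm_mul]
      have : ‖mode κ (j * h)‖ₑ = 1 := by
        rw [← ofReal_norm, norm_mode, ENNReal.ofReal_one]
      rw [this, mul_one]

/-! ### Fourier transform of a solution with measure initial data -/

section PDE

variable {μ ρ : ℝ} {ν : Measure ℝ} {u : ℝ → ℝ → ℝ}

lemma IsPDESolution.contDiffAt (hu : IsPDESolution μ ρ ν u) {t : ℝ} (ht : 0 < t) (x : ℝ) :
    ContDiffAt ℝ 2 (Function.uncurry u) (t, x) :=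
  hu.contDiffOn.contDiffAt ((isOpen_Ioi.prod isOpen_univ).mem_nhds ⟨ht, trivial⟩)

lemma IsPDESolution.contDiff (hu : IsPDESolution μ ρ ν u) {t : ℝ} (ht : 0 < t) :
    ContDiff ℝ 2 (u t) := contDiff_iff_contDiffAt.2 fun x =>
  ContDiffAt.comp (g := Function.uncurry u) (f := fun y : ℝ => (t, y)) x (hu.contDiffAt ht x)
    (contDiffAt_const.prodMk contDiffAt_id)

lemma IsPDESolution.hasDerivAt_time (hu : IsPDESolution μ ρ ν u) {t : ℝ} (ht : 0 < t) (x : ℝ) :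
    HasDerivAt (fun s => u s x) (fderiv ℝ (Function.uncurry u) (t, x) (1, 0)) t := by
  have h1 := ((hu.contDiffAt ht x).differentiableAt (by norm_num)).hasFDerivAt
  have h2 : HasDerivAt (fun s : ℝ => (s, x)) ((1 : ℝ), (0 : ℝ)) t :=
    (hasDerivAt_id t).prodMk (hasDerivAt_const t x)
  exact h1.comp_hasDerivAt t h2

lemma IsPDESolution.continuousOn_timeDeriv (hu : IsPDESolution μ ρ ν u) :
    ContinuousOn (fun p : ℝ × ℝ => fderiv ℝ (Function.uncurry u) p (1, 0))
      (Set.Ioi 0 ×ˢ Set.univ) :=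
  (hu.contDiffOn.continuousOn_fderiv_of_isOpen (isOpen_Ioi.prod isOpen_univ)
    (by norm_num)).clm_apply continuousOn_const

/-- The weak form of the equation, tested against a compactly supported function. -/
lemma IsPDESolution.hasDerivAt_integral (hu : IsPDESolution μ ρ ν u) {φ φ₁ φ₂ : ℝ → ℂ}
    (h1 : ∀ x, HasDerivAt φ (φ₁ x) x) (h2 : ∀ x, HasDerivAt φ₁ (φ₂ x) x) (hc2 : Continuous φ₂)
    (hs : HasCompactSupport φ) {t : ℝ} (ht : 0 < t) :
    HasDerivAt (fun s => ∫ x, φ x * (u s x : ℂ))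
      (∫ x, ((((1 / 2) * (1 - ρ) : ℝ) : ℂ) * φ₂ x + (μ : ℂ) * φ₁ x) * (u t x : ℂ)) t := by
  have hc : Continuous φ := continuous_iff_continuousAt.2 fun x => (h1 x).continuousAt
  have hc1 : Continuous φ₁ := continuous_iff_continuousAt.2 fun x => (h2 x).continuousAt
  have e1 : deriv φ = φ₁ := funext fun x => (h1 x).deriv
  have e2 : deriv φ₁ = φ₂ := funext fun x => (h2 x).deriv
  have hs1 : HasCompactSupport φ₁ := e1 ▸ hs.deriv
  have hs2 : HasCompactSupport φ₂ := e2 ▸ hs1.deriv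
  have hcu : ∀ {s : ℝ}, 0 < s → Continuous (fun x => (u s x : ℂ)) := fun hs =>
    Complex.continuous_ofReal.comp (hu.contDiff hs).continuous
  set D : ℝ → ℝ → ℝ := fun s x => fderiv ℝ (Function.uncurry u) (s, x) (1, 0) with hD
  have hDc : ∀ {s : ℝ}, 0 < s → Continuous (D s) := fun {s} hs => by
    have := hu.continuousOn_timeDeriv.comp (f := fun x : ℝ => (s, x)) (s := Set.univ)
      (by fun_prop) (fun x _ => ⟨hs, trivial⟩)
    exact continuousOn_univ.1 this
  -- The time derivative of u is bounded on this compact set, which supplies the dominating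
  -- function.
  have hcpt : IsCompact (Set.Icc (t / 2) (2 * t) ×ˢ tsupport φ) := isCompact_Icc.prod hs
  obtain ⟨B, hB⟩ := hcpt.exists_bound_of_continuousOn (hu.continuousOn_timeDeriv.mono
    (Set.prod_mono (fun s hs => lt_of_lt_of_le (by linarith) hs.1) (Set.subset_univ _)))
  have hnhds : Set.Icc (t / 2) (2 * t) ∈ 𝓝 t := Icc_mem_nhds (by linarith) (by linarith)
  have key := hasDerivAt_integral_of_dominated_loc_of_deriv_le (μ := volume) (𝕜 := ℝ)
    (F := fun s x => φ x * (u s x : ℂ)) (F' := fun s x => φ x * (D s x : ℂ)) (x₀ := t)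
    (bound := fun x => ‖φ x‖ * B) hnhds
    (by
      filter_upwards [Ioi_mem_nhds ht] with s hs
      exact (hc.mul (hcu hs)).aestronglyMeasurable)
    ((hc.mul (hcu ht)).integrable_of_hasCompactSupport hs.mul_right)
    ((hc.mul (Complex.continuous_ofReal.comp (hDc ht))).aestronglyMeasurable)
    (ae_of_all _ fun x s hst => by
      rw [norm_mul]
      by_cases hx : x ∈ tsupport φ
      · exact mul_le_mul_of_nonneg_left (by simpa using hB (s, x) ⟨hst, hx⟩) (norm_nonneg _)
      · simp [image_eq_zero_of_notMem_tsupport hx])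
    ((hc.norm.mul continuous_const).integrable_of_hasCompactSupport hs.norm.mul_right)
    (ae_of_all _ fun x s hst =>
      ((hu.hasDerivAt_time (lt_of_lt_of_le (by linarith) hst.1) x).ofReal_comp).const_mul (φ x))
  refine key.2.congr_deriv ?_
  have hcd := hu.contDiff ht
  have ud : ∀ x, HasDerivAt (fun x => (u t x : ℂ)) ((deriv (u t) x : ℝ) : ℂ) x := fun x =>
    ((hcd.differentiable (by norm_num) x).hasDerivAt).ofReal_comp
  have hd1 : ContDiff ℝ 1 (deriv (u t)) := by
    have : ContDiff ℝ (1 + 1) (u t) := by norm_num; exact hcd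
    exact (contDiff_succ_iff_deriv.1 this).2.2
  have udd : ∀ x, HasDerivAt (fun x => ((deriv (u t) x : ℝ) : ℂ))
      ((iteratedDeriv 2 (u t) x : ℝ) : ℂ) x := fun x => by
    rw [iteratedDeriv_succ, iteratedDeriv_one]
    exact ((hd1.differentiable (by norm_num) x).hasDerivAt).ofReal_comp
  have cu1 : Continuous fun x => ((deriv (u t) x : ℝ) : ℂ) :=
    Complex.continuous_ofReal.comp hd1.continuous
  have cu2 : Continuous fun x => ((iteratedDeriv 2 (u t) x : ℝ) : ℂ) :=
    Complex.continuous_ofReal.comp (hcd.continuous_iteratedDeriv 2 (by norm_num))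
  have I : ∀ {f g : ℝ → ℂ}, Continuous f → Continuous g → HasCompactSupport f →
      Integrable (f * g) volume := fun hf hg hfs =>
    (hf.mul hg).integrable_of_hasCompactSupport hfs.mul_right
  -- Compact support of the test function means that integration by parts needs no decay of the
  -- derivatives of u.
  have p1 : ∫ x, φ x * ((deriv (u t) x : ℝ) : ℂ) = -∫ x, φ₁ x * (u t x : ℂ) :=
    integral_mul_deriv_eq_deriv_mul_of_integrable (fun x _ => h1 x) (fun x _ => ud x)
      (I hc cu1 hs) (I hc1 (hcu ht) hs1) (I hc (hcu ht) hs)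
  have p2 : ∫ x, φ x * ((iteratedDeriv 2 (u t) x : ℝ) : ℂ)
      = -∫ x, φ₁ x * ((deriv (u t) x : ℝ) : ℂ) :=
    integral_mul_deriv_eq_deriv_mul_of_integrable (fun x _ => h1 x) (fun x _ => udd x)
      (I hc cu2 hs) (I hc1 cu1 hs1) (I hc cu1 hs)
  have p3 : ∫ x, φ₁ x * ((deriv (u t) x : ℝ) : ℂ) = -∫ x, φ₂ x * (u t x : ℂ) :=
    integral_mul_deriv_eq_deriv_mul_of_integrable (fun x _ => h2 x) (fun x _ => ud x)
      (I hc1 cu1 hs1) (I hc2 (hcu ht) hs2) (I hc1 (hcu ht) hs1)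
  have hpde : ∀ x, D t x = (1 / 2) * (1 - ρ) * iteratedDeriv 2 (u t) x - μ * deriv (u t) x :=
    fun x => by
      have := hu.pde t ht x
      rw [(hu.hasDerivAt_time ht x).deriv] at this
      simpa [smul_eq_mul] using this
  have l1 : (fun x => φ x * (D t x : ℂ)) = fun x =>
      (((1 / 2) * (1 - ρ) : ℝ) : ℂ) * (φ x * ((iteratedDeriv 2 (u t) x : ℝ) : ℂ))
        - (μ : ℂ) * (φ x * ((deriv (u t) x : ℝ) : ℂ)) := by
    funext x; rw [hpde]; push_cast; ring
  have l2 : (fun x => ((((1 / 2) * (1 - ρ) : ℝ) : ℂ) * φ₂ x + (μ : ℂ) * φ₁ x) * (u t x : ℂ))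
      = fun x => (((1 / 2) * (1 - ρ) : ℝ) : ℂ) * (φ₂ x * (u t x : ℂ))
        + (μ : ℂ) * (φ₁ x * (u t x : ℂ)) := by
    funext x; ring
  have j1 : Integrable fun x => φ x * ((iteratedDeriv 2 (u t) x : ℝ) : ℂ) := I hc cu2 hs
  have j2 : Integrable fun x => φ x * ((deriv (u t) x : ℝ) : ℂ) := I hc cu1 hs
  have j3 : Integrable fun x => φ₂ x * (u t x : ℂ) := I hc2 (hcu ht) hs2
  have j4 : Integrable fun x => φ₁ x * (u t x : ℂ) := I hc1 (hcu ht) hs1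
  rw [l1, l2, integral_sub (j1.const_mul _) (j2.const_mul _),
    integral_add (j3.const_mul _) (j4.const_mul _), integral_const_mul, integral_const_mul,
    integral_const_mul, integral_const_mul, p1, p2, p3]
  ring

/-- Dilates χ(ax) with a → 0 let exponentials serve as test functions; their derivatives carry
factors a. -/
lemma exists_cutoff : ∃ (χ χ₁ χ₂ : ℝ → ℝ) (C : ℝ), (∀ x, HasDerivAt χ (χ₁ x) x) ∧
    (∀ x, HasDerivAt χ₁ (χ₂ x) x) ∧ Continuous χ₂ ∧ HasCompactSupport χ ∧ χ 0 = 1 ∧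
    (∀ x, |χ x| ≤ 1) ∧ (∀ x, |χ₁ x| ≤ C) ∧ (∀ x, |χ₂ x| ≤ C) := by
  let χ : ContDiffBump (0 : ℝ) := ⟨1, 2, one_pos, one_lt_two⟩
  have h2 : ContDiff ℝ 2 χ := χ.contDiff
  have h1 : ContDiff ℝ 1 (deriv χ) := by
    have : ContDiff ℝ (1 + 1) χ := by norm_num; exact h2
    exact (contDiff_succ_iff_deriv.1 this).2.2
  have h0 : Continuous (deriv (deriv χ)) := by
    have : ContDiff ℝ (0 + 1) (deriv χ) := by norm_num; exact h1
    exact (contDiff_succ_iff_deriv.1 this).2.2.continuous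
  obtain ⟨C1, hC1⟩ := h1.continuous.bounded_above_of_compact_support χ.hasCompactSupport.deriv
  obtain ⟨C2, hC2⟩ := h0.bounded_above_of_compact_support χ.hasCompactSupport.deriv.deriv
  refine ⟨χ, deriv χ, deriv (deriv χ), max C1 C2,
    fun x => (h2.differentiable (by norm_num) x).hasDerivAt,
    fun x => (h1.differentiable (by norm_num) x).hasDerivAt, h0, χ.hasCompactSupport,
    χ.one_of_mem_closedBall (by simp [χ]), fun x => ?_,
    fun x => (hC1 x).trans (le_max_left _ _), fun x => (hC2 x).trans (le_max_right _ _)⟩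
  rw [abs_of_nonneg χ.nonneg]
  exact χ.le_one

lemma hasDerivAt_mode_neg (ξ x : ℝ) :
    HasDerivAt (fun x => mode ξ (-x)) (-(Complex.I * ξ) * mode ξ (-x)) x := by
  have e : (fun x => mode ξ (-x)) = fun x : ℝ => Complex.exp (-(Complex.I * ξ) * (x : ℂ)) := by
    funext x; rw [mode]; push_cast; ring_nf
  have h1 : HasDerivAt (fun x : ℝ => -(Complex.I * ξ) * (x : ℂ)) (-(Complex.I * ξ)) x := by
    simpa using (Complex.ofRealCLM.hasDerivAt (x := x)).const_mul (-(Complex.I * ξ))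
  have h2 := h1.cexp
  have e' : mode ξ (-x) = Complex.exp (-(Complex.I * ξ) * (x : ℂ)) := congrFun e x
  rw [e, e']
  exact h2.congr_deriv (mul_comm _ _)

lemma continuous_mode (κ : ℝ) : Continuous (mode κ) := by unfold mode; fun_prop

/-- The Fourier transform of a measure, `∫ e^{-iκx} dν(x)`. -/
noncomputable def fourierMeasure (ν : Measure ℝ) (κ : ℝ) : ℂ := ∫ x, mode κ (-x) ∂ν

/-- `e^{-st} ∫ e^{-iξx} u(t,x) dx` does not depend on `t > 0`. -/
lemma IsPDESolution.fourier_const (hu : IsPDESolution μ ρ ν u) (ξ : ℝ) {t₁ t₂ : ℝ} (h1 : 0 < t₁)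
    (h2 : 0 < t₂) :
    Complex.exp (-exactExponent μ ρ ξ t₁ 0) * ∫ x, mode ξ (-x) * (u t₁ x : ℂ)
      = Complex.exp (-exactExponent μ ρ ξ t₂ 0) * ∫ x, mode ξ (-x) * (u t₂ x : ℂ) := by
  obtain ⟨χ, χ₁, χ₂, C, hχ, hχ₁, hχ₂, hsupp, hχ0, hb0, hb1, hb2⟩ := exists_cutoff
  have hC0 : 0 ≤ C := (abs_nonneg _).trans (hb1 0)
  set s : ℂ := -(((1 / 2) * (1 - ρ) * ξ ^ 2 : ℝ) : ℂ) - Complex.I * ((ξ * μ : ℝ) : ℂ) with hs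
  have hexp : ∀ t : ℝ, exactExponent μ ρ ξ t 0 = s * t := fun t => by
    rw [exactExponent, hs]; push_cast; ring
  set a : ℕ → ℝ := fun n => 1 / ((n : ℝ) + 1) with ha
  have ha0 : ∀ n, 0 < a n := fun n => by positivity
  have ha1 : ∀ n, a n ≤ 1 := fun n => by
    rw [ha]; simp only; rw [div_le_one (by positivity)]; linarith [(Nat.cast_nonneg n : (0 : ℝ) ≤ n)]
  have hat : Tendsto a atTop (𝓝 0) := tendsto_one_div_add_atTop_nhds_zero_nat
  set e : ℝ → ℂ := fun x => mode ξ (-x) with he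
  have hen : ∀ x, ‖e x‖ = 1 := fun x => norm_mode _ _
  set θ : ℂ := -(Complex.I * ξ) with hθ
  have hθn : ‖θ‖ = |ξ| := by rw [hθ, norm_neg, norm_mul, Complex.norm_I, one_mul, Complex.norm_real,
    Real.norm_eq_abs]
  have hscale : ∀ {f f' : ℝ → ℝ}, (∀ x, HasDerivAt f (f' x) x) → ∀ n x,
      HasDerivAt (fun x => ((f (a n * x) : ℝ) : ℂ)) ((a n * f' (a n * x) : ℝ) : ℂ) x :=
    fun hf n x => by
      have : HasDerivAt (fun x => a n * x) (a n) x := by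
        simpa using (hasDerivAt_id x).const_mul (a n)
      have h := ((hf (a n * x)).comp x this).ofReal_comp
      rw [mul_comm]
      exact h
  set φ : ℕ → ℝ → ℂ := fun n x => (χ (a n * x) : ℂ) * e x with hφ
  set φ₁ : ℕ → ℝ → ℂ := fun n x => ((a n * χ₁ (a n * x) : ℝ) : ℂ) * e x
    + (χ (a n * x) : ℂ) * (θ * e x) with hφ₁
  set φ₂ : ℕ → ℝ → ℂ := fun n x => (((a n * (a n * χ₂ (a n * x)) : ℝ) : ℂ) * e x
    + ((a n * χ₁ (a n * x) : ℝ) : ℂ) * (θ * e x)) + (((a n * χ₁ (a n * x) : ℝ) : ℂ) * (θ * e x)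
    + (χ (a n * x) : ℂ) * (θ * (θ * e x))) with hφ₂
  have hed : ∀ x, HasDerivAt e (θ * e x) x := fun x => hasDerivAt_mode_neg ξ x
  have d1 : ∀ n x, HasDerivAt (φ n) (φ₁ n x) x := fun n x => (hscale hχ n x).mul (hed x)
  have d2 : ∀ n x, HasDerivAt (φ₁ n) (φ₂ n x) x := fun n x => by
    have hA : HasDerivAt (fun x => ((a n * χ₁ (a n * x) : ℝ) : ℂ))
        ((a n * (a n * χ₂ (a n * x)) : ℝ) : ℂ) x := by
      have := (hscale hχ₁ n x).const_mul (a n : ℂ)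
      simpa only [Complex.ofReal_mul] using this
    exact (hA.mul (hed x)).add ((hscale hχ n x).mul ((hed x).const_mul θ))
  have cχ : Continuous χ := continuous_iff_continuousAt.2 fun x => (hχ x).continuousAt
  have cχ₁ : Continuous χ₁ := continuous_iff_continuousAt.2 fun x => (hχ₁ x).continuousAt
  have ce : Continuous e := continuous_iff_continuousAt.2 fun x => (hed x).continuousAt
  have c2 : ∀ n, Continuous (φ₂ n) := fun n => by
    have q0 : Continuous fun x => ((χ (a n * x) : ℝ) : ℂ) := by fun_prop
    have q1 : Continuous fun x => ((a n * χ₁ (a n * x) : ℝ) : ℂ) := by fun_prop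
    have q2 : Continuous fun x => ((a n * (a n * χ₂ (a n * x)) : ℝ) : ℂ) := by fun_prop
    exact ((q2.mul ce).add (q1.mul (continuous_const.mul ce))).add
      ((q1.mul (continuous_const.mul ce)).add (q0.mul (continuous_const.mul
        (continuous_const.mul ce))))
  have hcs : ∀ n, HasCompactSupport (φ n) := fun n => by
    have h1 : HasCompactSupport fun x => χ (a n * x) :=
      hsupp.comp_homeomorph (Homeomorph.mulLeft₀ (a n) (ha0 n).ne')
    have h2 : HasCompactSupport fun x => ((χ (a n * x) : ℝ) : ℂ) :=
      h1.comp_left (g := fun y : ℝ => (y : ℂ)) Complex.ofReal_zero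
    exact h2.mul_right
  have cuc : ∀ {t : ℝ}, 0 < t → Continuous (fun x => (u t x : ℂ)) := fun ht =>
    Complex.continuous_ofReal.comp (hu.contDiff ht).continuous
  set T := max t₁ t₂ with hT
  obtain ⟨B, hB⟩ := hu.mass_bounded T
  set L : ℝ := |(1 / 2) * (1 - ρ)| * (C + 2 * C * |ξ|) + |μ| * C with hL
  have hL0 : 0 ≤ L := by positivity
  -- The exponential is an eigenfunction of the adjoint operator with eigenvalue s. The defect of
  -- its truncation contains at least one derivative of the cutoff, hence a factor a n.
  have herr : ∀ n x, ‖((((1 / 2) * (1 - ρ) : ℝ) : ℂ) * φ₂ n x + (μ : ℂ) * φ₁ n x) - s * φ n x‖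
      ≤ a n * L := fun n x => by
    have e1 : ((((1 / 2) * (1 - ρ) : ℝ) : ℂ) * φ₂ n x + (μ : ℂ) * φ₁ n x) - s * φ n x
        = (((1 / 2) * (1 - ρ) : ℝ) : ℂ) * ((((a n * (a n * χ₂ (a n * x)) : ℝ) : ℂ)
          + 2 * (((a n * χ₁ (a n * x) : ℝ) : ℂ) * θ)) * e x)
          + (μ : ℂ) * (((a n * χ₁ (a n * x) : ℝ) : ℂ) * e x) := by
      simp only [hφ, hφ₁, hφ₂, hs, hθ]
      push_cast
      linear_combination ((1 / 2) * (1 - ρ) * ξ ^ 2 * χ (a n * x) * e x : ℂ) * Complex.I_sq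
    have k2 : ‖((a n * (a n * χ₂ (a n * x)) : ℝ) : ℂ)‖ ≤ a n * C := by
      rw [Complex.norm_real, Real.norm_eq_abs, abs_mul, abs_mul, abs_of_pos (ha0 n)]
      refine mul_le_mul_of_nonneg_left ?_ (ha0 n).le
      exact (mul_le_of_le_one_left (abs_nonneg _) (ha1 n)).trans (hb2 _)
    have k1 : ‖((a n * χ₁ (a n * x) : ℝ) : ℂ)‖ ≤ a n * C := by
      rw [Complex.norm_real, Real.norm_eq_abs, abs_mul, abs_of_pos (ha0 n)]
      exact mul_le_mul_of_nonneg_left (hb1 _) (ha0 n).le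
    rw [e1]
    refine (norm_add_le _ _).trans ?_
    rw [norm_mul, norm_mul, norm_mul, norm_mul, hen, mul_one, mul_one, Complex.norm_real,
      Complex.norm_real, Real.norm_eq_abs, Real.norm_eq_abs]
    have k3 : ‖((a n * (a n * χ₂ (a n * x)) : ℝ) : ℂ) + 2 * (((a n * χ₁ (a n * x) : ℝ) : ℂ) * θ)‖
        ≤ a n * (C + 2 * C * |ξ|) := by
      refine (norm_add_le _ _).trans ?_
      rw [norm_mul, norm_mul, hθn, Complex.norm_ofNat]
      have := mul_le_mul_of_nonneg_right k1 (abs_nonneg ξ)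
      linarith
    have k4 := mul_le_mul_of_nonneg_left k3 (abs_nonneg ((1 / 2) * (1 - ρ)))
    have k5 := mul_le_mul_of_nonneg_left k1 (abs_nonneg μ)
    rw [hL]
    linarith
  set F : ℕ → ℝ → ℂ := fun n t => ∫ x, φ n x * (u t x : ℂ) with hF
  set H : ℕ → ℝ → ℂ := fun n t => Complex.exp (-(s * t)) * F n t with hH
  have huint : ∀ {t : ℝ}, 0 < t → Integrable (fun x => (u t x : ℂ)) := fun ht =>
    (hu.integrable _ ht).ofReal
  have hHd : ∀ n (t : ℝ), 0 < t → HasDerivAt (H n) (Complex.exp (-(s * t)) *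
      ∫ x, (((((1 / 2) * (1 - ρ) : ℝ) : ℂ) * φ₂ n x + (μ : ℂ) * φ₁ n x) - s * φ n x)
        * (u t x : ℂ)) t := fun n t ht => by
    have hFd := hu.hasDerivAt_integral (d1 n) (d2 n) (c2 n) (hcs n) ht
    have hE : HasDerivAt (fun t : ℝ => Complex.exp (-(s * t))) (Complex.exp (-(s * t)) * -s) t := by
      have : HasDerivAt (fun t : ℝ => -(s * (t : ℂ))) (-s) t := by
        exact ((Complex.ofRealCLM.hasDerivAt (x := t)).const_mul s).neg.congr_deriv (by simp)
      exact this.cexp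
    refine (hE.mul hFd).congr_deriv ?_
    have cφ : Continuous (φ n) := continuous_iff_continuousAt.2 fun x => (d1 n x).continuousAt
    have cφ₁ : Continuous (φ₁ n) := continuous_iff_continuousAt.2 fun x => (d2 n x).continuousAt
    have x1 : deriv (φ n) = φ₁ n := funext fun x => (d1 n x).deriv
    have x2 : deriv (φ₁ n) = φ₂ n := funext fun x => (d2 n x).deriv
    have hcs1 : HasCompactSupport (φ₁ n) := x1 ▸ (hcs n).deriv
    have hcs2 : HasCompactSupport (φ₂ n) := x2 ▸ hcs1.deriv
    have i1 : Integrable fun x => ((((1 / 2) * (1 - ρ) : ℝ) : ℂ) * φ₂ n x + (μ : ℂ) * φ₁ n x)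
        * (u t x : ℂ) :=
      (((continuous_const.mul (c2 n)).add (continuous_const.mul cφ₁)).mul
        (cuc ht)).integrable_of_hasCompactSupport
        ((hcs2.mul_left.add hcs1.mul_left).mul_right)
    have i2 : Integrable fun x => φ n x * (u t x : ℂ) :=
      (cφ.mul (cuc ht)).integrable_of_hasCompactSupport (hcs n).mul_right
    have e2 : (fun x => (((((1 / 2) * (1 - ρ) : ℝ) : ℂ) * φ₂ n x + (μ : ℂ) * φ₁ n x) - s * φ n x)
        * (u t x : ℂ)) = fun x => ((((1 / 2) * (1 - ρ) : ℝ) : ℂ) * φ₂ n x + (μ : ℂ) * φ₁ n x)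
        * (u t x : ℂ) - s * (φ n x * (u t x : ℂ)) := by funext x; ring
    rw [e2, integral_sub i1 (i2.const_mul s), integral_const_mul]
    ring
  have hT0 : 0 < T := h1.trans_le (le_max_left _ _)
  set K : ℝ := Real.exp (‖s‖ * T) * (L * max B 0) with hK
  have hHbound : ∀ n (t : ℝ), t ∈ Set.Ioc 0 T → ‖Complex.exp (-(s * t)) *
      ∫ x, (((((1 / 2) * (1 - ρ) : ℝ) : ℂ) * φ₂ n x + (μ : ℂ) * φ₁ n x) - s * φ n x)
        * (u t x : ℂ)‖ ≤ a n * K := fun n t ht => by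
    have y1 : ‖Complex.exp (-(s * t))‖ ≤ Real.exp (‖s‖ * T) := by
      refine (Complex.norm_exp_le_exp_norm _).trans (Real.exp_le_exp.2 ?_)
      rw [norm_neg, norm_mul, Complex.norm_real, Real.norm_of_nonneg ht.1.le]
      exact mul_le_mul_of_nonneg_left ht.2 (norm_nonneg _)
    have y2 : ‖∫ x, (((((1 / 2) * (1 - ρ) : ℝ) : ℂ) * φ₂ n x + (μ : ℂ) * φ₁ n x) - s * φ n x)
        * (u t x : ℂ)‖ ≤ a n * L * max B 0 := by
      refine (norm_integral_le_of_norm_le ((hu.integrable t ht.1).abs.const_mul (a n * L))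
        (ae_of_all _ fun x => ?_)).trans ?_
      · rw [norm_mul, Complex.norm_real, Real.norm_eq_abs]
        exact mul_le_mul_of_nonneg_right (herr n x) (abs_nonneg _)
      · rw [integral_const_mul]
        exact mul_le_mul_of_nonneg_left ((hB t ht.1 ht.2).trans (le_max_left _ _))
          (mul_nonneg (ha0 n).le hL0)
    rw [norm_mul]
    calc _ ≤ Real.exp (‖s‖ * T) * (a n * L * max B 0) :=
          mul_le_mul y1 y2 (norm_nonneg _) (Real.exp_pos _).le
      _ = _ := by rw [hK]; ring
  -- Mean value inequality on (0,T]: the mass bound makes the derivative of H n at most a n times a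
  -- constant, so the limit of H n takes equal values at t₁ and t₂.
  have hdiff : ∀ n, ‖H n t₁ - H n t₂‖ ≤ a n * K * ‖t₁ - t₂‖ := fun n =>
    Convex.norm_image_sub_le_of_norm_hasDerivWithin_le
      (fun t ht => (hHd n t ht.1).hasDerivWithinAt) (hHbound n) (convex_Ioc 0 T)
      ⟨h2, le_max_right _ _⟩ ⟨h1, le_max_left _ _⟩
  have hlimF : ∀ {t : ℝ}, 0 < t →
      Tendsto (fun n => H n t) atTop (𝓝 (Complex.exp (-(s * t)) * ∫ x, e x * (u t x : ℂ))) :=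
    fun {t} ht => by
      refine Tendsto.const_mul _ ?_
      refine tendsto_integral_of_dominated_convergence (fun x => |u t x|) (fun n => ?_)
        (hu.integrable t ht).abs (fun n => ae_of_all _ fun x => ?_) (ae_of_all _ fun x => ?_)
      · have cφ : Continuous (φ n) := continuous_iff_continuousAt.2 fun x => (d1 n x).continuousAt
        exact (cφ.mul (cuc ht)).aestronglyMeasurable
      · simp only [hφ]
        rw [norm_mul, norm_mul, hen, mul_one, Complex.norm_real, Complex.norm_real,
          Real.norm_eq_abs, Real.norm_eq_abs]
        exact mul_le_of_le_one_left (abs_nonneg _) (hb0 _)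
      · have z1 : Tendsto (fun n => a n * x) atTop (𝓝 0) := by simpa using hat.mul_const x
        have z2 : Tendsto (fun n => χ (a n * x)) atTop (𝓝 1) := by
          rw [← hχ0]; exact (cχ.tendsto 0).comp z1
        have z3 := (Complex.continuous_ofReal.tendsto 1).comp z2
        simpa [hφ] using (z3.mul_const (e x)).mul_const (u t x : ℂ)
  have hfin : Tendsto (fun n => H n t₁ - H n t₂) atTop (𝓝 0) := by
    refine squeeze_zero_norm hdiff ?_
    simpa using (hat.mul_const K).mul_const ‖t₁ - t₂‖
  have := tendsto_nhds_unique hfin ((hlimF h1).sub (hlimF h2))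
  rw [hexp, hexp]
  exact (sub_eq_zero.1 this.symm)

/-- The constant is identified by letting time tend to 0: weak convergence applies to cosine and
sine, which are bounded and continuous. -/
lemma IsPDESolution.fourier_eq [IsFiniteMeasure ν] (hu : IsPDESolution μ ρ ν u) (ξ : ℝ) {t : ℝ}
    (ht : 0 < t) :
    ∫ x, mode ξ (-x) * (u t x : ℂ)
      = Complex.exp (exactExponent μ ρ ξ t 0) * fourierMeasure ν ξ := by
  have hlim : Tendsto (fun s => ∫ x, mode ξ (-x) * (u s x : ℂ)) (𝓝[>] 0)
      (𝓝 (fourierMeasure ν ξ)) := by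
    let c : BoundedContinuousFunction ℝ ℝ := BoundedContinuousFunction.ofNormedAddCommGroup
      (fun x => Real.cos (ξ * x)) (by fun_prop) 1 (fun x => Real.abs_cos_le_one _)
    let d : BoundedContinuousFunction ℝ ℝ := BoundedContinuousFunction.ofNormedAddCommGroup
      (fun x => Real.sin (ξ * x)) (by fun_prop) 1 (fun x => Real.abs_sin_le_one _)
    have hc := hu.initial c
    have hd := hu.initial d
    have hm : ∀ x, mode ξ (-x) = (c x : ℂ) - (d x : ℂ) * Complex.I := fun x => by
      rw [mode_eq_cos_add_sin, mul_neg, Real.cos_neg, Real.sin_neg]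
      simp only [c, d, BoundedContinuousFunction.coe_ofNormedAddCommGroup]
      push_cast; ring
    have e1 : fourierMeasure ν ξ = ((∫ x, c x ∂ν : ℝ) : ℂ) - ((∫ x, d x ∂ν : ℝ) : ℂ) * Complex.I := by
      rw [fourierMeasure, ← integral_complex_ofReal, ← integral_complex_ofReal, ← integral_mul_const,
        ← integral_sub (c.integrable ν).ofReal ((d.integrable ν).ofReal.mul_const _)]
      exact integral_congr_ae (ae_of_all _ hm)
    rw [e1]
    refine (((Complex.continuous_ofReal.tendsto _).comp hc).sub
      (((Complex.continuous_ofReal.tendsto _).comp hd).mul_const Complex.I)).congr' ?_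
    filter_upwards [self_mem_nhdsWithin] with s hs
    have ic : ∀ f : BoundedContinuousFunction ℝ ℝ, Integrable fun x => f x * u s x := fun f =>
      (hu.integrable s hs).bdd_mul f.continuous.aestronglyMeasurable (c := ‖f‖)
        (ae_of_all _ fun x => f.norm_coe_le_norm x)
    simp only [Function.comp]
    rw [← integral_complex_ofReal, ← integral_complex_ofReal, ← integral_mul_const,
      ← integral_sub (ic c).ofReal ((ic d).ofReal.mul_const _)]
    refine integral_congr_ae (ae_of_all _ fun x => ?_)
    simp only [hm]
    push_cast; ring
  have hexp : Tendsto (fun s : ℝ => Complex.exp (-exactExponent μ ρ ξ s 0)) (𝓝[>] 0) (𝓝 1) := by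
    have hc : Continuous fun s : ℝ => Complex.exp (-exactExponent μ ρ ξ s 0) := by
      unfold exactExponent; fun_prop
    have := hc.tendsto 0
    have e0 : Complex.exp (-exactExponent μ ρ ξ 0 0) = 1 := by simp [exactExponent]
    rw [e0] at this
    exact this.mono_left nhdsWithin_le_nhds
  have hprod := hexp.mul hlim
  rw [one_mul] at hprod
  have hconst : Tendsto (fun s : ℝ => Complex.exp (-exactExponent μ ρ ξ s 0)
      * ∫ x, mode ξ (-x) * (u s x : ℂ)) (𝓝[>] 0)
      (𝓝 (Complex.exp (-exactExponent μ ρ ξ t 0) * ∫ x, mode ξ (-x) * (u t x : ℂ))) := by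
    refine tendsto_const_nhds.congr' ?_
    filter_upwards [self_mem_nhdsWithin] with s hs
    exact hu.fourier_const ξ ht hs
  rw [← tendsto_nhds_unique hconst hprod, ← mul_assoc, ← Complex.exp_add, add_neg_cancel,
    Complex.exp_zero, one_mul]

end PDE

/-! ### Fourier inversion for the exact solution -/

section Inversion

variable {μ ρ : ℝ} {ν : Measure ℝ} {u : ℝ → ℝ → ℝ}

lemma measurable_fourierMeasure (ν : Measure ℝ) [IsFiniteMeasure ν] :
    Measurable (fourierMeasure ν) := by
  have : Continuous fun p : ℝ × ℝ => mode p.1 (-p.2) := by unfold mode; fun_prop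
  exact (this.stronglyMeasurable.integral_prod_right (ν := ν)).measurable

lemma norm_fourierMeasure_le (ν : Measure ℝ) [IsFiniteMeasure ν] (κ : ℝ) :
    ‖fourierMeasure ν κ‖ ≤ ν.real Set.univ := by
  have := norm_integral_le_of_norm_le_const (μ := ν) (f := fun x => mode κ (-x)) (C := 1)
    (ae_of_all _ fun x => (norm_mode _ _).le)
  simpa [fourierMeasure] using this

lemma norm_exp_exactExponent_eq_gaussian (μ ρ κ t m : ℝ) :
    ‖Complex.exp (exactExponent μ ρ κ t m)‖ = Real.exp (-((1 - ρ) * t / 2) * κ ^ 2) := by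
  rw [norm_exp_exactExponent]; congr 1; ring

lemma exactMode_shift (μ ρ κ t m x : ℝ) :
    Complex.exp (exactExponent μ ρ κ t 0) * mode κ (x - √ρ * m) = exactMode μ ρ κ t m x := by
  rw [exactMode, mode, mode, ← Complex.exp_add, ← Complex.exp_add, exactExponent, exactExponent]
  push_cast; ring_nf

lemma integrable_exp_exactExponent_mul (hρ : ρ < 1) [IsFiniteMeasure ν] {t : ℝ} (ht : 0 < t)
    (m : ℝ) :
    Integrable fun κ => Complex.exp (exactExponent μ ρ κ t m) * fourierMeasure ν κ := by
  have hb : 0 < (1 - ρ) * t / 2 := by have := sub_pos.2 hρ; positivity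
  refine ((integrable_exp_neg_mul_sq hb).mul_const (ν.real Set.univ)).mono' ?_
    (ae_of_all _ fun κ => ?_)
  · have : Continuous fun κ => Complex.exp (exactExponent μ ρ κ t m) := by
      unfold exactExponent; fun_prop
    exact (this.measurable.mul (measurable_fourierMeasure ν)).aestronglyMeasurable
  · rw [norm_mul, norm_exp_exactExponent_eq_gaussian]
    exact mul_le_mul_of_nonneg_left (norm_fourierMeasure_le ν κ) (Real.exp_pos _).le

/-- The solution of the PDE is the inverse Fourier transform of its symbol. -/
lemma IsPDESolution.eq_integral [IsFiniteMeasure ν] (hu : IsPDESolution μ ρ ν u) (hρ : ρ < 1)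
    {t : ℝ} (ht : 0 < t) (x : ℝ) :
    (u t x : ℂ) = ((2 * Real.pi)⁻¹ : ℝ) * ∫ κ, Complex.exp (exactExponent μ ρ κ t 0)
      * fourierMeasure ν κ * mode κ x := by
  set G : ℝ → ℂ := fun κ => Complex.exp (exactExponent μ ρ κ t 0) * fourierMeasure ν κ with hG
  have hGi : Integrable G := integrable_exp_exactExponent_mul hρ ht 0
  set f : ℝ → ℂ := fun x => (u t x : ℂ) with hf
  have hF : FourierTransform.fourier f = fun w => G (2 * Real.pi * w) := by
    funext w
    rw [Real.fourier_real_eq_integral_exp_smul, hG]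
    simp only
    rw [← hu.fourier_eq (2 * Real.pi * w) ht]
    refine integral_congr_ae (ae_of_all _ fun y => ?_)
    simp only [hf, smul_eq_mul, mode]
    congr 2; push_cast; ring
  have hFi : Integrable (FourierTransform.fourier f) := by
    rw [hF]; exact hGi.comp_mul_left' (by positivity)
  have hcont : Continuous f := Complex.continuous_ofReal.comp (hu.contDiff ht).continuous
  have hinv := congrFun (hcont.fourierInv_fourier_eq (hu.integrable t ht).ofReal hFi) x
  rw [Real.fourierInv_eq', hF] at hinv
  have e : (fun w : ℝ => Complex.exp ((↑(2 * Real.pi * inner ℝ w x) * Complex.I))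
      • G (2 * Real.pi * w)) = fun w => (fun κ => G κ * mode κ x) (2 * Real.pi * w) := by
    funext w
    simp only [smul_eq_mul, mode, RCLike.inner_apply, conj_trivial]
    rw [mul_comm]
    congr 2; push_cast; ring
  rw [e, Measure.integral_comp_mul_left (fun κ => G κ * mode κ x) (2 * Real.pi),
    abs_of_pos (by positivity), Complex.real_smul] at hinv
  exact hinv.symm

/-- The random translation becomes a phase in the exponent. One null set serves all t and x, so the
formula may be used on the whole grid. -/
lemma IsSPDESolution.eq_integral {Ω : Type*} [MeasurableSpace Ω] {P : Measure Ω}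
    {M : ℝ≥0 → Ω → ℝ} {v : ℝ → ℝ → Ω → ℝ} [IsFiniteMeasure ν] (hv : IsSPDESolution μ ρ ν M P v)
    (hρ : ρ < 1) :
    ∀ᵐ ω ∂P, ∀ t : ℝ, 0 < t → ∀ x : ℝ, (v t x ω : ℂ) = ((2 * Real.pi)⁻¹ : ℝ) *
      ∫ κ, fourierMeasure ν κ * Complex.exp (exactExponent μ ρ κ t (M t.toNNReal ω))
        * mode κ x := by
  filter_upwards [hv] with ω hω t ht x
  have h := hω.eq_integral hρ ht (x - √ρ * M t.toNNReal ω)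
  simp only [sub_add_cancel] at h
  rw [h]
  congr 1
  refine integral_congr_ae (ae_of_all _ fun κ => ?_)
  simp only
  rw [mul_right_comm, exactMode_shift, exactMode]
  ring

end Inversion

/-! ### Fourier representation of the hat projection and the scheme -/

section SchemeFourier

lemma norm_exp_I_mul_sub_one_sub_le (y : ℝ) :
    ‖Complex.exp (Complex.I * y) - 1 - Complex.I * y‖ ≤ 3 * y ^ 2 := by
  have hn : ‖Complex.I * (y : ℂ)‖ = |y| := by
    rw [norm_mul, Complex.norm_I, one_mul, Complex.norm_real, Real.norm_eq_abs]
  rcases le_total |y| 1 with h | h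
  · refine (Complex.norm_exp_sub_one_sub_id_le (by rwa [hn])).trans ?_
    rw [hn, sq_abs]; nlinarith [sq_nonneg y]
  · refine (norm_sub_le _ _).trans ((add_le_add_left (norm_sub_le _ _) _).trans ?_)
    rw [hn, mul_comm, Complex.norm_exp_ofReal_mul_I, norm_one]
    nlinarith [sq_abs y]

/-- The piecewise linear interpolation on the grid `hℤ` of `x ↦ e^{-iκx}`. -/
noncomputable def hatSymbol (h κ x : ℝ) : ℂ :=
  ((1 - Int.fract (x / h) : ℝ) : ℂ) * mode κ (-(⌊x / h⌋ * h))
    + ((Int.fract (x / h) : ℝ) : ℂ) * mode κ (-((⌊x / h⌋ + 1 : ℤ) * h))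

lemma measurable_hatSymbol (h : ℝ) : Measurable fun p : ℝ × ℝ => hatSymbol h p.1 p.2 := by
  have hfr : Measurable fun p : ℝ × ℝ => Int.fract (p.2 / h) := by fun_prop
  have hfl : Measurable fun p : ℝ × ℝ => (⌊p.2 / h⌋ : ℝ) := by
    have : (fun p : ℝ × ℝ => (⌊p.2 / h⌋ : ℝ)) = fun p => p.2 / h - Int.fract (p.2 / h) := by
      funext p; rw [Int.self_sub_fract]
    rw [this]; fun_prop
  unfold hatSymbol mode
  push_cast
  fun_prop

lemma norm_hatSymbol_le_one (h κ x : ℝ) : ‖hatSymbol h κ x‖ ≤ 1 := by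
  refine (norm_add_le _ _).trans ?_
  rw [norm_mul, norm_mul, norm_mode, norm_mode, Complex.norm_real, Complex.norm_real,
    Real.norm_of_nonneg (sub_nonneg.2 (Int.fract_lt_one _).le),
    Real.norm_of_nonneg (Int.fract_nonneg _)]
  linarith

/-- Linear interpolation reproduces affine functions, so the first-order terms at the two
neighbouring nodes cancel and only second-order Taylor remainders are left. -/
lemma norm_hatSymbol_sub_mode_le {h : ℝ} (hh : 0 < h) (κ x : ℝ) :
    ‖hatSymbol h κ x - mode κ (-x)‖ ≤ 3 * (κ ^ 2 * h ^ 2) := by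
  set s := Int.fract (x / h) with hs
  have hs0 : 0 ≤ s := Int.fract_nonneg _
  have hs1 : s ≤ 1 := (Int.fract_lt_one _).le
  have hx : x = (⌊x / h⌋ : ℝ) * h + s * h := by
    rw [← add_mul, Int.floor_add_fract, div_mul_cancel₀ _ hh.ne']
  have e1 : mode κ (-(⌊x / h⌋ * h)) = mode κ (-x) * Complex.exp (Complex.I * (κ * (s * h) : ℝ)) := by
    rw [← mode, ← mode_add]; congr 1; linarith
  have e2 : mode κ (-((⌊x / h⌋ + 1 : ℤ) * h))
      = mode κ (-x) * Complex.exp (Complex.I * (κ * (-(1 - s) * h) : ℝ)) := by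
    rw [← mode, ← mode_add]; congr 1; push_cast; linarith
  have b1 := norm_exp_I_mul_sub_one_sub_le (κ * (s * h))
  have b2 := norm_exp_I_mul_sub_one_sub_le (κ * (-(1 - s) * h))
  set A := Complex.exp (Complex.I * (κ * (s * h) : ℝ)) with hA
  set B := Complex.exp (Complex.I * (κ * (-(1 - s) * h) : ℝ)) with hB
  have e3 : hatSymbol h κ x - mode κ (-x)
      = mode κ (-x) * (((1 - s : ℝ) : ℂ) * (A - 1 - Complex.I * (κ * (s * h) : ℝ))
        + (s : ℂ) * (B - 1 - Complex.I * (κ * (-(1 - s) * h) : ℝ))) := by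
    rw [hatSymbol, e1, e2]
    push_cast; ring
  rw [e3, norm_mul, norm_mode, one_mul]
  refine (norm_add_le _ _).trans ?_
  rw [norm_mul, norm_mul, Complex.norm_real, Complex.norm_real,
    Real.norm_of_nonneg (sub_nonneg.2 hs1), Real.norm_of_nonneg hs0]
  have c1 := mul_le_mul_of_nonneg_left b1 (sub_nonneg.2 hs1)
  have c2 := mul_le_mul_of_nonneg_left b2 hs0
  have hP : 0 ≤ κ ^ 2 * h ^ 2 := by positivity
  have : (1 - s) * (3 * (κ * (s * h)) ^ 2) + s * (3 * (κ * (-(1 - s) * h)) ^ 2)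
      = 3 * (κ ^ 2 * h ^ 2) * (s * (1 - s)) := by ring
  nlinarith [mul_nonneg hs0 (sub_nonneg.2 hs1), sq_nonneg (1 - 2 * s)]

lemma mode_zero_right (κ : ℝ) : mode κ 0 = 1 := by simp [mode]

lemma integral_mode_int {h : ℝ} (hh : 0 < h) (m : ℤ) :
    ∫ κ in Set.Icc (-(Real.pi / h)) (Real.pi / h), mode κ (m * h)
      = if m = 0 then ((2 * Real.pi / h : ℝ) : ℂ) else 0 := by
  have hle : -(Real.pi / h) ≤ Real.pi / h := 
    neg_le_self (div_nonneg Real.pi_pos.le hh.le)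
  rw [integral_Icc_eq_integral_Ioc, ← intervalIntegral.integral_of_le hle]
  split_ifs with hm
  · simp only [hm, Int.cast_zero, zero_mul, mode_zero_right]
    rw [intervalIntegral.integral_const, Complex.real_smul, mul_one]
    congr 1; ring
  · have hc : Complex.I * ((m * h : ℝ) : ℂ) ≠ 0 := by
      refine mul_ne_zero Complex.I_ne_zero ?_
      exact_mod_cast mul_ne_zero (Int.cast_ne_zero.2 hm) hh.ne'
    have e : (fun κ : ℝ => mode κ (m * h)) = fun κ : ℝ => Complex.exp (Complex.I * ((m * h : ℝ) : ℂ) * κ) := by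
      funext κ; rw [mode]; push_cast; ring_nf
    rw [e, integral_exp_mul_complex hc, div_eq_zero_iff]
    left
    rw [sub_eq_zero, Complex.exp_eq_exp_iff_exists_int]
    refine ⟨m, ?_⟩
    have : (h : ℂ) ≠ 0 := by exact_mod_cast hh.ne'
    push_cast
    field_simp
    ring

lemma hat_eq {h : ℝ} (hh : 0 < h) (j : ℤ) (x : ℝ) :
    hat h j x = (if j = ⌊x / h⌋ then 1 - Int.fract (x / h) else 0)
      + (if j = ⌊x / h⌋ + 1 then Int.fract (x / h) else 0) := by
  set s := Int.fract (x / h) with hs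
  set l := ⌊x / h⌋ with hl
  have hs0 : 0 ≤ s := Int.fract_nonneg _
  have hs1 : s < 1 := Int.fract_lt_one _
  have hx : x = (l : ℝ) * h + s * h := by
    rw [← add_mul, Int.floor_add_fract, div_mul_cancel₀ _ hh.ne']
  have key : hat h j x = max (1 - |(l - j : ℝ) + s|) 0 := by
    rw [hat, hx, show (l : ℝ) * h + s * h - j * h = ((l - j : ℝ) + s) * h by ring, abs_mul,
      abs_of_pos hh, show h - |(l - j : ℝ) + s| * h = h * (1 - |(l - j : ℝ) + s|) by ring]
    conv_lhs => rw [← mul_zero h, ← mul_max_of_nonneg _ _ hh.le, ← mul_assoc,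
      one_div_mul_cancel hh.ne', one_mul]
  rw [key]
  rcases lt_trichotomy j l with h1 | h1 | h1
  · rw [if_neg h1.ne, if_neg (by omega)]
    have : (j : ℝ) + 1 ≤ l := by exact_mod_cast h1
    rw [abs_of_nonneg (by linarith), max_eq_right (by linarith), add_zero]
  · subst h1
    rw [if_pos rfl, if_neg (by omega), sub_self, zero_add, abs_of_nonneg hs0,
      max_eq_left (by linarith), add_zero]
  · rw [if_neg h1.ne']
    by_cases h2 : j = l + 1
    · rw [if_pos h2, h2]
      push_cast
      rw [show (l : ℝ) - (l + 1) + s = -(1 - s) by ring, abs_neg, abs_of_nonneg (by linarith),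
        max_eq_left (by linarith)]
      ring
    · rw [if_neg h2]
      have : (l : ℝ) + 2 ≤ j := by
        have : l + 2 ≤ j := by omega
        exact_mod_cast this
      rw [abs_of_nonpos (by linarith), max_eq_right (by linarith), add_zero]

/-- For fixed x the symbol is a trigonometric polynomial in κ with two terms, whose coefficients are
the two hat functions that can be nonzero at x; orthogonality on [-π/h, π/h] picks out the one at j.
-/
lemma integral_hatSymbol_mul_mode {h : ℝ} (hh : 0 < h) (j : ℤ) (x : ℝ) :
    ∫ κ in Set.Icc (-(Real.pi / h)) (Real.pi / h), hatSymbol h κ x * mode κ (j * h)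
      = ((2 * Real.pi * ((1 / h) * hat h j x) : ℝ) : ℂ) := by
  have hI : ∀ (c : ℂ) (y : ℝ),
      IntegrableOn (fun κ => c * mode κ y) (Set.Icc (-(Real.pi / h)) (Real.pi / h)) := fun c y => by
    refine Continuous.integrableOn_Icc ?_
    unfold mode; fun_prop
  have e : ∀ κ, hatSymbol h κ x * mode κ (j * h)
      = ((1 - Int.fract (x / h) : ℝ) : ℂ) * mode κ ((j - ⌊x / h⌋ : ℤ) * h)
        + ((Int.fract (x / h) : ℝ) : ℂ) * mode κ ((j - (⌊x / h⌋ + 1) : ℤ) * h) := fun κ => by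
    rw [hatSymbol, add_mul, mul_assoc, mul_assoc, ← mode_add, ← mode_add]
    push_cast; ring_nf
  simp only [e]
  rw [integral_add (hI _ _) (hI _ _), integral_const_mul, integral_const_mul,
    integral_mode_int hh, integral_mode_int hh, hat_eq hh]
  simp only [sub_eq_zero]
  split_ifs <;> push_cast <;> ring

/-- The Fourier symbol of the hat function projection of `ν`. -/
noncomputable def hatFourier (h : ℝ) (ν : Measure ℝ) (κ : ℝ) : ℂ := ∫ x, hatSymbol h κ x ∂ν

variable {ν : Measure ℝ} [IsFiniteMeasure ν]

lemma measurable_hatFourier (h : ℝ) (ν : Measure ℝ) [IsFiniteMeasure ν] :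
    Measurable (hatFourier h ν) :=
  ((measurable_hatSymbol h).stronglyMeasurable.integral_prod_right (ν := ν)).measurable

lemma integrable_hatSymbol (h κ : ℝ) : Integrable (hatSymbol h κ) ν :=
  (integrable_const (1 : ℝ)).mono'
    ((measurable_hatSymbol h).comp measurable_prodMk_left).aestronglyMeasurable
    (ae_of_all _ fun x => norm_hatSymbol_le_one h κ x)

lemma norm_hatFourier_le (h κ : ℝ) : ‖hatFourier h ν κ‖ ≤ ν.real Set.univ := by
  have := norm_integral_le_of_norm_le_const (μ := ν) (f := hatSymbol h κ) (C := 1)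
    (ae_of_all _ fun x => norm_hatSymbol_le_one h κ x)
  simpa [hatFourier] using this

lemma norm_hatFourier_sub_le {h : ℝ} (hh : 0 < h) (κ : ℝ) :
    ‖hatFourier h ν κ - fourierMeasure ν κ‖ ≤ 3 * (κ ^ 2 * h ^ 2) * ν.real Set.univ := by
  have hi : Integrable (fun x => mode κ (-x)) ν :=
    (integrable_const (1 : ℝ)).mono'
      ((continuous_mode κ).comp continuous_neg).aestronglyMeasurable
      (ae_of_all _ fun x => (norm_mode _ _).le)
  rw [hatFourier, fourierMeasure, ← integral_sub (integrable_hatSymbol h κ) hi]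
  exact norm_integral_le_of_norm_le_const
    (ae_of_all _ fun x => norm_hatSymbol_sub_mode_le hh κ x)

lemma hatProjection_eq_integral {h : ℝ} (hh : 0 < h) (j : ℤ) :
    (hatProjection h ν j : ℂ) = ((2 * Real.pi)⁻¹ : ℝ) *
      ∫ κ in Set.Icc (-(Real.pi / h)) (Real.pi / h), hatFourier h ν κ * mode κ (j * h) := by
  have e1 : ∀ κ, hatFourier h ν κ * mode κ (j * h)
      = ∫ x, hatSymbol h κ x * mode κ (j * h) ∂ν := fun κ => (integral_mul_const _ _).symm
  simp only [e1]
  rw [integral_integral_swap]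
  · simp only [integral_hatSymbol_mul_mode hh]
    rw [integral_complex_ofReal, integral_const_mul, integral_const_mul, ← Complex.ofReal_mul,
      hatProjection]
    congr 1
    have := Real.pi_pos.ne'
    field_simp
  · refine (integrable_const (1 : ℝ)).mono' ?_ (ae_of_all _ fun p => ?_)
    · have : Measurable fun p : ℝ × ℝ => mode p.1 (j * h) := by unfold mode; fun_prop
      exact ((measurable_hatSymbol h).mul this).aestronglyMeasurable
    · simp only [Function.uncurry]
      rw [norm_mul, norm_mode, mul_one]
      exact norm_hatSymbol_le_one _ _ _

lemma milsteinStep_ofReal (μ ρ k h z : ℝ) (v : ℤ → ℝ) (j : ℤ) :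
    ((milsteinStep μ ρ k h z v j : ℝ) : ℂ) = milsteinStep μ ρ k h z (fun i => (v i : ℂ)) j := by
  simp only [milsteinStep, Complex.real_smul, smul_eq_mul]
  push_cast
  ring

lemma milsteinStep_integral {α : Type*} [MeasurableSpace α] {m : Measure α} (μ ρ k h z : ℝ)
    {f : ℤ → α → ℂ} (hf : ∀ i, Integrable (f i) m) (j : ℤ) :
    milsteinStep μ ρ k h z (fun i => ∫ a, f i a ∂m) j
      = ∫ a, milsteinStep μ ρ k h z (fun i => f i a) j ∂m := by
  simp only [milsteinStep]
  have i1 := ((hf (j + 1)).sub (hf (j - 1))).smul ((μ * k + √(ρ * k) * z) / (2 * h))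
  have i2 := (((hf (j + 1)).sub ((hf j).smul (2 : ℝ))).add (hf (j - 1))).smul
    (((1 - ρ) * k + ρ * k * z ^ 2) / (2 * h ^ 2))
  have E := integral_add ((hf j).sub i1) i2
  have E1 := integral_sub (hf j) i1
  have E2 := integral_smul (μ := m) ((μ * k + √(ρ * k) * z) / (2 * h)) (f (j + 1) - f (j - 1))
  have E3 := integral_smul (μ := m) (((1 - ρ) * k + ρ * k * z ^ 2) / (2 * h ^ 2))
    (f (j + 1) - (2 : ℝ) • f j + f (j - 1))
  have E4 := integral_sub (hf (j + 1)) (hf (j - 1))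
  have E5 := integral_add ((hf (j + 1)).sub ((hf j).smul (2 : ℝ))) (hf (j - 1))
  have E6 := integral_sub (hf (j + 1)) ((hf j).smul (2 : ℝ))
  have E7 := integral_smul (μ := m) (2 : ℝ) (f j)
  simp only [Pi.sub_apply, Pi.add_apply, Pi.smul_apply] at E E1 E2 E3 E4 E5 E6 E7
  rw [E, E1, E2, E3, E4, E5, E6, E7]

lemma milsteinStep_const_mul (μ ρ k h z : ℝ) (c : ℂ) (v : ℤ → ℂ) (j : ℤ) :
    milsteinStep μ ρ k h z (fun i => c * v i) j = c * milsteinStep μ ρ k h z v j := by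
  simp only [milsteinStep, Complex.real_smul]; ring

lemma continuous_ampFactor_waveNumber (μ ρ k h z : ℝ) :
    Continuous fun κ => ampFactor μ ρ κ k h z := by
  unfold ampFactor coefA coefB coefC; fun_prop

/-- The grid solution as a superposition of discrete modes. -/
lemma gridSolution_eq_integral (μ ρ k h : ℝ) (Z : ℕ → ℝ) {v0 : ℤ → ℝ} {V : ℝ → ℂ} {K : Set ℝ}
    (hK : IsCompact K) (hV : IntegrableOn V K) {c : ℂ}
    (h0 : ∀ j : ℤ, (v0 j : ℂ) = c * ∫ κ in K, V κ * mode κ (j * h)) (n : ℕ) (j : ℤ) :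
    ((gridSolution μ ρ k h Z v0 n j : ℝ) : ℂ) = c * ∫ κ in K,
      V κ * (∏ i ∈ Finset.range n, ampFactor μ ρ κ k h (Z i)) * mode κ (j * h) := by
  induction n generalizing j with
  | zero => simpa [gridSolution] using h0 j
  | succ n ih =>
    have hA : Continuous fun κ => ∏ i ∈ Finset.range n, ampFactor μ ρ κ k h (Z i) :=
      continuous_finsetProd _ fun i _ => continuous_ampFactor_waveNumber μ ρ k h (Z i)
    have hm : ∀ i : ℤ, Continuous fun κ => mode κ (i * h) := fun i => by unfold mode; fun_prop
    have hint : ∀ i : ℤ, Integrable (fun κ => V κ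
        * (∏ i ∈ Finset.range n, ampFactor μ ρ κ k h (Z i)) * mode κ (i * h))
        (volume.restrict K) := fun i =>
      (hV.mul_continuousOn hA.continuousOn hK).mul_continuousOn (hm i).continuousOn hK
    rw [gridSolution, milsteinStep_ofReal]
    simp only [ih]
    rw [milsteinStep_const_mul, milsteinStep_integral _ _ _ _ _ hint]
    simp only [milsteinStep_mode]
    simp only [Finset.prod_range_succ, mul_assoc]

end SchemeFourier

/-! ### Gaussian-weighted estimates on the grid -/

section GridNorms

/-- The Fourier transform of the Gaussian weight. -/
lemma integral_gaussian_mul_mode {b : ℝ} (hb : 0 < b) (x : ℝ) :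
    ∫ κ : ℝ, (Real.exp (-b * κ ^ 2) : ℂ) * mode κ x
      = ((√(Real.pi / b) * Real.exp (-(1 / (4 * b)) * x ^ 2) : ℝ) : ℂ) := by
  have h := fourierIntegral_gaussian (b := (b : ℂ)) (by simpa using hb) (x : ℂ)
  have e : ∀ κ : ℝ, (Real.exp (-b * κ ^ 2) : ℂ) * mode κ x
      = Complex.exp (Complex.I * x * κ) * Complex.exp (-b * κ ^ 2) := fun κ => by
    rw [mode, mul_comm]; push_cast; ring_nf
  simp only [e]
  rw [h]
  have hπ : (0 : ℝ) ≤ Real.pi / b := by positivity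
  rw [Real.sqrt_eq_rpow, Complex.ofReal_mul, Complex.ofReal_cpow hπ]
  push_cast
  congr 2
  have : (b : ℂ) ≠ 0 := by exact_mod_cast hb.ne'
  field_simp

/-- Completing the square trades Gaussian for exponential decay, which makes the row sums of the
Gram matrix geometric. -/
lemma exp_neg_mul_sq_le {b : ℝ} (hb : 0 < b) (x : ℝ) :
    Real.exp (-(1 / (4 * b)) * x ^ 2) ≤ Real.exp b * Real.exp (-|x|) := by
  rw [← Real.exp_add, Real.exp_le_exp]
  have h1 : 0 ≤ (|x| - 2 * b) ^ 2 / (4 * b) := by positivity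
  have h2 : (|x| - 2 * b) ^ 2 / (4 * b) = 1 / (4 * b) * x ^ 2 - |x| + b := by
    rw [← sq_abs x]; field_simp; ring
  linarith

/-- A two-sided geometric series with ratio e^{-h}; 1-e^{-h} ≥ h/2 makes the bound uniform in h ≤ 1,
in the centre and in the finite set. -/
lemma sum_exp_neg_abs_le {h : ℝ} (hh : 0 < h) (hh1 : h ≤ 1) (s : Finset ℤ) (j : ℤ) :
    h * ∑ l ∈ s, Real.exp (-|((l - j : ℤ) : ℝ) * h|) ≤ 4 := by
  set r := Real.exp (-h) with hr
  have hr0 : 0 < r := Real.exp_pos _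
  have hr1 : r < 1 := by rw [hr, ← Real.exp_zero, Real.exp_lt_exp]; linarith
  have hgeo := hasSum_geometric_of_lt_one hr0.le hr1
  have hterm : ∀ m : ℤ, Real.exp (-|(m : ℝ) * h|) = r ^ m.natAbs := fun m => by
    rw [hr, ← Real.exp_nat_mul, abs_mul, abs_of_pos hh, Nat.cast_natAbs]; push_cast; ring_nf
  have hsum : HasSum (fun m : ℤ => r ^ m.natAbs) ((1 - r)⁻¹ + r * (1 - r)⁻¹) := by
    refine HasSum.of_nat_of_neg_add_one (by simpa using hgeo) ?_
    have e : (fun m : ℕ => r ^ (-((m : ℤ) + 1)).natAbs) = fun m => r * r ^ m := by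
      funext m
      rw [show (-((m : ℤ) + 1)).natAbs = m + 1 by omega, pow_succ']
    rw [e]
    exact hgeo.mul_left r
  have hle : ∑ l ∈ s, Real.exp (-|((l - j : ℤ) : ℝ) * h|) ≤ (1 - r)⁻¹ + r * (1 - r)⁻¹ := by
    simp only [hterm]
    have : HasSum (fun l : ℤ => r ^ (l - j).natAbs) ((1 - r)⁻¹ + r * (1 - r)⁻¹) :=
      (Equiv.subRight j).hasSum_iff (f := fun m : ℤ => r ^ m.natAbs) |>.2 hsum
    exact sum_le_hasSum s (fun _ _ => pow_nonneg hr0.le _) this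
  have h1 : h / 2 ≤ 1 - r := by
    have : r * (1 + h) ≤ 1 := by
      calc r * (1 + h) ≤ r * Real.exp h := by
            have := Real.add_one_le_exp h
            exact mul_le_mul_of_nonneg_left (by linarith) hr0.le
        _ = 1 := by rw [hr, ← Real.exp_add]; simp
    nlinarith
  have h2 : (1 - r)⁻¹ ≤ 2 / h := by
    rw [inv_le_comm₀ (by linarith) (by positivity), inv_div]; exact h1
  calc h * ∑ l ∈ s, Real.exp (-|((l - j : ℤ) : ℝ) * h|)
      ≤ h * ((1 - r)⁻¹ + r * (1 - r)⁻¹) := mul_le_mul_of_nonneg_left hle hh.le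
    _ ≤ h * (2 / h + 1 * (2 / h)) := by
        have : 0 ≤ (1 - r)⁻¹ := inv_nonneg.2 (by linarith)
        gcongr
    _ = 4 := by field_simp; norm_num

/-- A Schur test for the Gaussian Gram matrix of the discrete modes. -/
lemma integral_gaussian_mul_norm_sum_mode_sq_le {b h : ℝ} (hb : 0 < b) (hh : 0 < h) (hh1 : h ≤ 1)
    (s : Finset ℤ) (a : ℤ → ℂ) :
    h * ∫ κ : ℝ, Real.exp (-b * κ ^ 2) * ‖∑ j ∈ s, a j * mode κ (j * h)‖ ^ 2
      ≤ 4 * √(Real.pi / b) * Real.exp b * ∑ j ∈ s, ‖a j‖ ^ 2 := by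
  have hmc : ∀ κ x, (starRingEnd ℂ) (mode κ x) = mode κ (-x) := fun κ x => by
    rw [mode, mode, ← Complex.exp_conj, map_mul, Complex.conj_I, Complex.conj_ofReal]
    push_cast; ring_nf
  have hmi : ∀ x : ℝ, Integrable fun κ : ℝ => (Real.exp (-b * κ ^ 2) : ℂ) * mode κ x := fun x => by
    refine (integrable_exp_neg_mul_sq hb).mono' ?_ (ae_of_all _ fun κ => ?_)
    · have : Continuous fun κ : ℝ => (Real.exp (-b * κ ^ 2) : ℂ) * mode κ x := by
        unfold mode; fun_prop
      exact this.aestronglyMeasurable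
    · rw [norm_mul, norm_mode, mul_one, Complex.norm_real, Real.norm_of_nonneg (Real.exp_pos _).le]
  -- Expanding the square leaves a Gram matrix whose entries, after integration, depend only on
  -- (j-l)h and are Gaussian in it.
  have e : ∀ κ : ℝ, ((Real.exp (-b * κ ^ 2) * ‖∑ j ∈ s, a j * mode κ (j * h)‖ ^ 2 : ℝ) : ℂ)
      = ∑ j ∈ s, ∑ l ∈ s, a j * (starRingEnd ℂ) (a l)
        * ((Real.exp (-b * κ ^ 2) : ℂ) * mode κ (((j - l : ℤ) : ℝ) * h)) := fun κ => by
    rw [Complex.ofReal_mul, Complex.ofReal_pow, ← Complex.mul_conj', map_sum,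
      Finset.sum_mul_sum, Finset.mul_sum]
    refine Finset.sum_congr rfl fun j _ => ?_
    rw [Finset.mul_sum]
    refine Finset.sum_congr rfl fun l _ => ?_
    rw [map_mul, hmc, Int.cast_sub, sub_mul, sub_eq_add_neg, mode_add]
    ring
  have hint : ((∫ κ : ℝ, Real.exp (-b * κ ^ 2) * ‖∑ j ∈ s, a j * mode κ (j * h)‖ ^ 2 : ℝ) : ℂ)
      = ∑ j ∈ s, ∑ l ∈ s, a j * (starRingEnd ℂ) (a l) * ((√(Real.pi / b)
        * Real.exp (-(1 / (4 * b)) * (((j - l : ℤ) : ℝ) * h) ^ 2) : ℝ) : ℂ) := by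
    rw [← integral_complex_ofReal]
    simp only [e]
    rw [integral_finsetSum _ fun j _ => integrable_finsetSum _ fun l _ => (hmi _).const_mul _]
    refine Finset.sum_congr rfl fun j _ => ?_
    rw [integral_finsetSum _ fun l _ => (hmi _).const_mul _]
    refine Finset.sum_congr rfl fun l _ => ?_
    rw [integral_const_mul, integral_gaussian_mul_mode hb]
  set A : ℝ := √(Real.pi / b) * Real.exp b with hA
  have hA0 : 0 ≤ A := by positivity
  have hI0 : 0 ≤ ∫ κ : ℝ, Real.exp (-b * κ ^ 2) * ‖∑ j ∈ s, a j * mode κ (j * h)‖ ^ 2 :=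
    integral_nonneg fun κ => by positivity
  set g : ℤ → ℝ := fun m => Real.exp (-|(m : ℝ) * h|) with hg
  have hgs : ∀ m, g (-m) = g m := fun m => by simp [hg]
  -- Schur's test: the product of coefficients is split into half squares, so that only row sums of
  -- the kernel matter.
  have hbound : ∫ κ : ℝ, Real.exp (-b * κ ^ 2) * ‖∑ j ∈ s, a j * mode κ (j * h)‖ ^ 2
      ≤ ∑ j ∈ s, ∑ l ∈ s, (‖a j‖ ^ 2 / 2 + ‖a l‖ ^ 2 / 2) * (A * g (j - l)) := by
    rw [← abs_of_nonneg hI0, ← Real.norm_eq_abs, ← Complex.norm_real, hint]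
    refine (norm_sum_le _ _).trans (Finset.sum_le_sum fun j _ => (norm_sum_le _ _).trans
      (Finset.sum_le_sum fun l _ => ?_))
    rw [norm_mul, norm_mul, RCLike.norm_conj, Complex.norm_real, Real.norm_of_nonneg (by positivity)]
    refine mul_le_mul ?_ ?_ (by positivity) (by positivity)
    · nlinarith [sq_nonneg (‖a j‖ - ‖a l‖)]
    · rw [hA, mul_assoc]
      exact mul_le_mul_of_nonneg_left (exp_neg_mul_sq_le hb _) (Real.sqrt_nonneg _)
  have hsplit : ∑ j ∈ s, ∑ l ∈ s, (‖a j‖ ^ 2 / 2 + ‖a l‖ ^ 2 / 2) * (A * g (j - l))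
      = ∑ j ∈ s, ‖a j‖ ^ 2 * (A * ∑ l ∈ s, g (l - j)) := by
    have s1 : ∑ j ∈ s, ∑ l ∈ s, ‖a l‖ ^ 2 / 2 * (A * g (j - l))
        = ∑ j ∈ s, ∑ l ∈ s, ‖a j‖ ^ 2 / 2 * (A * g (l - j)) := Finset.sum_comm
    simp only [add_mul, Finset.sum_add_distrib]
    rw [s1, ← Finset.sum_add_distrib]
    refine Finset.sum_congr rfl fun j _ => ?_
    rw [← Finset.sum_add_distrib, Finset.mul_sum, Finset.mul_sum]
    refine Finset.sum_congr rfl fun l _ => ?_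
    rw [← hgs (j - l), neg_sub]; ring
  calc _ ≤ h * ∑ j ∈ s, ‖a j‖ ^ 2 * (A * ∑ l ∈ s, g (l - j)) :=
        mul_le_mul_of_nonneg_left (hbound.trans_eq hsplit) hh.le
    _ = ∑ j ∈ s, ‖a j‖ ^ 2 * (A * (h * ∑ l ∈ s, g (l - j))) := by
        rw [Finset.mul_sum]; exact Finset.sum_congr rfl fun j _ => by ring
    _ ≤ ∑ j ∈ s, ‖a j‖ ^ 2 * (A * 4) := by
        refine Finset.sum_le_sum fun j _ => mul_le_mul_of_nonneg_left
          (mul_le_mul_of_nonneg_left (sum_exp_neg_abs_le hh hh1 s j) hA0) (sq_nonneg _)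
    _ = _ := by rw [← Finset.sum_mul, hA]; ring

/-- Cauchy–Schwarz with a Gaussian weight. -/
lemma enorm_integral_mul_sq_le {b : ℝ} {F G : ℝ → ℂ} (hF : AEStronglyMeasurable F)
    (hG : AEStronglyMeasurable G) :
    ‖∫ κ, F κ * G κ‖ₑ ^ 2 ≤ (∫⁻ κ, ENNReal.ofReal (Real.exp (b * κ ^ 2)) * ‖F κ‖ₑ ^ 2)
      * ∫⁻ κ, ENNReal.ofReal (Real.exp (-b * κ ^ 2)) * ‖G κ‖ₑ ^ 2 := by
  set w : ℝ → ℝ≥0∞ := fun κ => ENNReal.ofReal (Real.exp (b * κ ^ 2 / 2)) with hw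
  set w' : ℝ → ℝ≥0∞ := fun κ => ENNReal.ofReal (Real.exp (-(b * κ ^ 2 / 2))) with hw'
  have hww : ∀ κ, w κ * w' κ = 1 := fun κ => by
    rw [hw, hw', ← ENNReal.ofReal_mul (Real.exp_pos _).le, ← Real.exp_add]; simp
  have hwm : AEMeasurable w := by fun_prop
  have hwm' : AEMeasurable w' := by fun_prop
  have h1 : ‖∫ κ, F κ * G κ‖ₑ ≤ ∫⁻ κ, ((fun κ => w κ * ‖F κ‖ₑ) * fun κ => w' κ * ‖G κ‖ₑ) κ := by
    refine (enorm_integral_le_lintegral_enorm _).trans (lintegral_mono fun κ => ?_)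
    simp only [Pi.mul_apply]
    rw [enorm_mul, show w κ * ‖F κ‖ₑ * (w' κ * ‖G κ‖ₑ) = w κ * w' κ * (‖F κ‖ₑ * ‖G κ‖ₑ) by ring, hww,
      one_mul]
  have h2 := h1.trans (ENNReal.lintegral_mul_le_Lp_mul_Lq volume Real.HolderConjugate.two_two
    (hwm.mul hF.enorm) (hwm'.mul hG.enorm))
  have h3 := pow_le_pow_left' h2 2
  refine h3.trans_eq ?_
  have hs : ∀ x : ℝ≥0∞, (x ^ (1 / 2 : ℝ)) ^ 2 = x := fun x => by
    rw [← ENNReal.rpow_natCast, ← ENNReal.rpow_mul]; norm_num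
  rw [mul_pow, hs, hs]
  congr 1
  · refine lintegral_congr fun κ => ?_
    rw [ENNReal.rpow_two, mul_pow, hw, ← ENNReal.ofReal_pow (Real.exp_pos _).le, ← Real.exp_nat_mul]
    congr 3; push_cast; ring
  · refine lintegral_congr fun κ => ?_
    rw [ENNReal.rpow_two, mul_pow, hw', ← ENNReal.ofReal_pow (Real.exp_pos _).le,
      ← Real.exp_nat_mul]
    congr 3; push_cast; ring

end GridNorms

/-! ### Inverse transforms on the grid and the error symbol -/

section GridError

lemma lintegral_gaussian {b : ℝ} (hb : 0 < b) :
    ∫⁻ κ : ℝ, ENNReal.ofReal (Real.exp (-b * κ ^ 2)) = ENNReal.ofReal √(Real.pi / b) := by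
  rw [← ofReal_integral_eq_lintegral_ofReal (integrable_exp_neg_mul_sq hb)
    (ae_of_all _ fun κ => (Real.exp_pos _).le), integral_gaussian]

lemma enorm_two_pi_inv_mul_le (z : ℂ) : ‖(((2 * Real.pi)⁻¹ : ℝ) : ℂ) * z‖ₑ ≤ ‖z‖ₑ := by
  rw [enorm_le_iff_norm_le, norm_mul, Complex.norm_real,
    Real.norm_of_nonneg (by have := Real.pi_pos; positivity)]
  refine mul_le_of_le_one_left (norm_nonneg _) (inv_le_one_of_one_le₀ ?_)
  linarith [Real.two_le_pi]

/-- Weighted Cauchy–Schwarz against a mode of modulus one; the bound does not depend on x and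
therefore controls the supremum. -/
lemma enorm_fourierInv_sq_le {b : ℝ} (hb : 0 < b) {F : ℝ → ℂ} (hF : Integrable F) (x : ℝ) :
    ‖(((2 * Real.pi)⁻¹ : ℝ) : ℂ) * ∫ κ, F κ * mode κ x‖ₑ ^ 2
      ≤ ENNReal.ofReal √(Real.pi / b)
        * ∫⁻ κ, ENNReal.ofReal (Real.exp (b * κ ^ 2)) * ‖F κ‖ₑ ^ 2 := by
  have hm : Continuous fun κ => mode κ x := by unfold mode; fun_prop
  have hm1 : ∀ κ, ‖mode κ x‖ₑ = 1 := fun κ => by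
    rw [← ofReal_norm, norm_mode, ENNReal.ofReal_one]
  have h := enorm_integral_mul_sq_le (b := b) hF.1 hm.aestronglyMeasurable
  simp only [hm1, one_pow, mul_one] at h
  rw [lintegral_gaussian hb, mul_comm] at h
  exact (pow_le_pow_left' (enorm_two_pi_inv_mul_le _) 2).trans h

/-- Duality: X = Σ|fⱼ|² is the pairing of F with the trigonometric sum G having coefficients conj
fⱼ. Weighted Cauchy–Schwarz and the Schur test bound X² by a constant times X/h, and X cancels. F
lives on the whole line, so no periodisation or aliasing argument is needed. -/
lemma tsum_enorm_fourierInv_sq_le {b h : ℝ} (hb : 0 < b) (hh : 0 < h) (hh1 : h ≤ 1) {F : ℝ → ℂ}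
    (hF : Integrable F) :
    ∑' j : ℤ, ENNReal.ofReal h
        * ‖(((2 * Real.pi)⁻¹ : ℝ) : ℂ) * ∫ κ, F κ * mode κ (j * h)‖ₑ ^ 2
      ≤ ENNReal.ofReal (4 * √(Real.pi / b) * Real.exp b)
        * ∫⁻ κ, ENNReal.ofReal (Real.exp (b * κ ^ 2)) * ‖F κ‖ₑ ^ 2 := by
  set S := ∫⁻ κ, ENNReal.ofReal (Real.exp (b * κ ^ 2)) * ‖F κ‖ₑ ^ 2 with hS
  set c : ℂ := (((2 * Real.pi)⁻¹ : ℝ) : ℂ) with hc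
  set f : ℤ → ℂ := fun j => c * ∫ κ, F κ * mode κ (j * h) with hf
  set B := 4 * √(Real.pi / b) * Real.exp b with hB
  have hm : ∀ j : ℤ, Continuous fun κ => mode κ (j * h) := fun j => by unfold mode; fun_prop
  rw [ENNReal.tsum_eq_iSup_sum]
  refine iSup_le fun s => ?_
  set X : ℝ := ∑ j ∈ s, ‖f j‖ ^ 2 with hX
  have hX0 : 0 ≤ X := Finset.sum_nonneg fun _ _ => sq_nonneg _
  set G : ℝ → ℂ := fun κ => ∑ j ∈ s, (starRingEnd ℂ) (f j) * mode κ (j * h) with hG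
  have hGc : Continuous G := continuous_finsetSum _ fun j _ => continuous_const.mul (hm j)
  have hFm : ∀ j : ℤ, Integrable fun κ => F κ * mode κ (j * h) := fun j => by
    have := hF.bdd_mul (hm j).aestronglyMeasurable (c := 1)
      (ae_of_all _ fun κ => (norm_mode _ _).le)
    simpa only [mul_comm] using this
  have hXe : (X : ℂ) = c * ∫ κ, F κ * G κ := by
    have e1 : ∀ κ, F κ * G κ = ∑ j ∈ s, (starRingEnd ℂ) (f j) * (F κ * mode κ (j * h)) := fun κ => by
      rw [hG, Finset.mul_sum]; exact Finset.sum_congr rfl fun j _ => by ring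
    simp only [e1]
    rw [integral_finsetSum _ fun j _ => (hFm j).const_mul _, Finset.mul_sum, hX]
    push_cast
    refine Finset.sum_congr rfl fun j _ => ?_
    rw [integral_const_mul, ← Complex.conj_mul', mul_left_comm]
  have hsum : ∑ j ∈ s, ENNReal.ofReal h * ‖f j‖ₑ ^ 2 = ENNReal.ofReal h * ENNReal.ofReal X := by
    rw [← Finset.mul_sum, hX, ENNReal.ofReal_sum_of_nonneg fun _ _ => sq_nonneg _]
    congr 1
    refine Finset.sum_congr rfl fun j _ => ?_
    rw [ENNReal.ofReal_pow (norm_nonneg _), ofReal_norm]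
  rw [hsum]
  have hGi : ENNReal.ofReal h * ∫⁻ κ, ENNReal.ofReal (Real.exp (-b * κ ^ 2)) * ‖G κ‖ₑ ^ 2
      ≤ ENNReal.ofReal B * ENNReal.ofReal X := by
    obtain ⟨K, hK⟩ : ∃ K : ℝ, ∀ κ, ‖G κ‖ ≤ K := ⟨∑ j ∈ s, ‖f j‖, fun κ => by
      refine (norm_sum_le _ _).trans_eq (Finset.sum_congr rfl fun j _ => ?_)
      rw [norm_mul, norm_mode, mul_one, RCLike.norm_conj]⟩
    have hi : Integrable fun κ => Real.exp (-b * κ ^ 2) * ‖G κ‖ ^ 2 := by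
      refine ((integrable_exp_neg_mul_sq hb).mul_const (K ^ 2)).mono' ?_ (ae_of_all _ fun κ => ?_)
      · exact Continuous.aestronglyMeasurable (by fun_prop)
      · rw [Real.norm_of_nonneg (by positivity)]
        exact mul_le_mul_of_nonneg_left (pow_le_pow_left₀ (norm_nonneg _) (hK κ) 2)
          (Real.exp_pos _).le
    have e : ∀ κ, ENNReal.ofReal (Real.exp (-b * κ ^ 2)) * ‖G κ‖ₑ ^ 2
        = ENNReal.ofReal (Real.exp (-b * κ ^ 2) * ‖G κ‖ ^ 2) := fun κ => by
      rw [ENNReal.ofReal_mul (Real.exp_pos _).le, ENNReal.ofReal_pow (norm_nonneg _), ofReal_norm]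
    simp only [e]
    rw [← ofReal_integral_eq_lintegral_ofReal hi (ae_of_all _ fun κ => by positivity),
      ← ENNReal.ofReal_mul hh.le, ← ENNReal.ofReal_mul (by positivity)]
    refine ENNReal.ofReal_le_ofReal ?_
    have := integral_gaussian_mul_norm_sum_mode_sq_le hb hh hh1 s fun j => (starRingEnd ℂ) (f j)
    simpa only [RCLike.norm_conj] using this
  have hXX : ENNReal.ofReal X ^ 2
      ≤ S * ∫⁻ κ, ENNReal.ofReal (Real.exp (-b * κ ^ 2)) * ‖G κ‖ₑ ^ 2 := by
    have : ENNReal.ofReal X = ‖c * ∫ κ, F κ * G κ‖ₑ := by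
      rw [← hXe, ← ofReal_norm, Complex.norm_real, Real.norm_of_nonneg hX0]
    rw [this]
    exact (pow_le_pow_left' (enorm_two_pi_inv_mul_le _) 2).trans
      (enorm_integral_mul_sq_le hF.1 hGc.aestronglyMeasurable)
  -- Restricting to a finite set of nodes makes X finite, so it can be cancelled once it is nonzero.
  rcases hX0.eq_or_lt with h0 | h0
  · rw [← h0]; simp
  have hXp : ENNReal.ofReal X ≠ 0 := (ENNReal.ofReal_pos.2 h0).ne'
  have key : ENNReal.ofReal h * ENNReal.ofReal X * ENNReal.ofReal X
      ≤ ENNReal.ofReal B * S * ENNReal.ofReal X :=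
    calc ENNReal.ofReal h * ENNReal.ofReal X * ENNReal.ofReal X
        = ENNReal.ofReal h * ENNReal.ofReal X ^ 2 := by ring
      _ ≤ ENNReal.ofReal h * (S * ∫⁻ κ, ENNReal.ofReal (Real.exp (-b * κ ^ 2)) * ‖G κ‖ₑ ^ 2) := by
          gcongr
      _ = S * (ENNReal.ofReal h * ∫⁻ κ, ENNReal.ofReal (Real.exp (-b * κ ^ 2)) * ‖G κ‖ₑ ^ 2) := by
          ring
      _ ≤ S * (ENNReal.ofReal B * ENNReal.ofReal X) := by gcongr
      _ = _ := by ring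
  exact (ENNReal.mul_le_mul_iff_left hXp ENNReal.ofReal_ne_top).1 key

lemma enorm_add_sq_le (x y : ℂ) : ‖x + y‖ₑ ^ 2 ≤ 2 * ‖x‖ₑ ^ 2 + 2 * ‖y‖ₑ ^ 2 := by
  have h : ‖x + y‖ ^ 2 ≤ 2 * ‖x‖ ^ 2 + 2 * ‖y‖ ^ 2 := by
    have := pow_le_pow_left₀ (norm_nonneg _) (norm_add_le x y) 2
    nlinarith [sq_nonneg (‖x‖ - ‖y‖)]
  have h' := ENNReal.ofReal_le_ofReal h
  rw [ENNReal.ofReal_add (by positivity) (by positivity), ENNReal.ofReal_mul (by norm_num),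
    ENNReal.ofReal_mul (by norm_num), ENNReal.ofReal_pow (norm_nonneg _),
    ENNReal.ofReal_pow (norm_nonneg _), ENNReal.ofReal_pow (norm_nonneg _), ofReal_norm,
    ofReal_norm, ofReal_norm] at h'
  simpa using h'

lemma enorm_sq_le_ofReal {x : ℂ} {r : ℝ} (h : ‖x‖ ^ 2 ≤ r) : ‖x‖ₑ ^ 2 ≤ ENNReal.ofReal r := by
  rw [← ofReal_norm, ← ENNReal.ofReal_pow (norm_nonneg _)]
  exact ENNReal.ofReal_le_ofReal h

/-- The Fourier symbol of the difference between the grid solution and the exact solution. -/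
noncomputable def errorSymbol (μ ρ : ℝ) (ν : Measure ℝ) (k h : ℝ) (n : ℕ) (z : ℕ → ℝ) (κ : ℝ) : ℂ :=
  (Set.Icc (-(Real.pi / h)) (Real.pi / h)).indicator
      (fun κ => hatFourier h ν κ * ∏ i ∈ Finset.range n, ampFactor μ ρ κ k h (z i)) κ
    - fourierMeasure ν κ * ∏ i ∈ Finset.range n, Complex.exp (exactExponent μ ρ κ k (√k * z i))

variable {ν : Measure ℝ} [IsFiniteMeasure ν]

lemma measurable_errorSymbol (μ ρ k h : ℝ) (n : ℕ) :
    Measurable fun p : (ℕ → ℝ) × ℝ => errorSymbol μ ρ ν k h n p.1 p.2 := by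
  have h1 : Measurable fun p : (ℕ → ℝ) × ℝ => hatFourier h ν p.2
      * ∏ i ∈ Finset.range n, ampFactor μ ρ p.2 k h (p.1 i) := by
    refine ((measurable_hatFourier h ν).comp measurable_snd).mul ?_
    refine Continuous.measurable (continuous_finsetProd _ fun i _ => ?_)
    unfold ampFactor coefA coefB coefC; fun_prop
  have h2 : Measurable fun p : (ℕ → ℝ) × ℝ => fourierMeasure ν p.2
      * ∏ i ∈ Finset.range n, Complex.exp (exactExponent μ ρ p.2 k (√k * p.1 i)) := by
    refine ((measurable_fourierMeasure ν).comp measurable_snd).mul ?_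
    refine Continuous.measurable (continuous_finsetProd _ fun i _ => ?_)
    unfold exactExponent; fun_prop
  exact (h1.indicator (measurable_snd measurableSet_Icc)).sub h2

lemma norm_prod_exp_sq_le {ρ T₀ c k : ℝ} (hc : c ≤ 1 - ρ) (hc0 : 0 < c) (hT₀ : 0 < T₀) (μ κ : ℝ)
    {n : ℕ} (hn : T₀ ≤ n * k) (z : ℕ → ℝ) :
    ‖∏ i ∈ Finset.range n, Complex.exp (exactExponent μ ρ κ k (√k * z i))‖ ^ 2
      ≤ Real.exp (-(c * T₀ * κ ^ 2)) := by
  rw [prod_exp_exactExponent, norm_exp_exactExponent_eq_gaussian, ← Real.exp_nat_mul,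
    Real.exp_le_exp]
  have h1 : c * T₀ ≤ (1 - ρ) * (n * k) := mul_le_mul hc hn hT₀.le (hc0.le.trans hc)
  have h2 := mul_le_mul_of_nonneg_right h1 (sq_nonneg κ)
  push_cast
  linarith

/-- For resolved wave numbers the symbol splits into the amplification error times the projected
data, plus the projection error O(κ²h²) times the exact factor. Beyond π/h only the exact factor is
left, and 1 ≤ κ⁴h⁴ turns its Gaussian size into the required order. -/
lemma lintegral_errorSymbol_sq_le {Ω : Type*} [MeasurableSpace Ω] {P : Measure Ω}
    [IsProbabilityMeasure P] {Z : ℕ → Ω → ℝ} {μ ρ T₀ c C k h : ℝ} {n : ℕ} {κ : ℝ}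
    (hc : c ≤ 1 - ρ) (hc0 : 0 < c) (hC : 0 ≤ C) (hT₀ : 0 < T₀) (hk : 0 < k) (hh : 0 < h)
    (hn : T₀ ≤ n * k)
    (hmode : |κ| * h ≤ Real.pi → ∫⁻ ω, ‖∏ i ∈ Finset.range n, ampFactor μ ρ κ k h (Z i ω)
        - ∏ i ∈ Finset.range n, Complex.exp (exactExponent μ ρ κ k (√k * Z i ω))‖ₑ ^ 2 ∂P
      ≤ ENNReal.ofReal (C * (k + h ^ 2) ^ 2
        * (waveScale μ κ ^ 16 * Real.exp (-(c * T₀ * κ ^ 2))))) :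
    ∫⁻ ω, ‖errorSymbol μ ρ ν k h n (fun i => Z i ω) κ‖ₑ ^ 2 ∂P
      ≤ ENNReal.ofReal ((2 * C + 18) * ν.real Set.univ ^ 2 * (k + h ^ 2) ^ 2
        * (waveScale μ κ ^ 16 * Real.exp (-(c * T₀ * κ ^ 2)))) := by
  set N := ν.real Set.univ with hN
  have hN0 : 0 ≤ N := measureReal_nonneg
  set E := Real.exp (-(c * T₀ * κ ^ 2)) with hE
  have hE0 : 0 < E := Real.exp_pos _
  set W := waveScale μ κ ^ 16 with hW
  have hW1 : 1 ≤ waveScale μ κ := one_le_waveScale μ κ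
  have hκW : κ ^ 4 ≤ W := by
    calc κ ^ 4 = (κ ^ 2) ^ 2 := by ring
      _ ≤ waveScale μ κ ^ 2 := pow_le_pow_left₀ (sq_nonneg κ) (sq_le_waveScale μ κ) 2
      _ ≤ W := pow_le_pow_right₀ hW1 (by norm_num)
  have hW0 : 0 ≤ W := by positivity
  have hh4 : h ^ 4 ≤ (k + h ^ 2) ^ 2 := by nlinarith [sq_nonneg h]
  have hκh : κ ^ 4 * h ^ 4 ≤ (k + h ^ 2) ^ 2 * W := by
    rw [mul_comm]; exact mul_le_mul hh4 hκW (by positivity) (by positivity)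
  have hX : ∀ ω, ‖∏ i ∈ Finset.range n, Complex.exp (exactExponent μ ρ κ k (√k * Z i ω))‖ ^ 2 ≤ E :=
    fun ω => norm_prod_exp_sq_le hc hc0 hT₀ μ κ hn fun i => Z i ω
  by_cases hκ : κ ∈ Set.Icc (-(Real.pi / h)) (Real.pi / h)
  · have hκ' : |κ| * h ≤ Real.pi := by
      rw [← le_div_iff₀ hh]; exact abs_le.2 hκ
    have hpt : ∀ ω, ‖errorSymbol μ ρ ν k h n (fun i => Z i ω) κ‖ₑ ^ 2
        ≤ ENNReal.ofReal (2 * N ^ 2) * ‖∏ i ∈ Finset.range n, ampFactor μ ρ κ k h (Z i ω)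
          - ∏ i ∈ Finset.range n, Complex.exp (exactExponent μ ρ κ k (√k * Z i ω))‖ₑ ^ 2
          + ENNReal.ofReal (18 * N ^ 2 * ((k + h ^ 2) ^ 2 * W * E)) := fun ω => by
      rw [errorSymbol, Set.indicator_of_mem hκ]
      set A := ∏ i ∈ Finset.range n, ampFactor μ ρ κ k h (Z i ω)
      set X := ∏ i ∈ Finset.range n, Complex.exp (exactExponent μ ρ κ k (√k * Z i ω)) with hXd
      have e : hatFourier h ν κ * A - fourierMeasure ν κ * X = hatFourier h ν κ * (A - X)
          + (hatFourier h ν κ - fourierMeasure ν κ) * X := by ring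
      rw [e]
      refine (enorm_add_sq_le _ _).trans (add_le_add ?_ ?_)
      · rw [enorm_mul, mul_pow, ← mul_assoc]
        refine mul_le_mul_left ?_ _
        rw [ENNReal.ofReal_mul (by norm_num)]
        have := enorm_sq_le_ofReal (pow_le_pow_left₀ (norm_nonneg _)
          (norm_hatFourier_le (ν := ν) h κ) 2)
        rw [ENNReal.ofReal_ofNat]
        exact mul_le_mul_right this 2
      · have hb : ‖(hatFourier h ν κ - fourierMeasure ν κ) * X‖ ^ 2
            ≤ 9 * N ^ 2 * ((k + h ^ 2) ^ 2 * W * E) := by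
          rw [norm_mul, mul_pow]
          calc ‖hatFourier h ν κ - fourierMeasure ν κ‖ ^ 2 * ‖X‖ ^ 2
              ≤ (3 * (κ ^ 2 * h ^ 2) * N) ^ 2 * E :=
                mul_le_mul (pow_le_pow_left₀ (norm_nonneg _) (norm_hatFourier_sub_le hh κ) 2)
                  (hX ω) (sq_nonneg _) (sq_nonneg _)
            _ = 9 * N ^ 2 * (κ ^ 4 * h ^ 4 * E) := by ring
            _ ≤ _ := by gcongr
        have h2 := mul_le_mul_right (enorm_sq_le_ofReal hb) 2
        refine h2.trans_eq ?_
        rw [← ENNReal.ofReal_ofNat 2, ← ENNReal.ofReal_mul (by norm_num)]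
        congr 1; ring
    refine (lintegral_mono hpt).trans ?_
    rw [lintegral_add_right _ measurable_const, lintegral_const_mul' _ _ ENNReal.ofReal_ne_top,
      lintegral_const, measure_univ, mul_one]
    refine (add_le_add_left (mul_le_mul_right (hmode hκ') _) _).trans ?_
    rw [← ENNReal.ofReal_mul (by positivity), ← ENNReal.ofReal_add (by positivity) (by positivity)]
    refine ENNReal.ofReal_le_ofReal (le_of_eq ?_)
    ring
  · have hκ' : 1 ≤ κ ^ 4 * h ^ 4 := by
      have h1 : Real.pi < |κ| * h := by
        rw [← div_lt_iff₀ hh]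
        by_contra hcon
        exact hκ (abs_le.1 (not_lt.1 hcon))
      have h2 : 1 ≤ |κ| * h := by linarith [Real.two_le_pi]
      calc (1 : ℝ) ≤ (|κ| * h) ^ 4 := one_le_pow₀ h2
        _ = κ ^ 4 * h ^ 4 := by rw [mul_pow, Even.pow_abs (by decide)]
    have hpt : ∀ ω, ‖errorSymbol μ ρ ν k h n (fun i => Z i ω) κ‖ₑ ^ 2
        ≤ ENNReal.ofReal (N ^ 2 * ((k + h ^ 2) ^ 2 * W * E)) := fun ω => by
      rw [errorSymbol, Set.indicator_of_notMem hκ, zero_sub]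
      refine enorm_sq_le_ofReal ?_
      rw [norm_neg, norm_mul, mul_pow]
      calc _ ≤ N ^ 2 * E := mul_le_mul (pow_le_pow_left₀ (norm_nonneg _)
            (norm_fourierMeasure_le ν κ) 2) (hX ω) (sq_nonneg _) (sq_nonneg _)
        _ = N ^ 2 * (1 * E) := by ring
        _ ≤ _ := by gcongr; exact hκ'.trans hκh
    refine (lintegral_mono hpt).trans ?_
    rw [lintegral_const, measure_univ, mul_one]
    refine ENNReal.ofReal_le_ofReal ?_
    have : 0 ≤ N ^ 2 * ((k + h ^ 2) ^ 2 * W * E) := by positivity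
    nlinarith [mul_nonneg hC this]

/-- Polynomial growth in the wave number is absorbed by a Gaussian. -/
lemma waveScale_pow_le (μ κ : ℝ) {a : ℝ} (ha : 0 < a) :
    waveScale μ κ ^ 16 ≤ (1 + |μ|) ^ 16 * (Nat.factorial 16 * Real.exp a / a ^ 16)
      * Real.exp (a * κ ^ 2) := by
  have h := Real.pow_div_factorial_le_exp (a * (1 + κ ^ 2)) (by positivity) 16
  rw [div_le_iff₀ (by positivity), mul_pow, mul_add, mul_one, Real.exp_add] at h
  rw [waveScale, mul_pow, mul_assoc]
  refine mul_le_mul_of_nonneg_left ?_ (by positivity)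
  rw [div_mul_eq_mul_div, le_div_iff₀ (by positivity)]
  linarith

/-- The decay e^{-4aκ²} is shared out: one a pays for the weight, one absorbs the polynomial
`waveScale` factor, and e^{-2aκ²} remains integrable. -/
lemma lintegral_lintegral_errorSymbol_sq_le {Ω : Type*} [MeasurableSpace Ω] {P : Measure Ω}
    [IsProbabilityMeasure P] {Z : ℕ → Ω → ℝ} (hZ : ∀ i, AEMeasurable (Z i) P)
    {μ ρ a C k h : ℝ} {n : ℕ} (ha : 0 < a) (hC : 0 ≤ C)
    (hsym : ∀ κ, ∫⁻ ω, ‖errorSymbol μ ρ ν k h n (fun i => Z i ω) κ‖ₑ ^ 2 ∂P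
      ≤ ENNReal.ofReal (C * (waveScale μ κ ^ 16 * Real.exp (-(4 * a * κ ^ 2))))) :
    ∫⁻ ω, (∫⁻ κ, ENNReal.ofReal (Real.exp (a * κ ^ 2))
        * ‖errorSymbol μ ρ ν k h n (fun i => Z i ω) κ‖ₑ ^ 2) ∂P
      ≤ ENNReal.ofReal (C * ((1 + |μ|) ^ 16 * (Nat.factorial 16 * Real.exp a / a ^ 16)
        * √(Real.pi / (2 * a)))) := by
  have hm : AEMeasurable (fun p : Ω × ℝ => ENNReal.ofReal (Real.exp (a * p.2 ^ 2))
      * ‖errorSymbol μ ρ ν k h n (fun i => Z i p.1) p.2‖ₑ ^ 2) (P.prod volume) := by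
    have h1 : AEMeasurable (fun ω => fun i => Z i ω) P := aemeasurable_pi_lambda _ hZ
    have h2 : AEMeasurable (fun p : Ω × ℝ => ((fun i => Z i p.1 : ℕ → ℝ), p.2)) (P.prod volume) :=
      h1.comp_fst.prodMk measurable_snd.aemeasurable
    have h3 := (measurable_errorSymbol (ν := ν) μ ρ k h n).comp_aemeasurable h2
    have h4 : Measurable fun p : Ω × ℝ => ENNReal.ofReal (Real.exp (a * p.2 ^ 2)) := by fun_prop
    exact h4.aemeasurable.mul (h3.enorm.pow_const 2)
  rw [lintegral_lintegral_swap hm]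
  set K := (1 + |μ|) ^ 16 * (Nat.factorial 16 * Real.exp a / a ^ 16) with hK
  have hK0 : 0 ≤ K := by positivity
  have hpt : ∀ κ, ∫⁻ ω, ENNReal.ofReal (Real.exp (a * κ ^ 2))
        * ‖errorSymbol μ ρ ν k h n (fun i => Z i ω) κ‖ₑ ^ 2 ∂P
      ≤ ENNReal.ofReal (C * K) * ENNReal.ofReal (Real.exp (-(2 * a) * κ ^ 2)) := fun κ => by
    rw [lintegral_const_mul' _ _ ENNReal.ofReal_ne_top]
    refine (mul_le_mul_right (hsym κ) _).trans ?_
    rw [← ENNReal.ofReal_mul (Real.exp_pos _).le, ← ENNReal.ofReal_mul (by positivity)]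
    refine ENNReal.ofReal_le_ofReal ?_
    have e : Real.exp (-(2 * a) * κ ^ 2)
        = Real.exp (a * κ ^ 2) * (Real.exp (a * κ ^ 2) * Real.exp (-(4 * a * κ ^ 2))) := by
      rw [← Real.exp_add, ← Real.exp_add]; congr 1; ring
    rw [e]
    calc _ ≤ Real.exp (a * κ ^ 2) * (C * (K * Real.exp (a * κ ^ 2)
            * Real.exp (-(4 * a * κ ^ 2)))) := by
          have := waveScale_pow_le μ κ ha
          gcongr
      _ = _ := by ring
  refine (lintegral_mono hpt).trans ?_
  rw [lintegral_const_mul' _ _ ENNReal.ofReal_ne_top, lintegral_gaussian (by positivity),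
    ← ENNReal.ofReal_mul (by positivity)]
  exact ENNReal.ofReal_le_ofReal (by rw [mul_assoc])

end GridError

/-! ### Convergence of the grid solution -/

section Convergence

variable {ν : Measure ℝ} [IsFiniteMeasure ν]

lemma integrable_errorSymbol_parts {μ ρ k h : ℝ} (hρ : ρ < 1) {n : ℕ} (hnk : 0 < n * k)
    (z : ℕ → ℝ) :
    IntegrableOn (fun κ => hatFourier h ν κ * ∏ i ∈ Finset.range n, ampFactor μ ρ κ k h (z i))
        (Set.Icc (-(Real.pi / h)) (Real.pi / h)) ∧
      Integrable fun κ => fourierMeasure ν κ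
        * ∏ i ∈ Finset.range n, Complex.exp (exactExponent μ ρ κ k (√k * z i)) := by
  refine ⟨?_, ?_⟩
  · have h1 : IntegrableOn (hatFourier h ν) (Set.Icc (-(Real.pi / h)) (Real.pi / h)) :=
      Measure.integrableOn_of_bounded measure_Icc_lt_top.ne
        (measurable_hatFourier h ν).aestronglyMeasurable
        (ae_of_all _ fun κ => norm_hatFourier_le (ν := ν) h κ)
    exact h1.mul_continuousOn (continuous_finsetProd _ fun i _ =>
      continuous_ampFactor_waveNumber μ ρ k h (z i)).continuousOn isCompact_Icc
  · simp only [prod_exp_exactExponent]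
    simpa only [mul_comm] using integrable_exp_exactExponent_mul (μ := μ) (ν := ν) hρ hnk
      (√k * ∑ i ∈ Finset.range n, z i)

lemma integrable_errorSymbol {μ ρ k h : ℝ} (hρ : ρ < 1) {n : ℕ} (hnk : 0 < n * k)
    (z : ℕ → ℝ) : Integrable (errorSymbol μ ρ ν k h n z) := by
  obtain ⟨h1, h2⟩ := integrable_errorSymbol_parts (ν := ν) (μ := μ) (h := h) hρ hnk z
  exact (h1.integrable_indicator measurableSet_Icc).sub h2

/-- The error of the grid solution is the inverse Fourier transform of the error symbol. -/
lemma gridSolution_sub_eq_integral {Ω : Type*} [MeasurableSpace Ω] {P : Measure Ω}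
    {M : ℝ≥0 → Ω → ℝ} (hM : IsBrownianReal M P) {v : ℝ → ℝ → Ω → ℝ} {μ ρ : ℝ} (hρ : ρ < 1)
    (hv : IsSPDESolution μ ρ ν M P v) {k h : ℝ} (hk : 0 < k) (hh : 0 < h) {n : ℕ}
    (hnk : 0 < n * k) :
    ∀ᵐ ω ∂P, ∀ j : ℤ,
      ((gridSolution μ ρ k h (fun i => noise M k i ω) (hatProjection h ν) n j
        - v (n * k) (j * h) ω : ℝ) : ℂ)
      = (((2 * Real.pi)⁻¹ : ℝ) : ℂ) * ∫ κ,
        errorSymbol μ ρ ν k h n (fun i => noise M k i ω) κ * mode κ (j * h) := by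
  filter_upwards [hv.eq_integral hρ, prod_exp_exactExponent_noise hM hk n] with ω h1 h2 j
  have h3 := gridSolution_eq_integral μ ρ k h (fun i => noise M k i ω) (K :=
    Set.Icc (-(Real.pi / h)) (Real.pi / h)) (V := hatFourier h ν) isCompact_Icc
    (Measure.integrableOn_of_bounded measure_Icc_lt_top.ne
      (measurable_hatFourier h ν).aestronglyMeasurable
      (ae_of_all _ fun κ => norm_hatFourier_le (ν := ν) h κ))
    (hatProjection_eq_integral (ν := ν) hh) n j
  obtain ⟨i1, i2⟩ := integrable_errorSymbol_parts (ν := ν) (μ := μ) (h := h) hρ hnk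
    fun i => noise M k i ω
  have hm : ∀ {F : ℝ → ℂ}, Integrable F → Integrable fun κ => F κ * mode κ (j * h) := fun hF => by
    have hc : Continuous fun κ => mode κ (j * h) := by unfold mode; fun_prop
    have := hF.bdd_mul hc.aestronglyMeasurable (c := 1) (ae_of_all _ fun κ => (norm_mode _ _).le)
    simpa only [mul_comm] using this
  rw [Complex.ofReal_sub, h3, h1 (n * k) hnk, ← mul_sub]
  congr 1
  simp only [errorSymbol, sub_mul]
  rw [integral_sub (hm (i1.integrable_indicator measurableSet_Icc)) (hm i2)]
  congr 1
  · rw [← integral_indicator measurableSet_Icc]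
    refine integral_congr_ae (ae_of_all _ fun κ => ?_)
    by_cases hκ : κ ∈ Set.Icc (-(Real.pi / h)) (Real.pi / h)
    · simp only [Set.indicator_of_mem hκ]
    · simp only [Set.indicator_of_notMem hκ, zero_mul]
  · simp only [h2]

lemma exists_grid_error_le (μ : ℝ) {ρ : ℝ} (hρ0 : 0 ≤ ρ) (hρ1 : ρ < 1) {lam : ℝ}
    (hlam : (1 + 2 * ρ ^ 2) * lam < 1) {T₀ T : ℝ} (hT₀ : 0 < T₀) (hT : T₀ ≤ T) :
    ∃ δ C : ℝ, 0 < δ ∧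
      ∀ (Ω : Type u) [MeasurableSpace Ω] (P : Measure Ω) (M : ℝ≥0 → Ω → ℝ),
        IsBrownianReal M P →
        ∀ (ν : Measure ℝ) [IsFiniteMeasure ν] (v : ℝ → ℝ → Ω → ℝ),
          IsSPDESolution μ ρ ν M P v →
          ∀ k h : ℝ, 0 < k → 0 < h → h ≤ δ → k ≤ lam * h ^ 2 →
            ∀ n : ℕ, T₀ ≤ n * k → n * k ≤ T →
              rms P (fun ω => gridL2 h (fun j =>
                  gridSolution μ ρ k h (fun i => noise M k i ω) (hatProjection h ν) n j
                    - v (n * k) (j * h) ω))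
                ≤ ENNReal.ofReal (C * ν.real Set.univ * (k + h ^ 2)) ∧
              rms P (fun ω => gridLinf (fun j =>
                  gridSolution μ ρ k h (fun i => noise M k i ω) (hatProjection h ν) n j
                    - v (n * k) (j * h) ω))
                ≤ ENNReal.ofReal (C * ν.real Set.univ * (k + h ^ 2)) := by
  obtain ⟨δ, c, C, hδ0, hδ1, hc0, hc1, hC, hmode⟩ :=
    exists_mode_error_decay.{u} μ hρ0 hρ1 hlam hT₀ hT
  -- A quarter of the available decay rate, leaving room for the weight and the polynomial factor.
  -- It is positive because T₀ > 0: smoothing up to time T₀ is what admits measure data.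
  set a := c * T₀ / 4 with ha
  have ha0 : 0 < a := by positivity
  set K := (1 + |μ|) ^ 16 * (Nat.factorial 16 * Real.exp a / a ^ 16) * √(Real.pi / (2 * a)) with hK
  have hK0 : 0 ≤ K := by positivity
  set A := 4 * √(Real.pi / a) * Real.exp a with hA
  have hA0 : 0 ≤ A := by positivity
  -- One constant then serves both norms, and both reduce to the same bound `hSint`.
  have hAA : √(Real.pi / a) ≤ A := by
    have h1 := Real.one_le_exp ha0.le
    have h2 := Real.sqrt_nonneg (Real.pi / a)
    nlinarith
  refine ⟨δ, √(A * (2 * C + 18) * K), hδ0, ?_⟩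
  intro Ω _ P M hM ν _ v hv k h hk hh hhδ hklam n hn₀ hnT
  have hnk : 0 < n * k := hT₀.trans_le hn₀
  have hlaw := fun i => hasLaw_noise hM hk i
  have : IsProbabilityMeasure P := (hlaw 0).isProbabilityMeasure
  set N := ν.real Set.univ with hN
  have hN0 : 0 ≤ N := measureReal_nonneg
  set S : Ω → ℝ≥0∞ := fun ω => ∫⁻ κ, ENNReal.ofReal (Real.exp (a * κ ^ 2))
    * ‖errorSymbol μ ρ ν k h n (fun i => noise M k i ω) κ‖ₑ ^ 2 with hS
  have hSint : ENNReal.ofReal A * ∫⁻ ω, S ω ∂P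
      ≤ ENNReal.ofReal (√(A * (2 * C + 18) * K) * N * (k + h ^ 2)) ^ 2 := by
    have h1 := lintegral_lintegral_errorSymbol_sq_le (ν := ν) (P := P)
      (fun i => (hlaw i).aemeasurable) (μ := μ) (ρ := ρ) (k := k) (h := h) (n := n) ha0
      (C := (2 * C + 18) * N ^ 2 * (k + h ^ 2) ^ 2) (by positivity) fun κ => by
        rw [show 4 * a * κ ^ 2 = c * T₀ * κ ^ 2 by rw [ha]; ring]
        exact lintegral_errorSymbol_sq_le hc1 hc0 hC hT₀ hk hh hn₀ fun hκ =>
          hmode (iIndepFun_noise hM hk) hlaw k h hk hh hhδ hklam n hn₀ hnT κ hκ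
    refine (mul_le_mul_right h1 _).trans_eq ?_
    rw [← ENNReal.ofReal_mul hA0, ← ENNReal.ofReal_pow (by positivity), mul_pow, mul_pow,
      Real.sq_sqrt (by positivity)]
    congr 1; ring
  have hae := gridSolution_sub_eq_integral (ν := ν) hM hρ1 hv hk hh hnk
  have henorm : ∀ x : ℝ, ‖x‖ₑ = ‖(x : ℂ)‖ₑ := fun x => by
    rw [← ofReal_norm, ← ofReal_norm, Complex.norm_real]
  refine ⟨rms_le_of_lintegral_sq_le (le_trans ?_ hSint),
    rms_le_of_lintegral_sq_le (le_trans ?_ hSint)⟩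
  · rw [← lintegral_const_mul' _ _ ENNReal.ofReal_ne_top]
    refine lintegral_mono_ae ?_
    filter_upwards [hae] with ω hω
    rw [gridL2, ← ENNReal.rpow_natCast, ← ENNReal.rpow_mul]
    norm_num only [ENNReal.rpow_one]
    simp only [henorm, hω]
    exact tsum_enorm_fourierInv_sq_le ha0 hh (hhδ.trans hδ1) (integrable_errorSymbol hρ1 hnk _)
  · rw [← lintegral_const_mul' _ _ ENNReal.ofReal_ne_top]
    refine lintegral_mono_ae ?_
    filter_upwards [hae] with ω hω
    have hle : ∀ j : ℤ, ‖gridSolution μ ρ k h (fun i => noise M k i ω) (hatProjection h ν) n j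
        - v (n * k) (j * h) ω‖ₑ ≤ (ENNReal.ofReal A * S ω) ^ (1 / 2 : ℝ) := fun j => by
      have h1 := enorm_fourierInv_sq_le ha0
        (integrable_errorSymbol (ν := ν) (μ := μ) (h := h) hρ1 hnk fun i => noise M k i ω) (j * h)
      rw [← hω j, ← henorm] at h1
      have h2 := h1.trans (mul_le_mul_left (ENNReal.ofReal_le_ofReal hAA) _)
      have h3 := ENNReal.rpow_le_rpow h2 (show (0 : ℝ) ≤ 1 / 2 by norm_num)
      rw [← ENNReal.rpow_natCast, ← ENNReal.rpow_mul] at h3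
      norm_num only [ENNReal.rpow_one] at h3
      exact h3
    refine (pow_le_pow_left' (iSup_le hle) 2).trans_eq ?_
    rw [← ENNReal.rpow_natCast, ← ENNReal.rpow_mul]
    norm_num

end Convergence

end MilsteinSPDE

theorem mainTheorem2 (μ ρ : ℝ) (hρ0 : 0 ≤ ρ) (hρ1 : ρ ≤ 1) :
    -- Fourier modes
    (∀ κ : ℝ,
      -- the exact mode: `exactMode μ ρ κ t M_t (x + √ρ M_t)` solves the PDE, for every path `m`
      (∀ m : ℝ → ℝ, SatisfiesPDE μ ρ (fun t x => exactMode μ ρ κ t (m t) (x + √ρ * m t))) ∧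
      -- the discrete mode is multiplied by the amplification factor in each time step
      (∀ k h : ℝ, 0 < k → 0 < h → ∀ (Z : ℕ → ℝ) (n : ℕ) (j : ℤ),
        gridSolution μ ρ k h Z (fun i : ℤ => mode κ (i * h)) n j
          = (∏ i ∈ Finset.range n, ampFactor μ ρ κ k h (Z i)) * mode κ (j * h)) ∧
      ∃ δ : ℝ, 0 < δ ∧
        -- the defining equation of `e_n`
        (∀ k h : ℝ, 0 < k → k ≤ δ → 0 < h → h ≤ δ → ∀ z : ℝ,
          ampFactor μ ρ κ k h z
            = Complex.exp (exactExponent μ ρ κ k (√k * z) + stepError μ ρ κ k h z)) ∧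
        -- the moments of the remainder `r_n`
        (∀ p : ℝ, 1 ≤ p → ∀ Λ : ℝ, ∃ c : ℝ,
          ∀ (Ω : Type u) [MeasurableSpace Ω] (P : Measure Ω) (M : ℝ≥0 → Ω → ℝ),
            IsBrownianReal M P →
            ∀ k h : ℝ, 0 < k → k ≤ δ → 0 < h → h ≤ δ → ρ * h ^ 4 ≤ Λ * k → ∀ n : ℕ,
              ∫⁻ ω, ‖remainder μ ρ κ k h (noise M k n ω)‖ₑ ^ p ∂P
                ≤ ENNReal.ofReal (c * (k ^ 2 + k * h ^ 2) ^ p)) ∧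
        -- the RMS error of the mode over `[0, T]`
        (∀ T : ℝ, 0 < T → ∃ C : ℝ,
          ∀ (Ω : Type u) [MeasurableSpace Ω] (P : Measure Ω) (M : ℝ≥0 → Ω → ℝ),
            IsBrownianReal M P →
            ∀ k h : ℝ, 0 < k → k ≤ δ → 0 < h → h ≤ δ → ∀ n : ℕ, n * k ≤ T →
              rms P (fun ω => ‖∑ i ∈ Finset.range n, stepError μ ρ κ k h (noise M k i ω)‖ₑ)
                ≤ ENNReal.ofReal (C * (k + h ^ 2)) ∧
              ∀ j : ℤ,
                rms P (fun ω =>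
                    ‖gridSolution μ ρ k h (fun i => noise M k i ω)
                        (fun i : ℤ => mode κ (i * h)) n j
                      - exactMode μ ρ κ (n * k) (M (n * k : ℝ).toNNReal ω) (j * h)‖ₑ)
                  ≤ ENNReal.ofReal (C * (k + h ^ 2)))) ∧
    -- RMS `L₂` and `L_∞` errors of the grid solution
    (ρ < 1 → ∀ lam : ℝ, (1 + 2 * ρ ^ 2) * lam < 1 →
      ∀ T₀ T : ℝ, 0 < T₀ → T₀ ≤ T → ∃ δ C : ℝ, 0 < δ ∧
        ∀ (Ω : Type u) [MeasurableSpace Ω] (P : Measure Ω) (M : ℝ≥0 → Ω → ℝ),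
          IsBrownianReal M P →
          ∀ (ν : Measure ℝ) [IsFiniteMeasure ν] (v : ℝ → ℝ → Ω → ℝ),
            IsSPDESolution μ ρ ν M P v →
            ∀ k h : ℝ, 0 < k → 0 < h → h ≤ δ → k ≤ lam * h ^ 2 →
              ∀ n : ℕ, T₀ ≤ n * k → n * k ≤ T →
                rms P (fun ω => gridL2 h (fun j =>
                    gridSolution μ ρ k h (fun i => noise M k i ω) (hatProjection h ν) n j
                      - v (n * k) (j * h) ω))
                  ≤ ENNReal.ofReal (C * ν.real Set.univ * (k + h ^ 2)) ∧
                rms P (fun ω => gridLinf (fun j =>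
                    gridSolution μ ρ k h (fun i => noise M k i ω) (hatProjection h ν) n j
                      - v (n * k) (j * h) ω))
                  ≤ ENNReal.ofReal (C * ν.real Set.univ * (k + h ^ 2))) := by
  refine ⟨fun κ => ⟨satisfiesPDE_exactMode μ ρ κ, fun k h _ _ Z n j => gridSolution_mode μ ρ κ k h Z n j,
    fourierMode_errors μ ρ hρ0 hρ1 κ⟩, fun hρ lam hlam T₀ T hT₀ hT =>
    exists_grid_error_le μ hρ0 hρ hlam hT₀ hT⟩
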